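/- **Concrete sites.** A *concrete site* $(\mathbb C,J)$ is a small category $\mathbb C$ with a terminal object $\star$ and an initial object $0$ such that the functor $|{-}|=\mathbb C(\star,-)$ is faithful, together with, for each object $c$, a set $J(c)$ of families of maps into $c$ (covering families), such that: (C) if $\{f_i:c_i\to c\}\in J(c)$ and $h:d\to c$, there is $\{g_j\}\in J(d)$ such that every $h\circ g_j$ factors through some $f_i$; ($\star$) if $\{f_i\}\in J(c)$, then every point of $c$ factors through some $f_i$; (0) $\emptyset\in J(0)$; (M) $\{1_c\}\in J(c)$; (L) if $\{f_i:c_i\to c\}\in J(c)$ and $\{g_{ij}\}_j\in J(c_i)$ for each $i$, then $\{f_i\circ g_{ij}\}_{i,j}\in J(c)$. $\mathrm{Sh}(\mathbb C,J)$ is the category of sheaves of sets on $(\mathbb C,J)$. A sheaf $X$ is *concrete* if for each $c$ the elements of $X(c)$ are determined by their restrictions along the points of $c$. **Admissible monos.** A class $\mathcal M$ of monos of $\mathbb C$ is *admissible* if: it contains all isomorphisms and all maps $0\to c$; it is closed under composition; all pullbacks of $\mathcal M$-maps exist and are in $\mathcal M$; the presheaf $\Delta_{\mathcal M}(c)=\mathrm{Sub}_{\mathcal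 M}(c)$ of subobjects represented by $\mathcal M$-maps (acting by pullback) is a $J$-sheaf; the map from $\mathrm{Sub}_{\mathcal M}(c)$ to subsets of $|c|$ that sends a subobject to the set of points factoring through it is order-reflecting (hence injective) and its image is closed under unions of $\omega$-chains; and for each $\omega$-chain $(c_n\rightarrowtail c)_n$ in $\mathrm{Sub}_{\mathcal M}(c)$ with supremum $c_\infty\rightarrowtail c$, the closure under precomposition of the set of inclusions $\{c_n\rightarrowtail c_\infty\}$ contains a covering family of $c_\infty$. **Sheaf lifting and completeness.** For admissible $\mathcal M$, the lifting monad $L_{\mathcal M}$ on $\mathrm{Sh}(\mathbb C,J)$ is $L_{\mathcal M}(X)(c)=\coprod_{(c'\rightarrowtail c)\in \mathrm{Sub}_{\mathcal M}(c)}X(c')$, with restriction by pullback, unit given by total elements and multiplication by composing subobjects. It has a natural point $\bot:1\to L_{\mathcal M}X$ given by $0\rightarrowtail c$. Let $\omega$ be the colimit in $\mathrm{Sh}(\mathbb C,J)$ of $1\xrightarrow{\bot}L1\xrightarrow{L\bot}LL1\to\cdots$, $\bar\omega$ the limit of $1\xleftarrow{!}L1\xleftarrow{L!}LL1\leftarrow\cdots$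 (with $L=L_{\mathcal M}$), and $i:\omega\to\bar\omega$ the comparison map. A sheaf $X$ is *$L_{\mathcal M}$-complete* if for every sheaf $A$ every map $\omega\times A\to X$ factors uniquely through $i\times 1_A:\omega\times A\to\bar\omega\times A$. **$\omega$-concrete sheaves.** An *$\omega$-concrete sheaf* $X$ on $(\mathbb C,J)$ is an $\omega$cpo $|X|$ (a poset with suprema of increasing $\omega$-chains, not necessarily with a least element) with, for each $c$, a set $R^c_X$ of functions $|c|\to|X|$, such that $R^c_X$ contains the constant functions; $g\in R^c_X$ and $h:d\to c$ imply $g\circ|h|\in R^d_X$; if $\{f_i:c_i\to c\}\in J(c)$ and $g\circ|f_i|\in R^{c_i}_X$ for all $i$, then $g\in R^c_X$; and $R^c_X$ is closed under pointwise suprema of $\omega$-chains. Morphisms $X\to Y$ are $\omega$-continuous functions $\alpha:|X|\to|Y|$ with $\alpha\circ g\in R^c_Y$ for all $g\in R^c_X$. They form a category $\omega\mathsf{Conc}(\mathbb C,J)$. For admissible $\mathcal M$, the lifting monad $L_{\mathcal M}$ on it has $|L_{\mathcal M}X|=|X|\uplus\{\bot\}$ with $\bot$ least, and $g\in R^c_{L_{\mathcal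 M}X}$ iff there is $m:c'\rightarrowtail c$ in $\mathcal M$ with $g^{-1}(|X|)=\mathrm{Im}|m|$ and $g\circ|m|\in R^{c'}_X$; its unit and multiplication are those of the maybe monad. **The combined site.** Let $V=\omega+1$. The category $\mathbb C+\mathbb V_0$ has the objects of $\mathbb C$ and one more object $V$. Its maps are functions between sets of points, where $|V|=\omega+1$: between objects of $\mathbb C$, the functions $|h|$ for $h$ in $\mathbb C$; from $V$ to $V$, the $\omega$-continuous functions; between $V$ and an object of $\mathbb C$, in either direction, the constant functions (including the empty function out of the empty set). The covering families $J\cup J_V$ are those of $J$ on the objects of $\mathbb C$, and only $\{1_V\}$ on $V$. The class $\mathcal M\cup\mathcal M_V$ consists of $\mathcal M$, the maps $x\mapsto x+n$ on $V$ $(n\in\mathbb N)$, and the maps $0\to V$ for the initial objects $0$ of $\mathbb C$. **Proposition.** Let $(\mathbb C,J)$ be a concrete site with a class $\mathcal M$ of admissible monos. Then $\omega\mathsf{Conc}(\mathbb C,J)$ has all small products and small coproducts and is cartesian closed, $(\mathbb C+\mathbb V_0,J\cup J_V)$ is a concrete site with class of admissible monos $\mathcal M\cup\mathcal M_V$, and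 there is a functor $$F:\omega\mathsf{Conc}(\mathbb C,J)\longrightarrow\mathrm{Sh}(\mathbb C+\mathbb V_0,J\cup J_V)$$ that is full and faithful, preserves small products, small coproducts and exponentials (the canonical comparison maps are isomorphisms), and commutes with the lifting monads: there is a natural isomorphism $F L_{\mathcal M}\cong L_{\mathcal M\cup\mathcal M_V}F$ compatible with the units and the multiplications. Moreover, for every $\omega$-concrete sheaf $X$, $FX$ is a concrete, $L_{\mathcal M\cup\mathcal M_V}$-complete sheaf. -/

import Mathlib

open CategoryTheory Limits Opposite

universe u

noncomputable section

namespace OmegaSheaf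

section Partiality

variable {C : Type u} [SmallCategory C]

/-- A class of monomorphisms containing the isomorphisms, closed under composition, all of whose
pullbacks exist and are again in the class. -/
class StableMonos (M : MorphismProperty C) : Prop where
  mono : ∀ {c d : C} (m : c ⟶ d), M m → Mono m
  iso : ∀ {c d : C} (m : c ⟶ d), IsIso m → M m
  comp : ∀ {b c d : C} (m : b ⟶ c) (n : c ⟶ d), M m → M n → M (m ≫ n)
  hasPullback : ∀ {b c d : C} (m : b ⟶ d) (f : c ⟶ d), M m → HasPullback m f
  pullback : ∀ {a b c d : C} {k : a ⟶ b} {n : a ⟶ c} {m : b ⟶ d} {f : c ⟶ d},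
    IsPullback k n m f → M m → M n

/-- `Sub_M(c)`: the subobjects of `c` that have a representative in `M` (as `M` contains
the isomorphisms and is closed under composition, the chosen representative is then in `M`). -/
structure MSub (M : MorphismProperty C) (c : C) : Type u where
  sub : Subobject c
  mem : M sub.arrow

/-- The object `c'` of an `M`-subobject `c' ↣ c`. -/
abbrev MSub.obj {M : MorphismProperty C} {c : C} (P : MSub M c) : C := (P.sub : C)

/-- The map of an `M`-subobject `c' ↣ c`. -/
abbrev MSub.arrow {M : MorphismProperty C} {c : C} (P : MSub M c) : P.obj ⟶ c := P.sub.arrow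

/-- A map factors through an `M`-subobject. -/
abbrev MSub.Factors {M : MorphismProperty C} {c d : C} (P : MSub M c) (g : d ⟶ c) : Prop :=
  P.sub.Factors g

/-- The factorization of a map through an `M`-subobject. -/
abbrev MSub.factorThru {M : MorphismProperty C} {c d : C} (P : MSub M c) (g : d ⟶ c)
    (h : P.Factors g) : d ⟶ P.obj := P.sub.factorThru g h

variable {M : MorphismProperty C}

theorem MSub.ext' {c : C} {P Q : MSub M c}
    (h : ∀ {d : C} (g : d ⟶ c), P.Factors g ↔ Q.Factors g) : P = Q := by
  obtain ⟨P, hP⟩ := P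
  obtain ⟨Q, hQ⟩ := Q
  obtain rfl : P = Q :=
    le_antisymm (Subobject.le_of_factors ((h _).1 (Subobject.factors_self _)))
      (Subobject.le_of_factors ((h _).2 (Subobject.factors_self _)))
  rfl

variable (M) in
/-- The elements of `L_M(X)(c)`: an `M`-subobject `c' ↣ c` and an element of `X(c')`. -/
structure LiftElt (X : Cᵒᵖ ⥤ Type u) (c : C) : Type u where
  dom : MSub M c
  val : X.obj (op dom.obj)

namespace LiftElt

variable {X Y Z : Cᵒᵖ ⥤ Type u}

/-- The value of a partial element along a map that factors through its domain. -/
def ev {c d : C} (s : LiftElt M X c) (g : d ⟶ c) (h : s.dom.Factors g) : X.obj (op d) :=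
  X.map (s.dom.factorThru g h).op s.val

theorem ext' {c : C} {s t : LiftElt M X c}
    (h : ∀ {d : C} (g : d ⟶ c), s.dom.Factors g ↔ t.dom.Factors g)
    (h' : ∀ {d : C} (g : d ⟶ c) (hs : s.dom.Factors g) (ht : t.dom.Factors g),
      s.ev g hs = t.ev g ht) : s = t := by
  obtain ⟨P, x⟩ := s
  obtain ⟨Q, y⟩ := t
  obtain rfl : P = Q := MSub.ext' h
  have := h' P.arrow (Subobject.factors_self _) (Subobject.factors_self _)
  simpa [ev, Subobject.factorThru_self] using this

theorem ev_comp {c d e : C} (s : LiftElt M X c) (g : d ⟶ c) (k : e ⟶ d)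
    (h : s.dom.Factors g) (h' : s.dom.Factors (k ≫ g)) :
    s.ev (k ≫ g) h' = X.map k.op (s.ev g h) := by
  have : s.dom.factorThru (k ≫ g) h' = k ≫ s.dom.factorThru g h :=
    (Subobject.factorThru_right k g h).symm
  rw [ev, this, op_comp, Functor.map_comp, types_comp_apply]
  rfl

theorem ev_congr {c d : C} (s : LiftElt M X c) {g g' : d ⟶ c} (e : g = g')
    (h : s.dom.Factors g) : s.ev g h = s.ev g' (e ▸ h) := by
  subst e; rfl

/-- The action of a map of presheaves on partial elements. -/
def map (α : X ⟶ Y) {c : C} (s : LiftElt M X c) : LiftElt M Y c where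
  dom := s.dom
  val := α.app _ s.val

@[simp]
theorem map_dom (α : X ⟶ Y) {c : C} (s : LiftElt M X c) : (map α s).dom = s.dom := rfl

theorem map_ev (α : X ⟶ Y) {c d : C} (s : LiftElt M X c) (g : d ⟶ c)
    (h : s.dom.Factors g) (h' : (map α s).dom.Factors g) :
    (map α s).ev g h' = α.app _ (s.ev g h) :=
  (NatTrans.naturality_apply α (s.dom.factorThru g h).op s.val).symm

end LiftElt

variable [StableMonos M]

/-- The `M`-subobject represented by a map in `M`. -/
def MSub.mk' {c d : C} (m : d ⟶ c) (hm : M m) : MSub M c :=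
  haveI := StableMonos.mono m hm
  ⟨Subobject.mk m, by
    rw [← Subobject.underlyingIso_hom_comp_eq_mk]
    exact StableMonos.comp _ _ (StableMonos.iso _ inferInstance) hm⟩

/-- The canonical isomorphism between the domain of `m` and that of the subobject it represents. -/
def MSub.mk'Iso {c d : C} (m : d ⟶ c) (hm : M m) : (MSub.mk' m hm).obj ≅ d :=
  haveI := StableMonos.mono m hm
  Subobject.underlyingIso m

theorem MSub.mk'Iso_comp {c d : C} (m : d ⟶ c) (hm : M m) :
    (MSub.mk'Iso m hm).hom ≫ m = (MSub.mk' m hm).arrow :=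
  haveI := StableMonos.mono m hm
  Subobject.underlyingIso_hom_comp_eq_mk m

theorem MSub.mk'_factors {c d e : C} (m : d ⟶ c) (hm : M m) (g : e ⟶ c) :
    (MSub.mk' m hm).Factors g ↔ ∃ k : e ⟶ d, k ≫ m = g :=
  haveI := StableMonos.mono m hm
  Subobject.mk_factors_iff m g

theorem MSub.factorThru_mk' {c d e : C} (m : d ⟶ c) (hm : M m) (k : e ⟶ d)
    (h : (MSub.mk' m hm).Factors (k ≫ m)) :
    (MSub.mk' m hm).factorThru (k ≫ m) h ≫ (MSub.mk'Iso m hm).hom = k := by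
  have := StableMonos.mono m hm
  rw [← cancel_mono m, Category.assoc, MSub.mk'Iso_comp, Subobject.factorThru_arrow]

/-- Pullback of `M`-subobjects. -/
def MSub.pull {c d : C} (f : d ⟶ c) (P : MSub M c) : MSub M d :=
  haveI := StableMonos.hasPullback P.arrow f P.mem
  MSub.mk' (pullback.snd P.arrow f) (StableMonos.pullback (IsPullback.of_hasPullback _ _) P.mem)

@[simp]
theorem MSub.pull_factors {c d e : C} (f : d ⟶ c) (P : MSub M c) (g : e ⟶ d) :
    (MSub.pull f P).Factors g ↔ P.Factors (g ≫ f) := by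
  have := StableMonos.hasPullback P.arrow f P.mem
  rw [MSub.pull, MSub.mk'_factors]
  constructor
  · rintro ⟨k, rfl⟩
    rw [Category.assoc, ← pullback.condition, ← Category.assoc]
    exact Subobject.factors_comp_arrow _
  · intro h
    exact ⟨pullback.lift (P.factorThru _ h) g (Subobject.factorThru_arrow _ _ _),
      pullback.lift_snd _ _ _⟩

variable (M) in
/-- The presheaf `Δ_M` of `M`-subobjects. -/
def dominance : Cᵒᵖ ⥤ Type u where
  obj c := MSub M c.unop
  map f := TypeCat.ofHom (MSub.pull f.unop)
  map_id c := by
    ext P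
    refine MSub.ext' fun g => ?_
    simp
  map_comp f g := by
    ext P
    refine MSub.ext' fun g => ?_
    simp

/-- `M` is a class of pre-admissible monos for the site `(C, J)`: moreover `Δ_M` is a sheaf. -/
class PreAdmissible (J : GrothendieckTopology C) (M : MorphismProperty C) : Prop
    extends StableMonos M where
  isSheaf : Presieve.IsSheaf J (dominance M)

namespace LiftElt

variable {X Y Z : Cᵒᵖ ⥤ Type u}

/-- Restriction of partial elements. -/
def res {c d : C} (f : d ⟶ c) (s : LiftElt M X c) : LiftElt M X d where
  dom := MSub.pull f s.dom
  val := s.ev ((MSub.pull f s.dom).arrow ≫ f)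
    ((MSub.pull_factors f s.dom _).1 (Subobject.factors_self _))

@[simp]
theorem res_dom {c d : C} (f : d ⟶ c) (s : LiftElt M X c) :
    (res f s).dom = MSub.pull f s.dom := rfl

theorem res_ev {c d e : C} (f : d ⟶ c) (s : LiftElt M X c) (g : e ⟶ d)
    (h : (res f s).dom.Factors g) :
    (res f s).ev g h = s.ev (g ≫ f) ((MSub.pull_factors f s.dom g).1 h) := by
  have : (g ≫ f) = (MSub.pull f s.dom).factorThru g h ≫ (MSub.pull f s.dom).arrow ≫ f :=
    ((Category.assoc _ _ _).symm.trans (by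
      rw [Subobject.factorThru_arrow (MSub.pull f s.dom).sub g h])).symm
  rw [s.ev_congr this, ev_comp]
  rfl

/-- The partial element with a given domain `m` in `M` and a given value. -/
def mk' {c d : C} (m : d ⟶ c) (hm : M m) (x : X.obj (op d)) : LiftElt M X c where
  dom := MSub.mk' m hm
  val := X.map (MSub.mk'Iso m hm).hom.op x

theorem mk'_factors {c d e : C} (m : d ⟶ c) (hm : M m) (x : X.obj (op d)) (g : e ⟶ c) :
    (mk' m hm x).dom.Factors g ↔ ∃ k : e ⟶ d, k ≫ m = g := MSub.mk'_factors m hm g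

theorem mk'_ev {c d e : C} (m : d ⟶ c) (hm : M m) (x : X.obj (op d)) (k : e ⟶ d)
    (h : (mk' m hm x).dom.Factors (k ≫ m)) : (mk' m hm x).ev (k ≫ m) h = X.map k.op x := by
  have := MSub.factorThru_mk' m hm k h
  conv_rhs => rw [← this, op_comp, Functor.map_comp, types_comp_apply]
  rfl

/-- The unit: total elements are partial elements with full domain. -/
def unit {c : C} (x : X.obj (op c)) : LiftElt M X c :=
  mk' (𝟙 c) (StableMonos.iso _ inferInstance) x

theorem unit_factors {c d : C} (x : X.obj (op c)) (g : d ⟶ c) :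
    (unit (M := M) x).dom.Factors g :=
  (mk'_factors _ _ _ _).2 ⟨g, Category.comp_id g⟩

theorem unit_ev {c d : C} (x : X.obj (op c)) (g : d ⟶ c)
    (h : (unit (M := M) x).dom.Factors g) : (unit (M := M) x).ev g h = X.map g.op x := by
  rw [ev_congr _ (Category.comp_id g).symm]
  exact mk'_ev _ _ _ _ _

end LiftElt

variable (M) in
/-- The presheaf `L_M(X)`, with `L_M(X)(c) = ∐ X(c')`, the coproduct being taken over the
`M`-subobjects `c' ↣ c`. -/
def liftPresheaf (X : Cᵒᵖ ⥤ Type u) : Cᵒᵖ ⥤ Type u where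
  obj c := LiftElt M X c.unop
  map f := TypeCat.ofHom (LiftElt.res f.unop)
  map_id c := by
    ext s
    refine LiftElt.ext' (fun g => by simp) (fun g hs ht => ?_)
    exact (LiftElt.res_ev _ s g hs).trans (s.ev_congr (by simp) _)
  map_comp f g := by
    ext s
    refine LiftElt.ext' (fun g => by simp) (fun k hs ht => ?_)
    refine (LiftElt.res_ev _ s k hs).trans ?_
    refine Eq.trans ?_ (LiftElt.res_ev g.unop (LiftElt.res f.unop s) k ht).symm
    rw [LiftElt.res_ev]
    exact s.ev_congr (by simp) _

/-- Composition of a partial element of `X` with an `M`-subobject containing its domain. -/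
def LiftElt.extend {X : Cᵒᵖ ⥤ Type u} {c : C} (P : MSub M c) (t : LiftElt M X P.obj) :
    LiftElt M X c :=
  mk' (t.dom.arrow ≫ P.arrow) (StableMonos.comp _ _ t.dom.mem P.mem) t.val

theorem LiftElt.extend_factors {X : Cᵒᵖ ⥤ Type u} {c d : C} (P : MSub M c)
    (t : LiftElt M X P.obj) (g : d ⟶ c) :
    (extend P t).dom.Factors g ↔ ∃ h : P.Factors g, t.dom.Factors (P.factorThru g h) := by
  rw [extend, mk'_factors]
  constructor
  · rintro ⟨k, rfl⟩
    have h : P.Factors (k ≫ t.dom.arrow ≫ P.arrow) := by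
      rw [← Category.assoc]; exact Subobject.factors_comp_arrow _
    refine ⟨h, ?_⟩
    have e : P.factorThru (k ≫ t.dom.arrow ≫ P.arrow) h = k ≫ t.dom.arrow := by
      rw [← cancel_mono P.arrow, Subobject.factorThru_arrow, Category.assoc]
    rw [e]
    exact Subobject.factors_comp_arrow _
  · rintro ⟨h, h'⟩
    refine ⟨t.dom.factorThru _ h', ?_⟩
    rw [← Category.assoc, Subobject.factorThru_arrow, Subobject.factorThru_arrow]

theorem LiftElt.extend_ev {X : Cᵒᵖ ⥤ Type u} {c d : C} (P : MSub M c)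
    (t : LiftElt M X P.obj) (g : d ⟶ c) (h : P.Factors g) (h' : t.dom.Factors (P.factorThru g h))
    (h'' : (extend P t).dom.Factors g) : (extend P t).ev g h'' = t.ev (P.factorThru g h) h' := by
  have e : g = t.dom.factorThru _ h' ≫ t.dom.arrow ≫ P.arrow := by
    rw [← Category.assoc, Subobject.factorThru_arrow, Subobject.factorThru_arrow]
  rw [ev_congr _ e]
  exact mk'_ev _ _ _ _ _

/-- The multiplication of `L_M`: compose the two domains of a partial partial element. -/
def LiftElt.join {X : Cᵒᵖ ⥤ Type u} {c : C} (s : LiftElt M (liftPresheaf M X) c) :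
    LiftElt M X c :=
  extend s.dom s.val

/-- An element of `L_M(L_M(X))(c)`, evaluated along a map that factors through its domain. -/
def LiftElt.evLift {X : Cᵒᵖ ⥤ Type u} {c d : C} (s : LiftElt M (liftPresheaf M X) c)
    (g : d ⟶ c) (h : s.dom.Factors g) : LiftElt M X d := s.ev g h

theorem LiftElt.evLift_eq {X : Cᵒᵖ ⥤ Type u} {c d : C} (s : LiftElt M (liftPresheaf M X) c)
    (g : d ⟶ c) (h : s.dom.Factors g) :
    s.evLift g h = LiftElt.res (X := X) (s.dom.factorThru g h) s.val := rfl

theorem LiftElt.evLift_congr {X : Cᵒᵖ ⥤ Type u} {c d : C} (s : LiftElt M (liftPresheaf M X) c)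
    {g g' : d ⟶ c} (e : g = g') (h : s.dom.Factors g) :
    s.evLift g h = s.evLift g' (e ▸ h) := ev_congr s e h

theorem LiftElt.join_factors {X : Cᵒᵖ ⥤ Type u} {c d : C}
    (s : LiftElt M (liftPresheaf M X) c) (g : d ⟶ c) :
    s.join.dom.Factors g ↔ ∃ h : s.dom.Factors g, (s.evLift g h).dom.Factors (𝟙 d) := by
  refine (extend_factors (X := X) s.dom s.val g).trans ?_
  refine exists_congr fun h => ?_
  rw [evLift_eq]
  refine Iff.trans ?_ (MSub.pull_factors _ (LiftElt.dom (X := X) s.val) _).symm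
  rw [Category.id_comp]

theorem LiftElt.join_ev {X : Cᵒᵖ ⥤ Type u} {c d : C}
    (s : LiftElt M (liftPresheaf M X) c) (g : d ⟶ c) (h : s.dom.Factors g)
    (h' : (s.evLift g h).dom.Factors (𝟙 d)) (h'' : s.join.dom.Factors g) :
    s.join.ev g h'' = (s.evLift g h).ev (𝟙 d) h' := by
  have e := res_ev (X := X) (s.dom.factorThru g h) s.val (𝟙 d) h'
  refine Eq.trans ?_ e.symm
  have k : LiftElt.dom (X := X) s.val |>.Factors (s.dom.factorThru g h) := by
    rw [← Category.id_comp (s.dom.factorThru g h)]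
    exact (MSub.pull_factors _ _ _).1 h'
  refine (extend_ev (X := X) s.dom s.val g h k h'').trans ?_
  exact ev_congr _ (by simp) _

theorem LiftElt.map_res {X Y : Cᵒᵖ ⥤ Type u} (α : X ⟶ Y) {c d : C} (f : d ⟶ c)
    (s : LiftElt M X c) : map α (res f s) = res f (map α s) := by
  refine ext' (fun g => Iff.rfl) (fun g hs ht => ?_)
  rw [map_ev α (res f s) g hs hs, res_ev f s g hs, res_ev]
  exact (map_ev _ _ _ _ _).symm

theorem LiftElt.map_unit {X Y : Cᵒᵖ ⥤ Type u} (α : X ⟶ Y) {c : C} (x : X.obj (op c)) :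
    map α (unit (M := M) x) = unit (α.app _ x) := by
  refine ext' (fun g => iff_of_true (unit_factors x g) (unit_factors (α.app _ x) g))
    (fun g hs ht => ?_)
  rw [map_ev α _ g (unit_factors x g) hs, unit_ev, unit_ev]
  exact NatTrans.naturality_apply α g.op x

theorem LiftElt.unit_res {X : Cᵒᵖ ⥤ Type u} {c d : C} (f : d ⟶ c) (x : X.obj (op c)) :
    unit (M := M) (X.map f.op x) = res f (unit x) := by
  refine ext' (fun g => iff_of_true (unit_factors _ _)
    ((MSub.pull_factors _ _ _).2 (unit_factors _ _))) (fun g hs ht => ?_)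
  rw [unit_ev, res_ev, unit_ev, op_comp, Functor.map_comp, types_comp_apply]

theorem LiftElt.join_res {X : Cᵒᵖ ⥤ Type u} {c d : C} (f : d ⟶ c)
    (s : LiftElt M (liftPresheaf M X) c) : (res f s).join = res f s.join := by
  have key : ∀ {e : C} (g : e ⟶ d) (h : (res f s).dom.Factors g) (h' : s.dom.Factors (g ≫ f)),
      (res f s).evLift g h = s.evLift (g ≫ f) h' := fun g h h' => res_ev f s g h
  refine ext' (fun g => ?_) (fun g hs ht => ?_)
  · rw [res_dom, MSub.pull_factors, join_factors, join_factors]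
    constructor
    · rintro ⟨h, h'⟩
      have h2 := (MSub.pull_factors _ _ _).1 h
      exact ⟨h2, key g h h2 ▸ h'⟩
    · rintro ⟨h, h'⟩
      have h2 : (res f s).dom.Factors g := (MSub.pull_factors _ _ _).2 h
      exact ⟨h2, (key g h2 h).symm ▸ h'⟩
  · obtain ⟨h, h'⟩ := (join_factors _ _).1 hs
    rw [res_ev, join_ev _ g h h']
    have h2 := (MSub.pull_factors _ _ _).1 h
    have e := key g h h2
    generalize evLift (res f s) g h = w at e h'
    subst e
    exact (join_ev _ _ h2 h' _).symm

/-- `L_M` on maps of presheaves. -/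
def liftPresheafMap {X Y : Cᵒᵖ ⥤ Type u} (α : X ⟶ Y) : liftPresheaf M X ⟶ liftPresheaf M Y where
  app c := TypeCat.ofHom (LiftElt.map α)
  naturality c d f := by
    ext s
    exact LiftElt.map_res α f.unop s

theorem LiftElt.join_map {X Y : Cᵒᵖ ⥤ Type u} (α : X ⟶ Y) {c : C}
    (s : LiftElt M (liftPresheaf M X) c) :
    join (map (liftPresheafMap α) s) = map α (join s) := by
  have key : ∀ {e : C} (g : e ⟶ c) (h : s.dom.Factors g),
      evLift (map (liftPresheafMap α) s) g h = map α (s.evLift g h) :=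
    fun g h => map_ev (liftPresheafMap α) s g h h
  refine ext' (fun g => ?_) (fun g hs ht => ?_)
  · rw [map_dom, join_factors, join_factors]
    refine exists_congr fun h => ?_
    rw [key g h, map_dom]
  · obtain ⟨h, h'⟩ := (join_factors _ _).1 hs
    have h0 : s.dom.Factors g := h
    rw [join_ev _ g h h', map_ev α s.join g ht ht]
    have e := key g h0
    generalize evLift (map (liftPresheafMap α) s) g h = w at e h'
    subst e
    rw [map_ev α (s.evLift g h0) (𝟙 _) h' h', join_ev s g h0 h' ht]

variable (M) in
/-- The unit of `L_M`, on presheaves. -/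
def liftPresheafUnit (X : Cᵒᵖ ⥤ Type u) : X ⟶ liftPresheaf M X where
  app c := TypeCat.ofHom LiftElt.unit
  naturality c d f := by
    ext x
    exact LiftElt.unit_res f.unop x

variable (M) in
/-- The multiplication of `L_M`, on presheaves. -/
def liftPresheafMul (X : Cᵒᵖ ⥤ Type u) :
    liftPresheaf M (liftPresheaf M X) ⟶ liftPresheaf M X where
  app c := TypeCat.ofHom LiftElt.join
  naturality c d f := by
    ext s
    exact LiftElt.join_res f.unop s

theorem lift_left_unit {X : Cᵒᵖ ⥤ Type u} {c : C} (s : LiftElt M X c) :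
    LiftElt.join (LiftElt.unit (X := liftPresheaf M X) s) = s := by
  have key : ∀ {d : C} (g : d ⟶ c)
      (h : (LiftElt.unit (M := M) (X := liftPresheaf M X) s).dom.Factors g),
      (LiftElt.unit (X := liftPresheaf M X) s).evLift g h = LiftElt.res g s :=
    fun g h => LiftElt.unit_ev (X := liftPresheaf M X) s g h
  refine LiftElt.ext' (fun g => ?_) (fun g hs ht => ?_)
  · rw [LiftElt.join_factors]
    simp only [key, LiftElt.res_dom, MSub.pull_factors, Category.id_comp, exists_prop]
    exact and_iff_right (LiftElt.unit_factors (X := liftPresheaf M X) s g)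
  · obtain ⟨h, h'⟩ := (LiftElt.join_factors _ _).1 hs
    rw [LiftElt.join_ev _ g h h']
    have e := key g h
    generalize LiftElt.evLift _ g h = w at e h'
    subst e
    rw [LiftElt.res_ev]
    exact LiftElt.ev_congr _ (by simp) _

theorem lift_right_unit {X : Cᵒᵖ ⥤ Type u} {c : C} (s : LiftElt M X c) :
    LiftElt.join (LiftElt.map (liftPresheafUnit M X) s) = s := by
  have key : ∀ {d : C} (g : d ⟶ c) (h : s.dom.Factors g),
      (LiftElt.map (liftPresheafUnit M X) s).evLift g h = LiftElt.unit (s.ev g h) :=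
    fun g h => LiftElt.map_ev (liftPresheafUnit M X) s g h h
  refine LiftElt.ext' (fun g => ?_) (fun g hs ht => ?_)
  · rw [LiftElt.join_factors]
    constructor
    · rintro ⟨h, -⟩
      exact h
    · intro h
      refine ⟨h, ?_⟩
      rw [key g h]
      exact LiftElt.unit_factors _ _
  · obtain ⟨h, h'⟩ := (LiftElt.join_factors _ _).1 hs
    rw [LiftElt.join_ev _ g h h']
    have e := key g h
    generalize LiftElt.evLift _ g h = w at e h'
    subst e
    rw [LiftElt.unit_ev]
    simp

theorem lift_assoc {X : Cᵒᵖ ⥤ Type u} {c : C}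
    (s : LiftElt M (liftPresheaf M (liftPresheaf M X)) c) :
    LiftElt.join (LiftElt.map (liftPresheafMul M X) s) = LiftElt.join (LiftElt.join s) := by
  have key : ∀ {d : C} (g : d ⟶ c) (h : s.dom.Factors g),
      (LiftElt.map (liftPresheafMul M X) s).evLift g h = LiftElt.join (s.evLift g h) :=
    fun g h => LiftElt.map_ev (liftPresheafMul M X) s g h h
  have key' : ∀ {d : C} (g : d ⟶ c) (h : s.dom.Factors g)
      (h' : (s.evLift g h).dom.Factors (𝟙 d)) (h'' : s.join.dom.Factors g),
      s.join.evLift g h'' = (s.evLift g h).evLift (𝟙 d) h' :=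
    fun g h h' h'' => LiftElt.join_ev s g h h' h''
  refine LiftElt.ext' (fun g => ?_) (fun g hs ht => ?_)
  · rw [LiftElt.join_factors, LiftElt.join_factors]
    constructor
    · rintro ⟨h, h'⟩
      rw [key g h, LiftElt.join_factors] at h'
      obtain ⟨h1, h2⟩ := h'
      refine ⟨(LiftElt.join_factors _ _).2 ⟨h, h1⟩, ?_⟩
      rw [key' g h h1]
      exact h2
    · rintro ⟨h, h'⟩
      obtain ⟨h1, h2⟩ := (LiftElt.join_factors _ _).1 h
      refine ⟨h1, ?_⟩
      rw [key g h1, LiftElt.join_factors]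
      refine ⟨h2, ?_⟩
      rw [key' g h1 h2] at h'
      exact h'
  · obtain ⟨h, h'⟩ := (LiftElt.join_factors _ _).1 hs
    obtain ⟨k, k'⟩ := (LiftElt.join_factors _ _).1 ht
    rw [LiftElt.join_ev _ g h h', LiftElt.join_ev _ g k k']
    obtain ⟨h1, h2⟩ := (LiftElt.join_factors _ _).1 k
    have e := key g h1
    have e' := key' g h1 h2 k
    generalize LiftElt.evLift s.join g k = w' at e' k'
    generalize LiftElt.evLift (LiftElt.map (liftPresheafMul M X) s) g h = w at e h'
    subst e e'
    exact LiftElt.join_ev _ _ _ _ _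

end Partiality

section PartialitySheaf

variable {C : Type u} [SmallCategory C] {M : MorphismProperty C} {J : GrothendieckTopology C}

theorem liftPresheaf_isSheaf [hM : PreAdmissible J M] (X : Cᵒᵖ ⥤ Type u)
    (hX : Presieve.IsSheaf J X) : Presieve.IsSheaf J (liftPresheaf M X) := by
  intro c T hT s hs
  rw [Presieve.compatible_iff_sieveCompatible] at hs
  let s' : ∀ {d : C} (f : d ⟶ c), T f → LiftElt M X d := fun f hf => s f hf
  have hs' : ∀ {d e : C} (f : d ⟶ c) (g : e ⟶ d) (hf : T f),
      s' (g ≫ f) (T.downward_closed hf g) = LiftElt.res g (s' f hf) :=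
    fun f g hf => hs f g hf
  -- the domain
  let D : Presieve.FamilyOfElements (dominance M) T.arrows := fun d f hf => (s' f hf).dom
  have hD : D.Compatible := by
    rw [Presieve.compatible_iff_sieveCompatible]
    intro d e f g hf
    exact congrArg LiftElt.dom (hs' f g hf)
  obtain ⟨P, hP, hPu⟩ := hM.isSheaf T hT D hD
  change MSub M c at P
  have hP' : ∀ {d : C} (f : d ⟶ c) (hf : T f), MSub.pull f P = (s' f hf).dom :=
    fun f hf => hP f hf
  have one : ∀ {d : C} (g : d ⟶ P.obj) (hf : T (g ≫ P.arrow)),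
      (s' (g ≫ P.arrow) hf).dom.Factors (𝟙 d) := by
    intro d g hf
    rw [← hP', MSub.pull_factors, Category.id_comp]
    exact Subobject.factors_comp_arrow _
  -- the value
  have hT' : T.pullback P.arrow ∈ J P.obj := J.pullback_stable _ hT
  let v : Presieve.FamilyOfElements X (T.pullback P.arrow).arrows :=
    fun d g hg => (s' (g ≫ P.arrow) hg).ev (𝟙 d) (one g hg)
  have hv : v.Compatible := by
    rw [Presieve.compatible_iff_sieveCompatible]
    intro d e f g hf
    have h1 : (g ≫ f) ≫ P.arrow = g ≫ f ≫ P.arrow := Category.assoc _ _ _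
    have h2 := hs' (f ≫ P.arrow) g hf
    have h3 : ∀ (k : e ⟶ c) (hk : T k) (h : (s' k hk).dom.Factors (𝟙 e)),
        k = g ≫ f ≫ P.arrow → (s' k hk).ev (𝟙 e) h =
          X.map g.op ((s' (f ≫ P.arrow) hf).ev (𝟙 d) (one f hf)) := by
      rintro k hk h rfl
      generalize s' (g ≫ f ≫ P.arrow) hk = w at h2 h
      subst h2
      rw [LiftElt.res_ev, ← LiftElt.ev_comp _ _ _ _ (by
        rw [Category.comp_id, ← Category.id_comp g]; exact (MSub.pull_factors _ _ _).1 h)]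
      exact LiftElt.ev_congr _ (by simp) _
    exact h3 _ _ _ h1
  obtain ⟨x, hx, hxu⟩ := hX _ hT' v hv
  refine ⟨(⟨P, x⟩ : LiftElt M X c), ?_, ?_⟩
  · intro d f hf
    change LiftElt.res f (⟨P, x⟩ : LiftElt M X c) = s' f hf
    refine LiftElt.ext' (fun g => ?_) (fun g hg ht => ?_)
    · rw [← hP' f hf]; rfl
    · rw [LiftElt.res_ev]
      have h : P.Factors (g ≫ f) := (MSub.pull_factors _ _ _).1 hg
      have e : P.factorThru (g ≫ f) h ≫ P.arrow = g ≫ f := Subobject.factorThru_arrow _ _ _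
      have hT2 : T (P.factorThru (g ≫ f) h ≫ P.arrow) := by
        rw [e]; exact T.downward_closed hf g
      have := hx (P.factorThru (g ≫ f) h) hT2
      refine Eq.trans this ?_
      have h2 := hs' f g hf
      have h3 : ∀ {e : C} (g : e ⟶ d) (k : e ⟶ c) (hk : T k) (h : (s' k hk).dom.Factors (𝟙 e))
          (hg : (s' f hf).dom.Factors g),
          k = g ≫ f → (s' k hk).ev (𝟙 e) h = (s' f hf).ev g hg := by
        rintro e g k hk h hg rfl
        have h2 := hs' f g hf
        generalize s' (g ≫ f) hk = w at h2 h
        subst h2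
        rw [LiftElt.res_ev]
        exact LiftElt.ev_congr _ (by simp) _
      exact h3 _ _ _ _ _ e
  · intro t ht
    change LiftElt M X c at t
    have ht' : ∀ {d : C} (f : d ⟶ c) (hf : T f), LiftElt.res f t = s' f hf :=
      fun f hf => ht f hf
    obtain ⟨Q, y⟩ := t
    obtain rfl : Q = P := hPu Q fun d f hf => congrArg LiftElt.dom (ht' f hf)
    have : y = x := by
      refine hxu y fun d g hg => ?_
      have h1 := ht' (g ≫ Q.arrow) hg
      have h2 := one g hg
      change _ = (s' (g ≫ Q.arrow) hg).ev (𝟙 d) h2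
      generalize s' (g ≫ Q.arrow) hg = w at h1 h2
      subst h1
      rw [LiftElt.res_ev, LiftElt.ev_congr _ (Category.id_comp _)]
      change _ = X.map (Q.factorThru (g ≫ Q.arrow) _).op y
      have h4 : Q.factorThru (g ≫ Q.arrow) (Subobject.factors_comp_arrow _) = g := by
        rw [← cancel_mono Q.arrow, Subobject.factorThru_arrow]
      rw [h4]
    rw [this]

variable (J M) in
/-- The lifting monad `L_M` on the category of sheaves on `(C, J)`. -/
def sheafLift [PreAdmissible J M] : Monad (Sheaf J (Type u)) where
  obj X := ⟨liftPresheaf M X.obj, (isSheaf_iff_isSheaf_of_type J _).2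
    (liftPresheaf_isSheaf X.obj ((isSheaf_iff_isSheaf_of_type J _).1 X.property))⟩
  map α := ⟨liftPresheafMap α.hom⟩
  map_id X := by
    ext c s
    rfl
  map_comp f g := by
    ext c s
    rfl
  η :=
    { app X := ⟨liftPresheafUnit M X.obj⟩
      naturality X Y α := by
        ext c x
        exact (LiftElt.map_unit α.hom x).symm }
  μ :=
    { app X := ⟨liftPresheafMul M X.obj⟩
      naturality X Y α := by
        ext c s
        exact LiftElt.join_map α.hom s }
  assoc X := by
    ext c s
    exact lift_assoc s
  left_unit X := by
    ext c s
    exact lift_left_unit s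
  right_unit X := by
    ext c s
    exact lift_right_unit s

end PartialitySheaf

section Bottom

variable {C : Type u} [SmallCategory C] {M : MorphismProperty C} {J : GrothendieckTopology C}
variable {z : C}

/-- A sheaf has exactly one element over an object that is covered by the empty family. -/
theorem existsUnique_of_empty_cover {X : Cᵒᵖ ⥤ Type u} (hX : Presieve.IsSheaf J X)
    (hzJ : (⊥ : Sieve z) ∈ J z) : ∃! _x : X.obj (op z), True := by
  obtain ⟨x, -, hu⟩ := hX ⊥ hzJ (fun _ _ h => h.elim) (fun _ _ _ _ _ _ _ h => h.elim)
  exact ⟨x, trivial, fun y _ => hu y fun _ _ h => h.elim⟩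

variable [PreAdmissible J M]

/-- The element `(0 ↣ c, *)` of `L_M(X)(c)`, where `*` is the unique element of `X(0)`. -/
def botElt (hz : IsInitial z) (hzJ : (⊥ : Sieve z) ∈ J z) (hzM : ∀ c, M (hz.to c))
    (X : Sheaf J (Type u)) (c : C) : LiftElt M X.obj c :=
  LiftElt.mk' (hz.to c) (hzM c)
    (existsUnique_of_empty_cover ((isSheaf_iff_isSheaf_of_type J _).1 X.property) hzJ).choose

theorem botElt_factors (hz : IsInitial z) (hzJ : (⊥ : Sieve z) ∈ J z) (hzM : ∀ c, M (hz.to c))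
    (X : Sheaf J (Type u)) {c d : C} (g : d ⟶ c) :
    (botElt hz hzJ hzM X c).dom.Factors g ↔ Nonempty (d ⟶ z) := by
  rw [botElt, LiftElt.mk'_factors]
  refine ⟨fun ⟨k, _⟩ => ⟨k⟩, fun ⟨k⟩ => ⟨k, ?_⟩⟩
  have hd : (⊥ : Sieve d) ∈ J d := by
    have := J.pullback_stable k hzJ
    rwa [Sieve.pullback_bot] at this
  obtain ⟨P, -, hP⟩ := existsUnique_of_empty_cover (PreAdmissible.isSheaf (J := J) (M := M)) hd
  have e : MSub.mk' (hz.to d) (hzM d) = MSub.mk' (𝟙 d) (StableMonos.iso _ inferInstance) :=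
    (hP _ trivial).trans (hP _ trivial).symm
  obtain ⟨l, hl⟩ := (MSub.mk'_factors (hz.to d) (hzM d) (𝟙 d)).1
    (e ▸ (MSub.mk'_factors _ _ _).2 ⟨𝟙 d, by simp⟩)
  have : l = k := by
    have h1 : k ≫ hz.to d ≫ k = k := by rw [hz.hom_ext (hz.to d ≫ k) (𝟙 z), Category.comp_id]
    have h2 : l ≫ hz.to d ≫ k = k := by rw [← Category.assoc, hl, Category.id_comp]
    have h3 : hz.to d ≫ k = 𝟙 z := hz.hom_ext _ _
    rw [← h2, h3, Category.comp_id]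
  subst this
  rw [hz.hom_ext (hz.to c) (hz.to d ≫ g), ← Category.assoc, hl, Category.id_comp]

theorem botElt_unique (hz : IsInitial z) (hzJ : (⊥ : Sieve z) ∈ J z) (hzM : ∀ c, M (hz.to c))
    (X : Sheaf J (Type u)) {c : C} (s : LiftElt M X.obj c)
    (hs : ∀ {d : C} (g : d ⟶ c), s.dom.Factors g ↔ Nonempty (d ⟶ z)) :
    s = botElt hz hzJ hzM X c := by
  refine LiftElt.ext' (fun g => (hs g).trans (botElt_factors hz hzJ hzM X g).symm)
    (fun {d} g h1 h2 => ?_)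
  obtain ⟨k⟩ := (hs g).1 h1
  have hd : (⊥ : Sieve d) ∈ J d := by
    have := J.pullback_stable k hzJ
    rwa [Sieve.pullback_bot] at this
  obtain ⟨x, -, hx⟩ := existsUnique_of_empty_cover
    ((isSheaf_iff_isSheaf_of_type J _).1 X.property) hd
  exact (hx _ trivial).trans (hx _ trivial).symm

open MonoidalCategory CartesianMonoidalCategory in
variable (M) in
/-- The natural transformation `⊥ : 1 ⟶ L_M` that picks out the nowhere defined elements. -/
def sheafBot (hz : IsInitial z) (hzJ : (⊥ : Sieve z) ∈ J z) (hzM : ∀ c, M (hz.to c)) :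
    (Functor.const (Sheaf J (Type u))).obj (𝟙_ (Sheaf J (Type u))) ⟶
      (sheafLift M J).toFunctor where
  app X := ⟨
    { app c := TypeCat.ofHom fun _ => botElt hz hzJ hzM X c.unop
      naturality c d f := by
        ext _
        refine (botElt_unique hz hzJ hzM X
          (LiftElt.res f.unop (botElt hz hzJ hzM X c.unop)) fun g => ?_).symm
        rw [LiftElt.res_dom, MSub.pull_factors, botElt_factors] }⟩
  naturality X Y α := by
    ext c _
    refine (botElt_unique hz hzJ hzM Y
      (LiftElt.map α.hom (botElt hz hzJ hzM X c.unop)) fun g => ?_).symm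
    rw [LiftElt.map_dom, botElt_factors]

end Bottom

section Completeness

open MonoidalCategory CartesianMonoidalCategory

variable {D : Type*} [Category* D] [CartesianMonoidalCategory D] {L : D ⥤ D}
  (bot : (Functor.const D).obj (𝟙_ D) ⟶ L)

variable (L) in
/-- The objects `1, L1, LL1, …`. -/
def stage : ℕ → D
  | 0 => 𝟙_ D
  | n + 1 => L.obj (stage n)

/-- The maps of the sequence `1 ⟶ L1 ⟶ LL1 ⟶ …`: `⊥_1`, `L(⊥_1)`, `LL(⊥_1)`, …. -/
def stageUp : ∀ n, stage L n ⟶ stage L (n + 1)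
  | 0 => bot.app (𝟙_ D)
  | n + 1 => L.map (stageUp n)

variable (L) in
/-- The maps of the sequence `1 ⟵ L1 ⟵ LL1 ⟵ …`: `!`, `L!`, `LL!`, …. -/
def stageDown : ∀ n, stage L (n + 1) ⟶ stage L n
  | 0 => toUnit _
  | n + 1 => L.map (stageDown n)

/-- The object `ω`: the colimit of `1 ⟶ L1 ⟶ LL1 ⟶ …`. -/
abbrev omegaObj [HasColimitsOfShape ℕ D] : D := colimit (Functor.ofSequence (stageUp bot))

variable (L) in
/-- The object `ω̄`: the limit of `1 ⟵ L1 ⟵ LL1 ⟵ …`. -/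
abbrev omegaBarObj [HasLimitsOfShape ℕᵒᵖ D] : D := limit (Functor.ofOpSequence (stageDown L))

/-- The composites `L^n 1 ⟶ L^m 1` of the maps in the two sequences. -/
def stageMap : ∀ n m, stage L n ⟶ stage L m
  | 0, 0 => 𝟙 _
  | 0, m + 1 => bot.app (stage L m)
  | _ + 1, 0 => toUnit _
  | n + 1, m + 1 => L.map (stageMap n m)

theorem stageUp_stageMap : ∀ n m, stageUp bot n ≫ stageMap bot (n + 1) m = stageMap bot n m
  | 0, 0 => toUnit_unique _ _
  | _ + 1, 0 => toUnit_unique _ _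
  | 0, m + 1 => by
    have := bot.naturality (stageMap bot 0 m)
    simp only [Functor.const_obj_obj, Functor.const_obj_map, Category.id_comp] at this
    exact this.symm
  | n + 1, m + 1 => (L.map_comp _ _).symm.trans (congrArg L.map (stageUp_stageMap n m))

theorem stageMap_stageDown : ∀ n m, stageMap bot n (m + 1) ≫ stageDown L m = stageMap bot n m
  | 0, 0 => toUnit_unique _ _
  | _ + 1, 0 => toUnit_unique _ _
  | 0, m + 1 => by
    have := bot.naturality (stageDown L m)
    simp only [Functor.const_obj_obj, Functor.const_obj_map, Category.id_comp] at this
    exact this.symm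
  | n + 1, m + 1 => (L.map_comp _ _).symm.trans (congrArg L.map (stageMap_stageDown n m))

/-- The maps `L^n 1 ⟶ ω̄`. -/
def stageToOmegaBar [HasLimitsOfShape ℕᵒᵖ D] (n : ℕ) : stage L n ⟶ omegaBarObj L :=
  limit.lift (Functor.ofOpSequence (stageDown L))
    { pt := stage L n
      π := NatTrans.ofOpSequence (fun m => stageMap bot n m) (fun m => by
        refine (Category.id_comp _).trans ?_
        rw [Functor.ofOpSequence_map_homOfLE_succ]
        exact (stageMap_stageDown bot n m).symm) }

theorem stageUp_stageToOmegaBar [HasLimitsOfShape ℕᵒᵖ D] (n : ℕ) :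
    stageUp bot n ≫ stageToOmegaBar bot (n + 1) = stageToOmegaBar bot n := by
  refine limit.hom_ext fun m => ?_
  rw [Category.assoc, stageToOmegaBar, stageToOmegaBar, limit.lift_π, limit.lift_π]
  exact stageUp_stageMap bot n m.unop

/-- The comparison map `i : ω ⟶ ω̄`. -/
def omegaComparison [HasColimitsOfShape ℕ D] [HasLimitsOfShape ℕᵒᵖ D] :
    omegaObj bot ⟶ omegaBarObj L :=
  colimit.desc (Functor.ofSequence (stageUp bot))
    { pt := omegaBarObj L
      ι := NatTrans.ofSequence (fun n => stageToOmegaBar bot n) (fun n => by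
        rw [Functor.ofSequence_map_homOfLE_succ]
        exact (stageUp_stageToOmegaBar bot n).trans (Category.comp_id _).symm) }

/-- An object `X` is `L`-complete if it is right orthogonal to `i × A : ω × A ⟶ ω̄ × A` for
every object `A`. -/
def IsComplete [HasColimitsOfShape ℕ D] [HasLimitsOfShape ℕᵒᵖ D] (X : D) : Prop :=
  ∀ (A : D) (f : omegaObj bot ⊗ A ⟶ X),
    ∃! g : omegaBarObj L ⊗ A ⟶ X, (omegaComparison bot ▷ A) ≫ g = f

end Completeness

open OmegaCompletePartialOrder

/-- A concrete site: a small category with a terminal object `star` and an initial object `zero`,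
such that `C(star, -)` is faithful, together with a coverage `J` (the pullback axiom (C) for covering
families is part of `Coverage`) such that covering families contain all points (axiom (⋆)),
the initial object is covered by the empty family (axiom (0)), identities are covering (axiom (M)),
and covering families can be composed (axiom (L)). -/
structure ConcreteSite (C : Type u) [SmallCategory C] where
  star : C
  isTerminal : IsTerminal star
  zero : C
  isInitial : IsInitial zero
  faithful : ∀ {c d : C} (f g : c ⟶ d), (∀ x : star ⟶ c, x ≫ f = x ≫ g) → f = g
  J : Coverage C
  covers_points : ∀ {c : C} (T : Presieve c), T ∈ J c → ∀ x : star ⟶ c,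
    ∃ (d : C) (f : d ⟶ c) (y : star ⟶ d), T f ∧ y ≫ f = x
  empty_mem : (⊥ : Presieve zero) ∈ J zero
  id_mem : ∀ c : C, Presieve.singleton (𝟙 c) ∈ J c
  bind_mem : ∀ {c : C} (T : Presieve c) (R : ∀ ⦃d : C⦄ ⦃f : d ⟶ c⦄, T f → Presieve d),
    T ∈ J c → (∀ ⦃d : C⦄ ⦃f : d ⟶ c⦄ (hf : T f), R hf ∈ J d) → T.bind R ∈ J c

namespace ConcreteSite

variable {C : Type u} [SmallCategory C] (S : ConcreteSite C)

/-- The set of points `|c|`. -/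
abbrev Pts (c : C) : Type u := S.star ⟶ c

/-- The Grothendieck topology generated by the coverage. It has the same sheaves as the coverage,
see `CategoryTheory.Presieve.isSheaf_coverage`. -/
abbrev topology : GrothendieckTopology C := S.J.toGrothendieck

/-- The category of sheaves on a concrete site. -/
abbrev Sh := Sheaf S.topology (Type u)

theorem empty_mem_topology : (⊥ : Sieve S.zero) ∈ S.topology S.zero := by
  have := Coverage.Saturate.of (K := S.J) _ _ S.empty_mem
  rwa [show Sieve.generate (⊥ : Presieve S.zero) = ⊥ from Sieve.generate_bot] at this

/-- A sheaf is concrete if its elements over `c` are determined by their restrictions along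
the points of `c`. -/
def IsConcrete (X : S.Sh) : Prop :=
  ∀ c : C, Function.Injective
    (fun (s : X.obj.obj (op c)) (x : S.Pts c) => (X.obj.map x.op s : X.obj.obj (op S.star)))

/-- A class of admissible monos: a class of pre-admissible monos containing all maps `0 ⟶ c`,
such that the map from `Sub_M(c)` to subsets of `|c|` is order-reflecting (hence injective),
its image is closed under suprema of `ω`-chains, and for each increasing chain
`c_n ↣ c` with supremum `c_∞ ↣ c` the closure under precomposition of the set of the inclusions
`c_n ↣ c_∞` contains a covering family of `c_∞`. -/
class IsAdmissible (M : MorphismProperty C) : Prop extends PreAdmissible S.topology M where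
  zero_mem : ∀ c : C, M (S.isInitial.to c)
  le_of_points : ∀ {c : C} (P Q : MSub M c),
    (∀ x : S.Pts c, P.Factors x → Q.Factors x) → P.sub ≤ Q.sub
  exists_sup : ∀ {c : C} (P : ℕ → MSub M c), (∀ n, (P n).sub ≤ (P (n + 1)).sub) →
    ∃ Q : MSub M c, ∀ x : S.Pts c, Q.Factors x ↔ ∃ n, (P n).Factors x
  sup_cover : ∀ {c : C} (P : ℕ → MSub M c), (∀ n, (P n).sub ≤ (P (n + 1)).sub) →
    ∀ Q : MSub M c, (∀ x : S.Pts c, Q.Factors x ↔ ∃ n, (P n).Factors x) →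
      ∃ T ∈ S.J Q.obj, ∀ ⦃d : C⦄ ⦃f : d ⟶ Q.obj⦄, T f → ∃ n, (P n).Factors (f ≫ Q.arrow)

section

variable (M : MorphismProperty C) [S.IsAdmissible M]

/-- The lifting monad `L_M` on sheaves. -/
abbrev lift : Monad S.Sh := sheafLift M S.topology

/-- The point `⊥ : 1 ⟶ L_M` of the lifting monad. -/
abbrev bot := sheafBot (J := S.topology) M S.isInitial S.empty_mem_topology
  (IsAdmissible.zero_mem (S := S))

/-- `L_M`-complete sheaves. -/
abbrev IsLComplete (X : S.Sh) : Prop := IsComplete (S.bot M) X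

end

/-- The objects of the category `C + V₀`: those of `C` and the vertical natural numbers
`V = ω + 1`. The terminal and the initial object of `V₀` are identified with those of `C`. -/
inductive Comb (S : ConcreteSite C) : Type u
  | of (c : C) : Comb S
  | vert : Comb S

variable {S}

/-- The points of the objects of `C + V₀`. -/
def Comb.Pt : S.Comb → Type u
  | .of c => S.Pts c
  | .vert => ULift.{u} ℕ∞

/-- The functions on points that are maps of `C + V₀`: between objects of `C`, those given by maps
of `C`; from `V` to `V`, the continuous ones; otherwise, the constant ones. -/
def Comb.IsMap : ∀ a b : S.Comb, (a.Pt → b.Pt) → Prop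
  | .of c, .of d, f => ∃ h : c ⟶ d, ∀ x : S.Pts c, f x = x ≫ h
  | .vert, .vert, f => ωScottContinuous fun n : ℕ∞ => (f (ULift.up n)).down
  | .of _, .vert, f => ∃ y, ∀ x, f x = y
  | .vert, .of _, f => ∃ y, ∀ x, f x = y

theorem Comb.isMap_const (a b : S.Comb) (y : b.Pt) : Comb.IsMap a b fun _ => y := by
  cases a <;> cases b
  · refine ⟨S.isTerminal.from _ ≫ y, fun x => ?_⟩
    refine Eq.trans ?_ (Category.assoc _ _ _)
    rw [S.isTerminal.hom_ext (x ≫ _) (𝟙 _)]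
    exact (Category.id_comp _).symm
  · exact ⟨y, fun _ => rfl⟩
  · exact ⟨y, fun _ => rfl⟩
  · exact ωScottContinuous.const

theorem Comb.isMap_id (a : S.Comb) : Comb.IsMap a a fun x => x := by
  cases a
  · exact ⟨𝟙 _, fun x => (Category.comp_id x).symm⟩
  · exact ωScottContinuous.id

theorem Comb.isMap_comp {a b c : S.Comb} {f : a.Pt → b.Pt} {g : b.Pt → c.Pt}
    (hf : Comb.IsMap a b f) (hg : Comb.IsMap b c g) : Comb.IsMap a c fun x => g (f x) := by
  have h1 : (∃ y, ∀ x, f x = y) → Comb.IsMap a c fun x => g (f x) := by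
    rintro ⟨y, hy⟩
    simp only [hy]
    exact isMap_const _ _ _
  have h2 : (∃ y, ∀ x, g x = y) → Comb.IsMap a c fun x => g (f x) := by
    rintro ⟨y, hy⟩
    simp only [hy]
    exact isMap_const _ _ _
  rcases a with a | _ <;> rcases b with b | _ <;> rcases c with c | _
  · obtain ⟨h, hh⟩ := hf
    obtain ⟨k, hk⟩ := hg
    refine ⟨h ≫ k, fun x => ?_⟩
    change g (f x) = _
    rw [hh x, hk (x ≫ h)]
    exact Category.assoc _ _ _
  · exact h2 hg
  · exact h1 hf
  · exact h1 hf
  · exact h1 hf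
  · exact h1 hf
  · exact h2 hg
  · exact ωScottContinuous.comp (α := ℕ∞) (β := ℕ∞) (γ := ℕ∞)
      (g := fun n : ℕ∞ => (g (ULift.up n)).down) (f := fun n : ℕ∞ => (f (ULift.up n)).down) hg hf

instance : SmallCategory S.Comb where
  Hom a b := {f : a.Pt → b.Pt // Comb.IsMap a b f}
  id a := ⟨fun x => x, Comb.isMap_id a⟩
  comp f g := ⟨fun x => g.1 (f.1 x), Comb.isMap_comp f.2 g.2⟩

variable (S)

/-- The embedding of `C` in `C + V₀`. -/
def incl : C ⥤ S.Comb where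
  obj := Comb.of
  map h := ⟨fun x => x ≫ h, h, fun _ => rfl⟩
  map_id _ := Subtype.ext (funext fun x => Category.comp_id x)
  map_comp f g := Subtype.ext (funext fun x => (Category.assoc x f g).symm)

@[ext]
theorem Comb.hom_ext {S : ConcreteSite C} {a b : S.Comb} {f g : a ⟶ b}
    (h : ∀ x, f.1 x = g.1 x) : f = g := Subtype.ext (funext h)

/-- The constant maps of `C + V₀`. -/
def constMap {S : ConcreteSite C} (a : S.Comb) {b : S.Comb} (y : b.Pt) : a ⟶ b :=
  ⟨fun _ => y, Comb.isMap_const a b y⟩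

theorem isEmpty_pts_zero : IsEmpty (S.Pts S.zero) :=
  ⟨fun x => by obtain ⟨_, _, _, h, _⟩ := S.covers_points ⊥ S.empty_mem x; exact h⟩

/-- The covering families of `J ∪ J_V` on `C + V₀`: the objects of `C` have the covering families
of `J` (by axioms (M) and (0), these contain the families of `J_V` on the terminal and the initial
object), and `V` is covered by its identity. -/
def combCoverings : ∀ a : S.Comb, Set (Presieve a)
  | .of c => {T | ∃ R ∈ S.J c, T = R.map S.incl}
  | .vert => {Presieve.singleton (𝟙 _)}

theorem combCoverings_id (a : S.Comb) : Presieve.singleton (𝟙 a) ∈ S.combCoverings a := by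
  cases a with
  | of c => exact ⟨_, S.id_mem c, ((Presieve.map_singleton (F := S.incl) (𝟙 c)).trans
      (by rw [S.incl.map_id]; rfl)).symm⟩
  | vert => rfl

theorem combCoverings_points {a : S.Comb} {T : Presieve a} (hT : T ∈ S.combCoverings a)
    (x : a.Pt) : ∃ (b : S.Comb) (f : b ⟶ a) (y : b.Pt), T f ∧ f.1 y = x := by
  cases a with
  | of c =>
    obtain ⟨R, hR, rfl⟩ := hT
    obtain ⟨d, f, y, hf, hy⟩ := S.covers_points R hR x
    exact ⟨.of d, S.incl.map f, y, Presieve.map_map hf, hy⟩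
  | vert =>
    obtain rfl := hT
    exact ⟨_, 𝟙 _, x, ⟨⟩, rfl⟩

/-- The coverage `J ∪ J_V` on `C + V₀`. -/
def combCoverage : Coverage S.Comb where
  coverings := S.combCoverings
  pullback a b f T hT := by
    have const : (∃ y, ∀ x, f.1 x = y) → ∃ R ∈ S.combCoverings b, R.FactorsThruAlong T f := by
      rintro ⟨y, hy⟩
      obtain ⟨e, g, z, hg, hz⟩ := S.combCoverings_points hT y
      refine ⟨_, S.combCoverings_id b, ?_⟩
      rintro _ _ ⟨⟩
      refine ⟨e, constMap b z, g, hg, Comb.hom_ext fun x => ?_⟩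
      exact hz.trans (hy x).symm
    rcases a with c | _ <;> rcases b with d | _
    · obtain ⟨R, hR, rfl⟩ := hT
      obtain ⟨f, h, hf⟩ := f
      obtain ⟨Q, hQ, hQR⟩ := S.J.pullback h R hR
      refine ⟨Q.map S.incl, ⟨Q, hQ, rfl⟩, ?_⟩
      rintro _ _ ⟨hu⟩
      obtain ⟨e, i, k, hk, hik⟩ := hQR hu
      refine ⟨.of e, S.incl.map i, S.incl.map k, Presieve.map_map hk, ?_⟩
      refine (S.incl.map_comp i k).symm.trans ?_
      rw [hik, S.incl.map_comp]
      exact Comb.hom_ext fun x => (hf _).symm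
    · exact const f.2
    · exact const f.2
    · obtain rfl := hT
      refine ⟨_, S.combCoverings_id .vert, ?_⟩
      rintro _ _ ⟨⟩
      exact ⟨_, f, _, ⟨⟩, by simp⟩

/-- The concrete site `(C + V₀, J ∪ J_V)`. -/
def comb : ConcreteSite S.Comb where
  star := .of S.star
  isTerminal := IsTerminal.ofUniqueHom (fun a => constMap a (𝟙 S.star))
    (fun a m => Comb.hom_ext fun x => S.isTerminal.hom_ext _ _)
  zero := .of S.zero
  isInitial := IsInitial.ofUniqueHom
    (fun a => match a with
      | .of c => S.incl.map (S.isInitial.to c)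
      | .vert => constMap _ (ULift.up 0))
    (fun a m => Comb.hom_ext fun x => (S.isEmpty_pts_zero.false x).elim)
  faithful {a b} f g h := Comb.hom_ext fun x =>
    congrFun (congrArg Subtype.val (h (constMap _ x))) (𝟙 S.star)
  J := S.combCoverage
  covers_points {a} T hT x := by
    obtain ⟨b, f, y, hf, hy⟩ := S.combCoverings_points hT (x.1 (𝟙 S.star))
    refine ⟨b, f, constMap _ y, hf, Comb.hom_ext fun w => ?_⟩
    rw [S.isTerminal.hom_ext w (𝟙 S.star)]
    exact hy
  empty_mem := by
    refine ⟨⊥, S.empty_mem, ?_⟩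
    refine le_antisymm bot_le ?_
    rintro _ _ ⟨h⟩
    exact h
  id_mem := S.combCoverings_id
  bind_mem {a} T R hT hR := by
    cases a with
    | of c =>
      obtain ⟨Q, hQ, rfl⟩ := hT
      have key : ∀ (d : C) (f : d ⟶ c) (hf : Q f),
          ∃ P ∈ S.J d, R (Presieve.map_map (F := S.incl) hf) = P.map S.incl :=
        fun d f hf => hR (Presieve.map_map hf)
      choose P hP hPR using key
      refine ⟨Q.bind fun d f hf => P d f hf, S.bind_mem Q _ hQ fun d f hf => hP d f hf, ?_⟩
      refine le_antisymm ?_ ?_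
      · rintro b _ ⟨d, g, h, ⟨hh⟩, hg, rfl⟩
        rw [hPR _ _ hh] at hg
        obtain ⟨hu⟩ := hg
        have := Presieve.map_map (F := S.incl) (R := Q.bind fun d f hf => P d f hf)
          ⟨_, _, _, hh, hu, rfl⟩
        rw [S.incl.map_comp] at this
        exact this
      · rintro b _ ⟨d, g, h, hh, hg, rfl⟩
        rw [S.incl.map_comp]
        refine ⟨_, _, _, Presieve.map_map hh, ?_, rfl⟩
        rw [hPR _ _ hh]
        exact Presieve.map_map hg
    | vert =>
      obtain rfl := hT
      have h : R ⟨⟩ = Presieve.singleton (𝟙 _) := hR ⟨⟩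
      change _ = _
      refine le_antisymm ?_ ?_
      · rintro b _ ⟨d, g, h, ⟨⟩, hg, rfl⟩
        rw [h] at hg
        obtain ⟨⟩ := hg
        rw [Category.comp_id]
        exact ⟨⟩
      · rintro b _ ⟨⟩
        refine ⟨_, 𝟙 _, 𝟙 _, ⟨⟩, ?_, Category.comp_id _⟩
        rw [h]
        exact ⟨⟩

/-- The class `M ∪ M_V` of maps of `C + V₀`: the maps in `M` between objects of `C`, and the maps
`n + (-) : V ⟶ V` and `0 ⟶ V` (for each initial object `0` of `C`). -/
def combMonos (M : MorphismProperty C) : MorphismProperty S.Comb := fun a b f =>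
  match a, b, f with
  | .of _, .of _, f => ∃ m, M m ∧ f = S.incl.map m
  | .vert, .vert, f => ∃ n : ℕ, ∀ x : ℕ∞, f.1 (ULift.up x) = ULift.up (x + n)
  | .of c, .vert, _ => Nonempty (IsInitial c)
  | .vert, .of _, _ => False

end ConcreteSite

section WithBot

variable {α : Type u} [OmegaCompletePartialOrder α]

theorem exists_shift (c : Chain (WithBot α)) (h : ∃ n, c n ≠ ⊥) :
    ∃ (n : ℕ) (d : Chain α), ∀ k, c (n + k) = (d k : WithBot α) := by
  obtain ⟨n, hn⟩ := h
  have hk : ∀ k, c (n + k) ≠ ⊥ := fun k e =>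
    hn (le_bot_iff.1 (e ▸ c.monotone (Nat.le_add_right n k)))
  refine ⟨n, ⟨⟨fun k => (c (n + k)).unbot (hk k), fun i j hij => ?_⟩⟩, fun k => ?_⟩
  · rw [← WithBot.coe_le_coe, WithBot.coe_unbot, WithBot.coe_unbot]
    exact c.monotone (Nat.add_le_add_left hij n)
  · exact (WithBot.coe_unbot _ _).symm

open Classical in
/-- The `ω`cpo `α ⊎ {⊥}`. -/
instance : OmegaCompletePartialOrder (WithBot α) where
  ωSup c := if h : ∃ n, c n ≠ ⊥ then
    ((ωSup (exists_shift c h).choose_spec.choose : α) : WithBot α) else ⊥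
  le_ωSup c i := by
    split_ifs with h
    · have hs := (exists_shift c h).choose_spec.choose_spec
      refine (c.monotone (Nat.le_add_left i _)).trans ((hs i).le.trans ?_)
      exact WithBot.coe_le_coe.2 (le_ωSup _ i)
    · push Not at h
      exact (h i).le
  ωSup_le c x hx := by
    split_ifs with h
    · have hs := (exists_shift c h).choose_spec.choose_spec
      have hx' := fun k => (hs k) ▸ hx ((exists_shift c h).choose + k)
      cases x with
      | bot => exact absurd (hx' 0) (WithBot.not_coe_le_bot _)
      | coe x => exact WithBot.coe_le_coe.2 (ωSup_le _ _ fun k => WithBot.coe_le_coe.1 (hx' k))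
    · exact bot_le

theorem withBot_ωSup_coe (c : Chain (WithBot α)) (n : ℕ) (d : Chain α)
    (h : ∀ k, c (n + k) = (d k : WithBot α)) : ωSup c = ((ωSup d : α) : WithBot α) := by
  apply le_antisymm
  · refine ωSup_le _ _ fun k => ?_
    exact (c.monotone (Nat.le_add_left k n)).trans
      ((h k).le.trans (WithBot.coe_le_coe.2 (le_ωSup d k)))
  · have h0 : (d 0 : WithBot α) ≤ ωSup c := (h 0) ▸ le_ωSup c (n + 0)
    obtain ⟨y, hy⟩ := WithBot.ne_bot_iff_exists.1
      (fun e => WithBot.not_coe_le_bot (d 0) (e ▸ h0) : ωSup c ≠ ⊥)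
    rw [← hy, WithBot.coe_le_coe]
    refine ωSup_le _ _ fun k => WithBot.coe_le_coe.1 ?_
    rw [hy, ← h k]
    exact le_ωSup c _

theorem withBot_ωSup_ne_bot (c : Chain (WithBot α)) : ωSup c ≠ ⊥ ↔ ∃ n, c n ≠ ⊥ := by
  constructor
  · intro h
    by_contra hn
    push Not at hn
    exact h (le_bot_iff.1 (ωSup_le _ _ fun i => (hn i).le))
  · rintro ⟨n, hn⟩ h
    exact hn (le_bot_iff.1 (h ▸ le_ωSup c n))

theorem withBot_continuous {β : Type u} [OmegaCompletePartialOrder β] {f : WithBot α → β}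
    (hf : ωScottContinuous fun x : α => f x) (hb : ∀ x : α, f ⊥ ≤ f x) :
    ωScottContinuous f := by
  have hm : Monotone f := by
    intro x y hxy
    cases x with
    | bot => cases y with
      | bot => exact le_rfl
      | coe y => exact hb y
    | coe x => cases y with
      | bot => exact absurd hxy (WithBot.not_coe_le_bot _)
      | coe y => exact hf.monotone (WithBot.coe_le_coe.1 hxy)
  refine ωScottContinuous.of_monotone_map_ωSup ⟨hm, fun c => ?_⟩
  refine le_antisymm ?_ (ωSup_le _ _ fun i => hm (le_ωSup c i))
  by_cases h : ∃ n, c n ≠ ⊥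
  · obtain ⟨n, d, hd⟩ := exists_shift c h
    rw [withBot_ωSup_coe c n d hd]
    refine (hf.map_ωSup d).le.trans (ωSup_le _ _ fun k => ?_)
    refine le_trans ?_ (le_ωSup _ (n + k))
    exact (congrArg f (hd k)).ge
  · have h' : ωSup c = ⊥ := by
      by_contra h'
      exact h ((withBot_ωSup_ne_bot c).1 h')
    push Not at h
    rw [h']
    exact (congrArg f (h 0)).ge.trans (le_ωSup (c.map ⟨f, hm⟩) 0)

theorem withBot_coe_continuous : ωScottContinuous fun x : α => (x : WithBot α) :=
  ωScottContinuous.of_monotone_map_ωSup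
    ⟨fun _ _ h => WithBot.coe_le_coe.2 h, fun c =>
      (withBot_ωSup_coe (c.map ⟨_, fun _ _ h => WithBot.coe_le_coe.2 h⟩) 0 c
        (fun k => by rw [Nat.zero_add]; rfl)).symm⟩

end WithBot

/-- A concrete sheaf on a concrete site: a set `|X|` with, for each object `c`, a set `R^c_X` of
functions `|c| → |X|`, such that the constant functions are in `R^c_X`, and the relations are
closed under precomposition with maps of the site and under gluing along covering families. -/
structure ConcreteSheaf {C : Type u} [SmallCategory C] (S : ConcreteSite C) where
  carrier : Type u
  R : ∀ c : C, Set (S.Pts c → carrier)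
  const_mem : ∀ (c : C) (x : carrier), (fun _ => x) ∈ R c
  comp_mem : ∀ {c d : C} (h : d ⟶ c) {g : S.Pts c → carrier}, g ∈ R c →
    (fun x => g (x ≫ h)) ∈ R d
  glue_mem : ∀ {c : C} (T : Presieve c), T ∈ S.J c → ∀ g : S.Pts c → carrier,
    (∀ ⦃d : C⦄ ⦃f : d ⟶ c⦄, T f → (fun x => g (x ≫ f)) ∈ R d) → g ∈ R c

/-- An `ω`-concrete sheaf: a concrete sheaf `X` with an `ω`cpo structure on `|X|` such that each
`R^c_X` is closed under pointwise suprema of `ω`-chains. -/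
structure OmegaConc {C : Type u} [SmallCategory C] (S : ConcreteSite C) extends
    ConcreteSheaf S where
  [cpo : OmegaCompletePartialOrder carrier]
  sup_mem : ∀ {c : C} (s : Chain (S.Pts c → carrier)), (∀ n, s n ∈ R c) → ωSup s ∈ R c

namespace OmegaConc

variable {C : Type u} [SmallCategory C] {S : ConcreteSite C}

attribute [instance] cpo

/-- Morphisms of `ω`-concrete sheaves: continuous functions that preserve the relations. -/
structure Hom (X Y : OmegaConc S) : Type u where
  toFun : X.carrier → Y.carrier
  continuous : ωScottContinuous toFun
  map_mem : ∀ {c : C} {g : S.Pts c → X.carrier}, g ∈ X.R c → (fun x => toFun (g x)) ∈ Y.R c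

instance : Category (OmegaConc S) where
  Hom := Hom
  id X := ⟨fun x => x, ωScottContinuous.id, fun h => h⟩
  comp f g := ⟨fun x => g.toFun (f.toFun x), g.continuous.comp f.continuous,
    fun h => g.map_mem (f.map_mem h)⟩

@[ext]
theorem hom_ext {X Y : OmegaConc S} {f g : X ⟶ Y} (h : ∀ x, f.toFun x = g.toFun x) : f = g := by
  obtain ⟨f, _, _⟩ := f
  obtain ⟨g, _, _⟩ := g
  obtain rfl : f = g := funext h
  rfl

theorem ωSup_apply {ι : Type u} {α : Type u} [OmegaCompletePartialOrder α] (s : Chain (ι → α))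
    (x : ι) : ωSup s x = ωSup (s.map (Pi.evalOrderHom x)) := rfl

/-- The terminal `ω`-concrete sheaf. -/
def unit (S : ConcreteSite C) : OmegaConc S where
  carrier := PUnit
  cpo := { ωSup := fun _ => PUnit.unit, le_ωSup := fun _ _ => le_rfl, ωSup_le := fun _ _ _ => le_rfl }
  R _ := Set.univ
  const_mem _ _ := trivial
  comp_mem _ _ _ := trivial
  glue_mem _ _ _ _ := trivial
  sup_mem _ _ := trivial

/-- The product of two `ω`-concrete sheaves. -/
def prod (X Y : OmegaConc S) : OmegaConc S where
  carrier := X.carrier × Y.carrier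
  R c := {g | (fun x => (g x).1) ∈ X.R c ∧ (fun x => (g x).2) ∈ Y.R c}
  const_mem c x := ⟨X.const_mem c x.1, Y.const_mem c x.2⟩
  comp_mem h _ hg := ⟨X.comp_mem h hg.1, Y.comp_mem h hg.2⟩
  glue_mem T hT _ h := ⟨X.glue_mem T hT _ fun _ _ hf => (h hf).1,
    Y.glue_mem T hT _ fun _ _ hf => (h hf).2⟩
  sup_mem s hs := ⟨X.sup_mem (s.map ⟨fun g x => (g x).1, fun _ _ h x => (h x).1⟩)
      fun n => (hs n).1,
    Y.sup_mem (s.map ⟨fun g x => (g x).2, fun _ _ h x => (h x).2⟩) fun n => (hs n).2⟩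

section

variable {α β γ : Type u} [OmegaCompletePartialOrder α] [OmegaCompletePartialOrder β]
  [OmegaCompletePartialOrder γ]

theorem continuous_fst : ωScottContinuous fun p : α × β => p.1 :=
  ωScottContinuous.of_monotone_map_ωSup ⟨fun _ _ h => h.1, fun _ => rfl⟩

theorem continuous_snd : ωScottContinuous fun p : α × β => p.2 :=
  ωScottContinuous.of_monotone_map_ωSup ⟨fun _ _ h => h.2, fun _ => rfl⟩

theorem continuous_pair {f : γ → α} {g : γ → β} (hf : ωScottContinuous f)
    (hg : ωScottContinuous g) : ωScottContinuous fun x => (f x, g x) :=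
  ωScottContinuous.of_monotone_map_ωSup ⟨fun _ _ h => ⟨hf.monotone h, hg.monotone h⟩,
    fun c => Prod.ext (hf.map_ωSup c) (hg.map_ωSup c)⟩

/-- A pointwise supremum of continuous functions is continuous. -/
theorem continuous_ωSup (s : Chain (α → β)) (hs : ∀ n, ωScottContinuous (s n)) :
    ωScottContinuous (ωSup s) := by
  have hm : Monotone (ωSup s) := fun x y h => ωSup_le_ωSup_of_le fun n =>
    ⟨n, (hs n).monotone h⟩
  refine ωScottContinuous.of_monotone_map_ωSup ⟨hm, fun c => le_antisymm ?_
    (ωSup_le _ _ fun i => hm (le_ωSup c i))⟩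
  refine ωSup_le _ _ fun n => ?_
  change s n (ωSup c) ≤ _
  rw [(hs n).map_ωSup]
  refine ωSup_le _ _ fun i => ?_
  exact (le_ωSup s n (c i)).trans (le_ωSup (c.map ⟨ωSup s, hm⟩) i)

end

/-- The cartesian structure of the category of `ω`-concrete sheaves. -/
instance : CartesianMonoidalCategory (OmegaConc S) :=
  .ofChosenFiniteProducts
    ⟨asEmptyCone (unit S), IsTerminal.ofUniqueHom
      (fun _ => ⟨fun _ => PUnit.unit,
        ωScottContinuous.of_monotone_map_ωSup ⟨fun _ _ _ => le_rfl, fun _ => rfl⟩,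
        fun _ => trivial⟩) (fun _ _ => rfl)⟩
    (fun X Y => ⟨BinaryFan.mk (P := prod X Y)
      ⟨fun p => p.1, continuous_fst, fun h => h.1⟩ ⟨fun p => p.2, continuous_snd, fun h => h.2⟩,
      BinaryFan.isLimitMk
        (fun s => ⟨fun x => (s.fst.toFun x, s.snd.toFun x),
            continuous_pair s.fst.continuous s.snd.continuous,
          fun h => ⟨s.fst.map_mem h, s.snd.map_mem h⟩⟩)
        (fun _ => rfl) (fun _ => rfl)
        (fun _ _ h1 h2 => hom_ext fun x => Prod.ext
          (congrFun (congrArg Hom.toFun h1) x) (congrFun (congrArg Hom.toFun h2) x))⟩)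

instance (X Y : OmegaConc S) : PartialOrder (Hom X Y) :=
  PartialOrder.lift Hom.toFun (fun _ _ h => hom_ext (congrFun h))

/-- The pointwise supremum of a chain of morphisms. -/
def homSup {X Y : OmegaConc S} (s : Chain (Hom X Y)) : Hom X Y where
  toFun := ωSup (s.map ⟨Hom.toFun, fun _ _ h => h⟩)
  continuous := continuous_ωSup _ fun n => (s n).continuous
  map_mem {_ g} hg := Y.sup_mem (s.map ⟨fun f x => f.toFun (g x), fun _ _ h x => h (g x)⟩)
    fun n => (s n).map_mem hg

instance (X Y : OmegaConc S) : OmegaCompletePartialOrder (Hom X Y) where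
  ωSup := homSup
  le_ωSup c i := le_ωSup (c.map ⟨Hom.toFun, fun _ _ h => h⟩) i
  ωSup_le c x h := ωSup_le (c.map ⟨Hom.toFun, fun _ _ h => h⟩) x.toFun h

/-- The exponential of two `ω`-concrete sheaves. -/
def exp (X Y : OmegaConc S) : OmegaConc S where
  carrier := Hom X Y
  R c := {f | ∀ {d : C} (h : d ⟶ c) (g : S.Pts d → X.carrier), g ∈ X.R d →
    (fun x => (f (x ≫ h)).toFun (g x)) ∈ Y.R d}
  const_mem c f d h g hg := f.map_mem hg
  comp_mem h f hf e k g hg := by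
    have := hf (k ≫ h) g hg
    simpa only [Category.assoc] using! this
  glue_mem {c} T hT f hf d h g hg := by
    obtain ⟨Q, hQ, hQT⟩ := S.J.pullback h T hT
    refine Y.glue_mem Q hQ _ fun e k hk => ?_
    obtain ⟨b, i, l, hl, hil⟩ := hQT hk
    have := hf hl i _ (X.comp_mem k hg)
    simpa only [Category.assoc, hil] using! this
  sup_mem s hs _ h g hg := Y.sup_mem
    (s.map ⟨fun f x => (f (x ≫ h)).toFun (g x), fun _ _ l x => l _ _⟩) fun n => hs n h g hg

section

variable {X Y Z : OmegaConc S}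

/-- Currying. -/
def curry (f : Hom (prod X Y) Z) : Hom Y (exp X Z) where
  toFun y :=
    { toFun := fun x => f.toFun (x, y)
      continuous := f.continuous.comp (continuous_pair ωScottContinuous.id ωScottContinuous.const)
      map_mem := fun h => f.map_mem ⟨h, Y.const_mem _ y⟩ }
  continuous := by
    refine ωScottContinuous.of_monotone_map_ωSup
      ⟨fun a b h x => f.continuous.monotone (Prod.mk_le_mk.2 ⟨le_rfl, h⟩), fun c => ?_⟩
    refine hom_ext fun x => ?_
    have : ωScottContinuous fun y => f.toFun (x, y) :=
      f.continuous.comp (continuous_pair ωScottContinuous.const ωScottContinuous.id)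
    exact this.map_ωSup c
  map_mem hg _ h k hk := f.map_mem ⟨hk, Y.comp_mem h hg⟩

/-- Uncurrying. -/
def uncurry (f : Hom Y (exp X Z)) : Hom (prod X Y) Z where
  toFun p := (f.toFun p.2).toFun p.1
  continuous := by
    have hm : Monotone fun p : (prod X Y).carrier => (f.toFun p.2).toFun p.1 := fun p q h =>
      ((f.toFun p.2).continuous.monotone h.1).trans (f.continuous.monotone h.2 q.1)
    refine ωScottContinuous.of_monotone_map_ωSup ⟨hm, fun c => le_antisymm ?_
      (ωSup_le _ _ fun i => hm (le_ωSup c i))⟩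
    change (f.toFun (ωSup (c.map OrderHom.snd))).toFun (ωSup (c.map OrderHom.fst)) ≤ _
    rw [f.continuous.map_ωSup]
    refine ωSup_le _ _ fun n => ?_
    change (f.toFun (c n).2).toFun _ ≤ _
    rw [(f.toFun (c n).2).continuous.map_ωSup]
    refine ωSup_le _ _ fun i => ?_
    refine le_trans ?_ (le_ωSup _ (max n i))
    exact ((f.toFun (c n).2).continuous.monotone (c.monotone (le_max_right n i)).1).trans
      (f.continuous.monotone (c.monotone (le_max_left n i)).2 _)
  map_mem {c g} hg := by
    have := f.map_mem hg.2 (𝟙 c) (fun x => (g x).1) hg.1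
    simpa only [Category.comp_id] using! this

end

open MonoidalCategory in
/-- The category of `ω`-concrete sheaves is cartesian closed. -/
instance : MonoidalClosed (OmegaConc S) where
  closed X :=
    { rightAdj :=
        { obj := exp X
          map f :=
            { toFun := fun h => h ≫ f
              continuous := by
                refine ωScottContinuous.of_monotone_map_ωSup
                  ⟨fun a b h x => f.continuous.monotone (h x), fun c => hom_ext fun x => ?_⟩
                exact f.continuous.map_ωSup
                  (c.map ⟨fun h => h.toFun x, fun _ _ h => h x⟩)
              map_mem := fun hg _ h k hk => f.map_mem (hg h k hk) } }
      adj := Adjunction.mkOfHomEquiv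
        { homEquiv := fun Y Z =>
            { toFun := fun f => curry (X := X) (Y := Y) f
              invFun := fun f => uncurry (X := X) (Y := Y) f
              left_inv := fun _ => rfl
              right_inv := fun _ => rfl } } }

end OmegaConc

namespace OmegaConc

variable {C : Type u} [SmallCategory C] {S : ConcreteSite C} (M : MorphismProperty C)

/-- The relations of `L_M(X)`: a function `|c| → |X| ⊎ {⊥}` is in `R^c` if there is a map
`c' ↣ c` in `M` whose points are the ones where the function is not `⊥`, and the restriction of
the function to `c'` is in the relation of `X`. -/
def liftR (X : OmegaConc S) (c : C) : Set (S.Pts c → WithBot X.carrier) :=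
  {g | ∃ (c' : C) (m : c' ⟶ c), M m ∧ (∀ x : S.Pts c, g x ≠ ⊥ ↔ ∃ y : S.Pts c', y ≫ m = x) ∧
    ∃ g' ∈ X.R c', ∀ y : S.Pts c', g (y ≫ m) = (g' y : WithBot X.carrier)}

variable {M} {X Y : OmegaConc S}

theorem liftR_mk {c : C} {g : S.Pts c → WithBot X.carrier} (P : MSub M c)
    (hP : ∀ x : S.Pts c, P.Factors x ↔ g x ≠ ⊥) (g' : S.Pts P.obj → X.carrier)
    (hg' : g' ∈ X.R P.obj) (h : ∀ y, g (y ≫ P.arrow) = (g' y : WithBot X.carrier)) :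
    g ∈ liftR M X c := by
  refine ⟨_, P.arrow, P.mem, fun x => (hP x).symm.trans ⟨fun hx => ?_, ?_⟩, g', hg', h⟩
  · exact ⟨P.factorThru x hx, Subobject.factorThru_arrow _ _ _⟩
  · rintro ⟨y, rfl⟩
    exact Subobject.factors_comp_arrow _

theorem liftR_map (f : Hom X Y) {c : C} {g : S.Pts c → WithBot X.carrier}
    (hg : g ∈ liftR M X c) : (fun x => WithBot.map f.toFun (g x)) ∈ liftR M Y c := by
  obtain ⟨c', m, hm, h, g', hg', h'⟩ := hg
  refine ⟨c', m, hm, fun x => ?_, _, f.map_mem hg', fun y => ?_⟩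
  · rw [← h x, ne_eq, ne_eq, WithBot.map_eq_bot_iff]
  · change WithBot.map f.toFun (g (y ≫ m)) = _
    rw [h' y, WithBot.map_coe]

variable [S.IsAdmissible M]

theorem liftR_dom {c : C} {g : S.Pts c → WithBot X.carrier} (hg : g ∈ liftR M X c) :
    ∃ P : MSub M c, ∀ x : S.Pts c, P.Factors x ↔ g x ≠ ⊥ := by
  obtain ⟨c', m, hm, h, -⟩ := hg
  exact ⟨MSub.mk' m hm, fun x => (MSub.mk'_factors m hm x).trans (h x).symm⟩

theorem liftR_total {c d : C} {g : S.Pts c → WithBot X.carrier} (hg : g ∈ liftR M X c)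
    (h : d ⟶ c) (hh : ∀ x : S.Pts d, g (x ≫ h) ≠ ⊥) :
    ∃ k ∈ X.R d, ∀ x : S.Pts d, g (x ≫ h) = (k x : WithBot X.carrier) := by
  obtain ⟨c', m, hm, h1, g', hg', h2⟩ := hg
  have h3 : (MSub.mk' (M := M) (𝟙 d) (StableMonos.iso _ inferInstance)).sub ≤
      (MSub.pull h (MSub.mk' m hm)).sub := by
    refine ConcreteSite.IsAdmissible.le_of_points (S := S) _ _ fun x _ => ?_
    rw [MSub.pull_factors, MSub.mk'_factors]
    exact (h1 _).1 (hh x)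
  have h4 : (MSub.mk' m hm).Factors h := by
    have := Subobject.factors_of_le (𝟙 d) h3 ((MSub.mk'_factors _ _ _).2 ⟨𝟙 d, by simp⟩)
    have h5 := (MSub.pull_factors h (MSub.mk' m hm) (𝟙 d)).1 this
    rwa [Category.id_comp] at h5
  obtain ⟨k, rfl⟩ := (MSub.mk'_factors _ _ _).1 h4
  refine ⟨_, X.comp_mem k hg', fun x => ?_⟩
  rw [← h2, Category.assoc]

theorem liftR_coe {c : C} {g : S.Pts c → X.carrier} (hg : g ∈ X.R c) :
    (fun x => (g x : WithBot X.carrier)) ∈ liftR M X c :=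
  ⟨c, 𝟙 c, StableMonos.iso _ inferInstance,
    fun x => iff_of_true (WithBot.coe_ne_bot) ⟨x, Category.comp_id x⟩, g, hg,
    fun y => by rw [Category.comp_id]⟩

theorem liftR_glue {c : C} (T : Presieve c) (hT : T ∈ S.J c) (g : S.Pts c → WithBot X.carrier)
    (h : ∀ ⦃d : C⦄ ⦃f : d ⟶ c⦄, T f → (fun x => g (x ≫ f)) ∈ liftR M X d) :
    g ∈ liftR M X c := by
  have h1 := fun (d : C) (f : d ⟶ c) (hf : T f) => liftR_dom (h hf)
  choose D hD using h1
  have hs := (Presieve.isSheaf_coverage S.J (dominance M)).1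
    (PreAdmissible.isSheaf (J := S.topology)) T hT
  let F : Presieve.FamilyOfElements (dominance M) T := fun d f hf => D d f hf
  have hF : F.Compatible := by
    intro d₁ d₂ e g₁ g₂ f₁ f₂ hf₁ hf₂ e
    change MSub.pull g₁ (D d₁ f₁ hf₁) = MSub.pull g₂ (D d₂ f₂ hf₂)
    have key : ∀ x : S.Pts _, (MSub.pull g₁ (D d₁ f₁ hf₁)).Factors x ↔
        (MSub.pull g₂ (D d₂ f₂ hf₂)).Factors x := by
      intro x
      rw [MSub.pull_factors, MSub.pull_factors, hD, hD, Category.assoc, Category.assoc, e]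
    have h2 := le_antisymm (ConcreteSite.IsAdmissible.le_of_points (S := S) _ _
      fun x => (key x).1) (ConcreteSite.IsAdmissible.le_of_points (S := S) _ _ fun x => (key x).2)
    exact MSub.ext' fun y => by rw [MSub.Factors, MSub.Factors, h2]
  obtain ⟨P, hP, -⟩ := hs F hF
  change MSub M c at P
  have hP' : ∀ {d : C} (f : d ⟶ c) (hf : T f), MSub.pull f P = D d f hf := fun f hf => hP f hf
  have hPg : ∀ x : S.Pts c, P.Factors x ↔ g x ≠ ⊥ := by
    intro x
    obtain ⟨d, f, y, hf, rfl⟩ := S.covers_points T hT x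
    rw [← hD d f hf, ← hP' f hf, MSub.pull_factors]
  have hne : ∀ y : S.Pts P.obj, g (y ≫ P.arrow) ≠ ⊥ := fun y =>
    (hPg _).1 (Subobject.factors_comp_arrow _)
  refine liftR_mk P hPg (fun y => (g (y ≫ P.arrow)).unbot (hne y)) ?_
    (fun y => (WithBot.coe_unbot _ _).symm)
  obtain ⟨Q, hQ, hQT⟩ := S.J.pullback P.arrow T hT
  refine X.glue_mem Q hQ _ fun e k hk => ?_
  obtain ⟨b, i, l, hl, hil⟩ := hQT hk
  have e1 : ∀ x : S.Pts e, (x ≫ i) ≫ l = (x ≫ k) ≫ P.arrow := fun x => by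
    rw [Category.assoc, hil, Category.assoc]
  obtain ⟨r, hr, hr'⟩ := liftR_total (h hl) i fun x => by rw [e1]; exact hne _
  convert hr using 2 with x
  rw [WithBot.unbot_eq_iff, ← hr' x]
  rw [e1]

theorem liftR_sup {c : C} (s : Chain (S.Pts c → WithBot X.carrier))
    (hs : ∀ n, s n ∈ liftR M X c) : ωSup s ∈ liftR M X c := by
  choose D hD using fun n => liftR_dom (hs n)
  have hne : ∀ (x : S.Pts c) {n k : ℕ}, n ≤ k → s n x ≠ ⊥ → s k x ≠ ⊥ := fun x n k hnk h e =>
    h (le_bot_iff.1 (e ▸ s.monotone hnk x))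
  have hmono : ∀ n, (D n).sub ≤ (D (n + 1)).sub := fun n =>
    ConcreteSite.IsAdmissible.le_of_points (S := S) _ _ fun x hx =>
      (hD (n + 1) x).2 (hne x (Nat.le_succ n) ((hD n x).1 hx))
  obtain ⟨Q, hQ⟩ := ConcreteSite.IsAdmissible.exists_sup (S := S) D hmono
  have hQs : ∀ x : S.Pts c, Q.Factors x ↔ ωSup s x ≠ ⊥ := fun x =>
    (hQ x).trans ((exists_congr fun n => hD n x).trans
      (withBot_ωSup_ne_bot (s.map (Pi.evalOrderHom x))).symm)
  have hne' : ∀ y : S.Pts Q.obj, ωSup s (y ≫ Q.arrow) ≠ ⊥ := fun y =>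
    (hQs _).1 (Subobject.factors_comp_arrow _)
  refine liftR_mk Q hQs (fun y => (ωSup s (y ≫ Q.arrow)).unbot (hne' y)) ?_
    (fun y => (WithBot.coe_unbot _ _).symm)
  obtain ⟨T, hT, hT'⟩ := ConcreteSite.IsAdmissible.sup_cover (S := S) D hmono Q hQ
  refine X.glue_mem T hT _ fun d f hf => ?_
  obtain ⟨n, hn⟩ := hT' hf
  have hn' : ∀ (k : ℕ) (x : S.Pts d), s (n + k) (x ≫ f ≫ Q.arrow) ≠ ⊥ := fun k x =>
    hne _ (Nat.le_add_right n k) ((hD n _).1 (Subobject.factors_of_factors_right x hn))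
  choose r hr hr' using fun k => liftR_total (hs (n + k)) (f ≫ Q.arrow) (hn' k)
  have hrm : Monotone r := fun i j hij x => by
    rw [← WithBot.coe_le_coe, ← hr', ← hr']
    exact s.monotone (Nat.add_le_add_left hij n) _
  convert X.sup_mem ⟨r, hrm⟩ hr using 2 with x
  rw [WithBot.unbot_eq_iff]
  refine Eq.trans ?_ (withBot_ωSup_coe (s.map (Pi.evalOrderHom (x ≫ f ≫ Q.arrow))) n _
    fun k => hr' k x)
  rw [Category.assoc]
  rfl

variable (M) in
/-- The `ω`-concrete sheaf `L_M(X)`, with underlying `ω`cpo `|X| ⊎ {⊥}`. -/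
def liftObj (X : OmegaConc S) : OmegaConc S where
  carrier := WithBot X.carrier
  R := liftR M X
  const_mem c x := by
    cases x with
    | bot =>
      have h0 := S.isEmpty_pts_zero
      exact ⟨S.zero, S.isInitial.to c, ConcreteSite.IsAdmissible.zero_mem c,
        fun x => iff_of_false (fun h => h rfl) fun ⟨y, _⟩ => h0.false y,
        fun y => (h0.false y).elim, X.glue_mem ⊥ S.empty_mem _ fun _ _ h => h.elim,
        fun y => (h0.false y).elim⟩
    | coe x => exact liftR_coe (X.const_mem c x)
  comp_mem {c d} h g hg := by
    obtain ⟨P, hP⟩ := liftR_dom hg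
    have hP' : ∀ x : S.Pts d, (MSub.pull h P).Factors x ↔ g (x ≫ h) ≠ ⊥ := fun x =>
      (MSub.pull_factors h P x).trans (hP _)
    obtain ⟨k, hk, hk'⟩ := liftR_total hg ((MSub.pull h P).arrow ≫ h) fun y => by
      rw [← Category.assoc]
      exact (hP' _).1 (Subobject.factors_comp_arrow _)
    exact liftR_mk _ hP' k hk fun y => by rw [← hk' y, Category.assoc]
  glue_mem := liftR_glue
  sup_mem := liftR_sup

theorem withBot_map_continuous {α β : Type u} [OmegaCompletePartialOrder α]
    [OmegaCompletePartialOrder β] {f : α → β} (hf : ωScottContinuous f) :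
    ωScottContinuous (WithBot.map f) :=
  withBot_continuous (withBot_coe_continuous.comp hf) fun _ => bot_le

/-- The multiplication `(α ⊎ {⊥}) ⊎ {⊥} → α ⊎ {⊥}`. -/
def joinFun (α : Type u) : WithBot (WithBot α) → WithBot α := fun x => x.unbotD ⊥

theorem joinFun_continuous {α : Type u} [OmegaCompletePartialOrder α] :
    ωScottContinuous (joinFun α) :=
  withBot_continuous (f := joinFun α) ωScottContinuous.id fun _ => bot_le

theorem liftR_join {c : C} {g : S.Pts c → WithBot (WithBot X.carrier)}
    (hg : g ∈ liftR M (liftObj M X) c) : (fun x => joinFun X.carrier (g x)) ∈ liftR M X c := by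
  obtain ⟨c', m, hm, h, g', ⟨c'', m', hm', k, g'', hg'', k'⟩, h'⟩ := hg
  change S.Pts c' → WithBot X.carrier at g'
  change ∀ y, g (y ≫ m) = ((g' y : WithBot X.carrier) : WithBot (WithBot X.carrier)) at h'
  have e : ∀ y, joinFun X.carrier (g (y ≫ m)) = g' y := fun y => by rw [h' y]; rfl
  refine ⟨c'', m' ≫ m, StableMonos.comp _ _ hm' hm, fun x => ⟨fun hx => ?_, ?_⟩, g'', hg'',
    fun y => ?_⟩
  · change joinFun X.carrier (g x) ≠ ⊥ at hx
    obtain ⟨y, rfl⟩ := (h x).1 fun e => hx (by rw [e]; rfl)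
    rw [e y] at hx
    obtain ⟨z, rfl⟩ := (k y).1 hx
    exact ⟨z, (Category.assoc _ _ _).symm⟩
  · rintro ⟨z, rfl⟩
    change joinFun X.carrier (g _) ≠ ⊥
    rw [← Category.assoc, e, k' z]
    exact WithBot.coe_ne_bot
  · change joinFun X.carrier (g _) = _
    rw [← Category.assoc, e, k' y]

variable (M S) in
/-- The lifting monad `L_M` on `ω`-concrete sheaves. -/
def lift : Monad (OmegaConc S) where
  obj X := liftObj M X
  map f := ⟨WithBot.map f.toFun, withBot_map_continuous f.continuous, liftR_map f⟩
  map_id X := hom_ext fun x => congrFun WithBot.map_id (x : WithBot X.carrier)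
  map_comp f g := hom_ext fun x => (WithBot.map_map g.toFun f.toFun x).symm
  η :=
    { app X := (⟨fun x => (x : WithBot X.carrier), withBot_coe_continuous, liftR_coe⟩ :
        Hom X (liftObj M X))
      naturality _ _ _ := rfl }
  μ :=
    { app X := ⟨joinFun X.carrier, joinFun_continuous, liftR_join⟩
      naturality X Y f := hom_ext fun (x : WithBot (WithBot X.carrier)) => by
        cases x <;> rfl }
  assoc X := hom_ext fun (x : WithBot (WithBot (WithBot X.carrier))) => by
    cases x <;> rfl
  left_unit X := rfl
  right_unit X := hom_ext fun (x : WithBot X.carrier) => by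
    cases x <;> rfl

end OmegaConc

/-- The category of sheaves is cartesian closed. -/
instance {C : Type u} [SmallCategory C] (S : ConcreteSite C) :
    @MonoidalClosed S.Sh _ (@SemiCartesianMonoidalCategory.toMonoidalCategory S.Sh _ _) :=
  inferInstanceAs (MonoidalClosed (Sheaf S.topology (Type u)))

/-- A functor `F` commutes with the monads `T` and `T'`: there is a natural isomorphism
`F T ≅ T' F` that is compatible with the units and the multiplications. -/
def CommutesWithMonads {A B : Type*} [Category* A] [Category* B] (F : A ⥤ B) (T : Monad A)
    (T' : Monad B) : Prop :=
  ∃ e : T.toFunctor ⋙ F ≅ F ⋙ T'.toFunctor,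
    (∀ X : A, F.map (T.η.app X) ≫ e.hom.app X = T'.η.app (F.obj X)) ∧
    (∀ X : A, F.map (T.μ.app X) ≫ e.hom.app X =
      e.hom.app (T.obj X) ≫ T'.map (e.hom.app X) ≫ T'.μ.app (F.obj X))

end OmegaSheaf

end

/-! The sheaf `FX` has as sections over `c` the relation `R^c_X` and as sections over `V` the
continuous functions `ω + 1 → |X|`, that is, the increasing chains together with their suprema.
Adding `V` to the site thus records the order and the suprema of `|X|` as part of a plain sheaf of
sets. Covering families are jointly surjective on points, so sections glue pointwise and `FX` is
concrete. Hence a map `Z ⟶ FX` is the same as a function from the global elements of `Z` to `|X|`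
that sends sections to sections (`realize_hom_ext`, `toRealize`), and most of the proof is carried
out with such functions.

Fullness follows because a function that preserves continuous functions on `ω + 1` is continuous
(`continuous_of_enat`). Products are pointwise. Coproducts are preserved because a continuous
function on `ω + 1` stays in the summand of its value at `0`, while over objects of `C` the summand
is constant on the members of a cover. For exponentials, maps `Z ⟶ F(Y^X)` are compared with maps
`FX × Z ⟶ FY`, using that suprema of morphisms are pointwise.

The class `M ∪ M_V` is handled through sets of points: its subobjects of `a` correspond to the
subsets of `|a|` that are images of its maps, and every factorization question is decided on points
(`combMonos_factors`). On `V` these are the Scott-open sets, namely the empty set and the sets of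
all `x ≥ n` (`isCombOpen_vert`). Admissibility becomes a statement about such open sets. A function
`ω + 1 → |X| ⊎ {⊥}` is continuous exactly when its domain is Scott-open and it is continuous there
(`mem_rel_lift_iff`); this yields the isomorphism of lifting monads.

For completeness, `ω̄` has a section over `V` whose points exhaust its global elements
(`exists_eq_atPt_genericBar`), and the finite points come from `ω` (`atPt_genericBar_natCast`).
Along this section any map into `FX` is continuous in the point, so an extension from `ω × A` is
determined by its values at finite points. It exists as the supremum of the composites of `φ` with
the truncations `ω̄ ⟶ Lⁿ1 ⟶ ω`. -/

noncomputable section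

namespace OmegaSheaf

open OmegaCompletePartialOrder

/-! ### Continuous functions on `ω + 1`. -/

section ENat

variable {α : Type*} [OmegaCompletePartialOrder α]

/-- The chain `f 0 ≤ f 1 ≤ …` of the values of a monotone function at the finite numbers. -/
def finiteValues (f : ℕ∞ → α) (hf : Monotone f) : Chain α :=
  ⟨fun n => f n, fun _ _ h => hf (Nat.cast_le.2 h)⟩

/-- A chain in `ω + 1` either attains its supremum, where monotonicity suffices, or is unbounded, so
that the only supremum to check is the one at `⊤`. -/
theorem enat_continuous {f : ℕ∞ → α} (hf : Monotone f)
    (h : f ⊤ ≤ ωSup (finiteValues f hf)) : ωScottContinuous f := by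
  refine ωScottContinuous.of_monotone_map_ωSup ⟨hf, fun c => le_antisymm ?_
    (ωSup_le _ _ fun i => hf (le_ωSup c i))⟩
  by_cases hb : ∃ i, ωSup c = c i
  · obtain ⟨i, hi⟩ := hb
    rw [hi]
    exact le_ωSup (c.map ⟨f, hf⟩) i
  -- A chain with a finite bound has finite range, hence a largest member, which would be its
  -- supremum.
  · have key : ∀ n : ℕ, ∃ i, (n : ℕ∞) ≤ c i := by
      intro n
      by_contra hn
      push Not at hn
      have hfin : (Set.range c).Finite := by
        refine ((Set.finite_Iio n).image fun k : ℕ => (k : ℕ∞)).subset ?_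
        rintro _ ⟨i, rfl⟩
        have := hn i
        lift c i to ℕ using (this.trans_le le_top).ne with k
        exact ⟨k, by simpa using this, rfl⟩
      obtain ⟨_, ⟨i, rfl⟩, hi⟩ := hfin.exists_maximal ⟨_, Set.mem_range_self 0⟩
      refine hb ⟨i, le_antisymm (ωSup_le _ _ fun j => ?_) (le_ωSup c i)⟩
      rcases le_total (c i) (c j) with h | h
      · exact hi ⟨j, rfl⟩ h
      · exact h
    refine (hf le_top).trans (h.trans (ωSup_le _ _ fun n => ?_))
    obtain ⟨i, hi⟩ := key n
    exact (hf hi).trans (le_ωSup (c.map ⟨f, hf⟩) i)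

theorem enat_continuous_top {f : ℕ∞ → α} (hf : ωScottContinuous f) :
    f ⊤ = ωSup (finiteValues f hf.monotone) := by
  have h : (⊤ : ℕ∞) = ωSup (finiteValues (fun n : ℕ∞ => n) monotone_id) := by
    refine le_antisymm ?_ le_top
    refine (ENat.eq_top_iff_forall_ge.2 fun n => ?_).ge
    exact le_ωSup (finiteValues (fun n : ℕ∞ => n) monotone_id) n
  conv_lhs => rw [h]
  exact hf.map_ωSup _

/-- Chains extend to `ω + 1` by their suprema; this is the reason why probing with `V` detects the
whole `ω`cpo structure. -/
theorem exists_enat_continuous (s : Chain α) :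
    ∃ f : ℕ∞ → α, ωScottContinuous f ∧ (∀ n : ℕ, f n = s n) ∧ f ⊤ = ωSup s := by
  let f : ℕ∞ → α := fun n => ENat.recTopCoe (ωSup s) s n
  have hm : Monotone f := by
    intro x y h
    induction y with
    | top => induction x with
      | top => exact le_rfl
      | coe x => exact le_ωSup s x
    | coe y => induction x with
      | top => exact absurd (top_le_iff.1 h) (ENat.natCast_ne_top y)
      | coe x => exact s.monotone (Nat.cast_le.1 h)
  exact ⟨f, enat_continuous hm (ωSup_le _ _ fun n => le_ωSup (finiteValues f hm) n),
    fun _ => rfl, rfl⟩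

/-- A function is continuous if it preserves continuous functions on `ω + 1`. -/
theorem continuous_of_enat {β : Type*} [OmegaCompletePartialOrder β] {g : α → β}
    (h : ∀ f : ℕ∞ → α, ωScottContinuous f → ωScottContinuous fun n => g (f n)) :
    ωScottContinuous g := by
  have hm : Monotone g := by
    intro x y hxy
    -- The inequality `x ≤ y` is encoded as the chain `x, y, y, …`, and read off at the indices `0`
    -- and `1`.
    obtain ⟨f, hf, h1, -⟩ := exists_enat_continuous
      (⟨fun n => if n = 0 then x else y, monotone_nat_of_le_succ fun n => by
        by_cases hn : n = 0 <;> simp [hn, hxy]⟩ : Chain α)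
    have h2 := (h f hf).monotone (Nat.cast_le.2 zero_le_one : ((0 : ℕ) : ℕ∞) ≤ (1 : ℕ))
    change g (f _) ≤ g (f _) at h2
    rw [h1, h1] at h2
    exact h2
  refine ωScottContinuous.of_monotone_map_ωSup ⟨hm, fun s => ?_⟩
  obtain ⟨f, hf, h1, h2⟩ := exists_enat_continuous s
  rw [← h2]
  refine (enat_continuous_top (h f hf)).trans (congrArg ωSup ?_)
  ext n
  exact congrArg g (h1 n)

theorem enat_continuous_of_unbounded {f : ℕ∞ → ℕ∞} (hf : Monotone f)
    (h : ∀ k : ℕ, (k : ℕ∞) ≤ f ⊤ → ∃ n : ℕ, (k : ℕ∞) ≤ f n) : ωScottContinuous f := by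
  refine enat_continuous hf (ENat.forall_natCast_le_iff_le.1 fun k hk => ?_)
  obtain ⟨n, hn⟩ := h k hk
  exact hn.trans (le_ωSup (finiteValues f hf) n)

/-- Natural numbers are compact in `ω + 1`: if every `f n` is below `k + 1`, then all are at most
`k`, and so is their supremum. -/
theorem enat_continuous_le {f : ℕ∞ → ℕ∞} (hf : ωScottContinuous f) (k : ℕ)
    (hk : (k : ℕ∞) ≤ f ⊤) : ∃ n : ℕ, (k : ℕ∞) ≤ f n := by
  by_contra hn
  push Not at hn
  rw [enat_continuous_top hf] at hk
  cases k with
  | zero => exact not_lt_bot (hn 0)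
  | succ k =>
    have : ωSup (finiteValues f hf.monotone) ≤ k := ωSup_le _ _ fun n => by
      have := hn n
      rw [Nat.cast_succ] at this
      exact Order.le_of_lt_add_one this
    exact absurd (hk.trans this) (not_le.2 (Nat.cast_lt.2 (Nat.lt_succ_self k)))

theorem continuous_enat_add (n : ℕ) : ωScottContinuous fun x : ℕ∞ => x + n :=
  enat_continuous_of_unbounded (fun _ _ h => add_le_add_left h _) fun k _ =>
    ⟨k, le_self_add⟩

/-- Truncated subtraction provides the factorizations through the shift by `n`. -/
theorem continuous_enat_sub (n : ℕ) : ωScottContinuous fun x : ℕ∞ => x - n :=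
  enat_continuous_of_unbounded (fun _ _ h => tsub_le_tsub_right h _) fun k _ =>
    ⟨k + n, by rw [← ENat.natCast_sub, Nat.add_sub_cancel]⟩

/-- Truncation at `n` describes the maps out of `Lⁿ1` in the sequences that define `ω` and `ω̄`. -/
theorem continuous_enat_min (n : ℕ) : ωScottContinuous fun x : ℕ∞ => min x n :=
  enat_continuous_of_unbounded (fun _ _ h => min_le_min_right _ h) fun k hk =>
    ⟨k, by simpa using hk⟩

end ENat

/-! ### Points and admissible monos of a concrete site. -/

namespace ConcreteSite

section

variable {C : Type u} [SmallCategory C] {S : ConcreteSite C} {M : MorphismProperty C}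

variable (M) in
/-- Sets of points that are the image of a map in `M`. -/
def IsOpenPts (c : C) (U : Set (S.Pts c)) : Prop :=
  ∃ (c' : C) (m : c' ⟶ c), M m ∧ ∀ x, x ∈ U ↔ ∃ y : S.Pts c', y ≫ m = x

theorem MSub_isOpenPts {c : C} (P : MSub M c) : IsOpenPts M c {x : S.Pts c | P.Factors x} :=
  ⟨P.obj, P.arrow, P.mem, fun x => ⟨fun h => ⟨P.factorThru x h, Subobject.factorThru_arrow _ _ _⟩,
    fun ⟨_, hy⟩ => hy ▸ Subobject.factors_comp_arrow _⟩⟩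

variable [S.IsAdmissible M]

/-- The pullback of `m` along `g` contains all points of `d`, so by order reflection it is the whole
of `d`. -/
theorem factors_of_points {c c' d : C} {m : c' ⟶ c} (hm : M m) (g : d ⟶ c)
    (h : ∀ x : S.Pts d, ∃ y : S.Pts c', y ≫ m = x ≫ g) : ∃ k, k ≫ m = g := by
  have h3 : (MSub.mk' (M := M) (𝟙 d) (StableMonos.iso _ inferInstance)).sub ≤
      (MSub.pull g (MSub.mk' m hm)).sub := by
    refine IsAdmissible.le_of_points (S := S) _ _ fun x _ => ?_
    rw [MSub.pull_factors, MSub.mk'_factors]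
    exact h x
  have h4 := (MSub.pull_factors g (MSub.mk' m hm) (𝟙 d)).1
    (Subobject.factors_of_le (𝟙 d) h3 ((MSub.mk'_factors _ _ _).2 ⟨𝟙 d, by simp⟩))
  rw [Category.id_comp] at h4
  exact (MSub.mk'_factors _ _ _).1 h4

/-- Without points, the identity of `c` factors pointwise, vacuously, through the admissible mono `0
⟶ c`. -/
theorem exists_to_zero (M : MorphismProperty C) [S.IsAdmissible M] (c : C)
    (hc : IsEmpty (S.Pts c)) : Nonempty (c ⟶ S.zero) := by
  obtain ⟨k, -⟩ := factors_of_points (S := S) (M := M) (IsAdmissible.zero_mem (S := S) c) (𝟙 c)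
    fun x => hc.elim x
  exact ⟨k⟩

theorem isInitial_iff_isEmpty (M : MorphismProperty C) [S.IsAdmissible M] (c : C) :
    Nonempty (IsInitial c) ↔ IsEmpty (S.Pts c) := by
  constructor
  · rintro ⟨h⟩
    exact ⟨fun x => S.isEmpty_pts_zero.false (x ≫ h.to _)⟩
  · intro hc
    obtain ⟨k⟩ := exists_to_zero M c hc
    exact ⟨S.isInitial.ofIso ⟨S.isInitial.to c, k, S.isInitial.hom_ext _ _,
      S.faithful _ _ fun x => hc.elim x⟩⟩

/-- The empty cover of the initial object pulls back along `c ⟶ 0`, and only the empty family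
refines the empty family. -/
theorem bot_mem_of_isEmpty {c : C} (hc : IsEmpty (S.Pts c)) (M : MorphismProperty C)
    [S.IsAdmissible M] : (⊥ : Presieve c) ∈ S.J c := by
  obtain ⟨k⟩ := exists_to_zero M c hc
  obtain ⟨R, hR, hR'⟩ := S.J.pullback k ⊥ S.empty_mem
  convert hR
  refine le_antisymm bot_le fun d f hf => ?_
  obtain ⟨_, _, _, h, _⟩ := hR' hf
  exact h

theorem IsOpenPts.exists_MSub {c : C} {U : Set (S.Pts c)} (hU : IsOpenPts M c U) :
    ∃ P : MSub M c, ∀ x : S.Pts c, P.Factors x ↔ x ∈ U := by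
  obtain ⟨d, m, hm, h⟩ := hU
  exact ⟨MSub.mk' m hm, fun x => (MSub.mk'_factors m hm x).trans (h x).symm⟩

theorem IsOpenPts.preimage {c d : C} {U : Set (S.Pts c)} (hU : IsOpenPts M c U) (f : d ⟶ c) :
    IsOpenPts M d {x | x ≫ f ∈ U} := by
  obtain ⟨P, hP⟩ := hU.exists_MSub
  convert MSub_isOpenPts (S := S) (MSub.pull f P) using 1
  ext x
  rw [Set.mem_ofPred_eq, Set.mem_ofPred_eq, MSub.pull_factors, hP]

-- Open sets are the domains of the partial maps to the one-point `ω`-concrete sheaf, so they are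
-- local because the relations of its lifting are (`liftR_glue`).
open Classical in
theorem isOpenPts_of_cover {c : C} {U : Set (S.Pts c)} (T : Presieve c) (hT : T ∈ S.J c)
    (h : ∀ ⦃d : C⦄ ⦃f : d ⟶ c⦄, T f → IsOpenPts M d {x | x ≫ f ∈ U}) : IsOpenPts M c U := by
  have key : ∀ {d : C} (V : Set (S.Pts d)), IsOpenPts M d V ↔
      (fun x => if x ∈ V then ((PUnit.unit : PUnit.{u+1}) : WithBot PUnit.{u+1}) else ⊥) ∈
        OmegaConc.liftR M (OmegaConc.unit S) d := by
    intro d V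
    have e : ∀ x, (if x ∈ V then ((PUnit.unit : PUnit.{u+1}) : WithBot PUnit.{u+1}) else ⊥) ≠ ⊥ ↔
        x ∈ V := fun x => by
      split_ifs with hx
      · exact iff_of_true WithBot.coe_ne_bot hx
      · exact iff_of_false (fun h => h rfl) hx
    constructor
    · rintro ⟨c', m, hm, h⟩
      exact ⟨c', m, hm, fun x => (e x).trans (h x), fun _ => PUnit.unit, trivial,
        fun _ => if_pos ((h _).2 ⟨_, rfl⟩)⟩
    · rintro ⟨c', m, hm, h, -⟩
      exact ⟨c', m, hm, fun x => (e x).symm.trans (h x)⟩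
  rw [key]
  exact OmegaConc.liftR_glue T hT _ fun d f hf => (key _).1 (h hf)

end

/-! ### Admissibility of `M ∪ M_V` on the combined site. -/

variable {C : Type u} [SmallCategory C] {S : ConcreteSite C}

/-- The element of `|a|` given by a point of `a`. -/
def Comb.pt {a : S.Comb} (x : S.comb.Pts a) : a.Pt := x.1 (𝟙 S.star)

theorem Comb.constMap_pt {a : S.Comb} (x : S.comb.Pts a) : constMap _ (Comb.pt x) = x :=
  Comb.hom_ext fun _ => congrArg x.1 (S.isTerminal.hom_ext _ _)

/-- The map `V ⟶ V` given by a continuous function. -/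
def vertMap (f : ℕ∞ → ℕ∞) (hf : ωScottContinuous f) : (Comb.vert : S.Comb) ⟶ Comb.vert :=
  ⟨fun x => ULift.up (f x.down), hf⟩

variable (S) in
/-- The map `x ↦ x + n` on `V`. -/
def vertAdd (n : ℕ) : (Comb.vert : S.Comb) ⟶ Comb.vert := vertMap _ (continuous_enat_add n)

theorem incl_full {c d : C} (f : Comb.of c ⟶ (Comb.of d : S.Comb)) : ∃ h, f = S.incl.map h :=
  ⟨f.2.choose, Comb.hom_ext f.2.choose_spec⟩

variable {M : MorphismProperty C}

theorem combMonos_incl {c d : C} {m : c ⟶ d} (hm : M m) : S.combMonos M (S.incl.map m) :=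
  ⟨m, hm, rfl⟩

theorem combMonos_vertAdd (n : ℕ) : S.combMonos M (S.vertAdd n) := ⟨n, fun _ => rfl⟩

variable (M) in
/-- Sets of points that are the image of a map in `M ∪ M_V`. -/
def IsCombOpen (a : S.Comb) (U : Set a.Pt) : Prop :=
  ∃ (b : S.Comb) (m : b ⟶ a), S.combMonos M m ∧ ∀ x, x ∈ U ↔ ∃ y, m.1 y = x

theorem isCombOpen_of {c : C} {U : Set (S.Pts c)} :
    IsCombOpen M (.of c) U ↔ IsOpenPts M c U := by
  constructor
  · rintro ⟨b | _, m, hm, h⟩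
    · obtain ⟨m, hm, rfl⟩ := hm
      exact ⟨b, m, hm, h⟩
    · exact hm.elim
  · rintro ⟨b, m, hm, h⟩
    exact ⟨.of b, S.incl.map m, combMonos_incl hm, h⟩

/-- The set of points of an `M`-subobject. -/
def MSub_pts {a : S.Comb} (P : MSub (S.combMonos M) a) : Set a.Pt :=
  {x | P.Factors (constMap (.of S.star) x)}

theorem MSub_pts_iff {a : S.Comb} (P : MSub (S.combMonos M) a) (x : a.Pt) :
    x ∈ MSub_pts P ↔ ∃ y, P.arrow.1 y = x := by
  constructor
  · intro h
    exact ⟨(P.factorThru _ h).1 (𝟙 S.star),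
      congrFun (congrArg Subtype.val (Subobject.factorThru_arrow _ _ h)) (𝟙 S.star)⟩
  · rintro ⟨y, rfl⟩
    change P.Factors (constMap (.of S.star) y ≫ P.arrow)
    exact Subobject.factors_comp_arrow _

theorem MSub_pts_isCombOpen {a : S.Comb} (P : MSub (S.combMonos M) a) :
    IsCombOpen M a (MSub_pts P) := ⟨_, P.arrow, P.mem, MSub_pts_iff P⟩

variable [S.IsAdmissible M]

theorem combMonos_injective {a b : S.Comb} (m : a ⟶ b) (hm : S.combMonos M m) :
    Function.Injective m.1 := by
  cases a with
  | of c => cases b with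
    | of d =>
      obtain ⟨m, hm, rfl⟩ := hm
      have := StableMonos.mono m hm
      intro x y h
      exact (cancel_mono m).1 h
    | vert =>
      have := (isInitial_iff_isEmpty (S := S) M c).1 hm
      exact fun x => this.elim x
  | vert => cases b with
    | of d => exact hm.elim
    | vert =>
      obtain ⟨n, hn⟩ := hm
      rintro ⟨x⟩ ⟨y⟩ h
      rw [hn, hn] at h
      have h' : x + n = y + n := congrArg ULift.down h
      exact congrArg _ ((ENat.add_left_injective_of_ne_top (ENat.natCast_ne_top n)) h')

/-- The counterpart of `factors_of_points`: a constant map is lifted by lifting its value, a map in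
`C` by that lemma, and a map `V ⟶ V` by subtracting the shift. -/
theorem combMonos_factors {a b e : S.Comb} {m : a ⟶ b} (hm : S.combMonos M m) (g : e ⟶ b)
    (h : ∀ x, ∃ y, m.1 y = g.1 x) : ∃ k, k ≫ m = g := by
  have const : (∃ y, ∀ x, g.1 x = y) → Nonempty e.Pt → ∃ k, k ≫ m = g := by
    rintro ⟨y, hy⟩ ⟨x⟩
    obtain ⟨z, hz⟩ := h x
    exact ⟨constMap e z, Comb.hom_ext fun x' => hz.trans ((hy x).trans (hy x').symm)⟩
  cases e with
  | of e =>
    -- An object without points has no value that could be lifted; it maps to `a` through the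
    -- initial object instead.
    by_cases he : IsEmpty (S.Pts e)
    · obtain ⟨k⟩ := exists_to_zero M e he
      exact ⟨S.incl.map k ≫ S.comb.isInitial.to a, Comb.hom_ext fun x => he.elim x⟩
    · rw [not_isEmpty_iff] at he
      cases b with
      | vert => exact const g.2 he
      | of b => cases a with
        | vert => exact hm.elim
        | of a =>
          obtain ⟨m, hm, rfl⟩ := hm
          obtain ⟨g, rfl⟩ := incl_full g
          obtain ⟨k, rfl⟩ := factors_of_points (S := S) hm g h
          exact ⟨S.incl.map k, (S.incl.map_comp _ _).symm⟩
  | vert => cases b with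
    | of b => exact const g.2 ⟨ULift.up 0⟩
    | vert => cases a with
      | of a =>
        have := (isInitial_iff_isEmpty (S := S) M a).1 hm
        obtain ⟨y, -⟩ := h (ULift.up 0)
        exact this.elim y
      | vert =>
        obtain ⟨n, hn⟩ := hm
        refine ⟨⟨fun x => ULift.up ((g.1 x).down - n),
          (continuous_enat_sub n).comp g.2⟩, Comb.hom_ext fun x => ?_⟩
        obtain ⟨y, hy⟩ := h x
        change m.1 (ULift.up ((g.1 x).down - n)) = g.1 x
        rw [hn, ← hy, show y = ULift.up y.down from rfl, hn]
        congr 2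
        exact (ENat.addLECancellable_natCast n).add_tsub_cancel_right

/-- The right-hand side is Scott-openness: such a set is empty or consists of all `x ≥ n`, with `n`
its least natural number. -/
theorem isCombOpen_vert {U : Set (Comb.vert : S.Comb).Pt} :
    IsCombOpen M .vert U ↔ (∀ x y : ℕ∞, x ≤ y → ULift.up x ∈ U → ULift.up y ∈ U) ∧
      (ULift.up ⊤ ∈ U → ∃ n : ℕ, ULift.up (n : ℕ∞) ∈ U) := by
  classical
  constructor
  · rintro ⟨b | _, m, hm, h⟩
    · have := (isInitial_iff_isEmpty (S := S) M b).1 hm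
      have hU : ∀ x, x ∉ U := fun x hx => by
        obtain ⟨y, -⟩ := (h x).1 hx
        exact this.elim y
      exact ⟨fun x y _ hx => (hU _ hx).elim, fun hx => (hU _ hx).elim⟩
    · obtain ⟨n, hn⟩ := hm
      refine ⟨fun x y hxy hx => ?_, fun _ => ⟨n, (h _).2 ⟨ULift.up 0, ?_⟩⟩⟩
      · obtain ⟨⟨z⟩, hz⟩ := (h _).1 hx
        rw [hn] at hz
        refine (h _).2 ⟨ULift.up (y - n), ?_⟩
        rw [hn, tsub_add_cancel_of_le]
        exact le_trans (le_trans le_add_self (congrArg ULift.down hz).le) hxy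
      · rw [hn, zero_add]
  · rintro ⟨h1, h2⟩
    by_cases hU : ∃ x, x ∈ U
    · obtain ⟨⟨x⟩, hx⟩ := hU
      have h3 := h2 (h1 _ _ le_top hx)
      refine ⟨.vert, S.vertAdd (Nat.find h3), combMonos_vertAdd _, ?_⟩
      rintro ⟨y⟩
      constructor
      · intro hy
        refine ⟨ULift.up (y - (Nat.find h3 : ℕ)), ?_⟩
        change ULift.up (y - (Nat.find h3 : ℕ) + (Nat.find h3 : ℕ)) = _
        rw [tsub_add_cancel_of_le]
        induction y with
        | top => exact le_top
        | coe y => exact Nat.cast_le.2 (Nat.find_min' h3 hy)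
      · rintro ⟨⟨z⟩, hz⟩
        refine h1 _ y ?_ (Nat.find_spec h3)
        exact le_add_self.trans (congrArg ULift.down hz).le
    -- The empty set is the image of the map `0 ⟶ V`.
    · push Not at hU
      exact ⟨.of S.zero, constMap _ (ULift.up 0), ⟨S.isInitial⟩, fun x =>
        iff_of_false (hU x) fun ⟨y, _⟩ => S.isEmpty_pts_zero.elim y⟩

theorem isCombOpen_univ (a : S.Comb) : IsCombOpen M a Set.univ := by
  cases a with
  | of c => exact ⟨_, S.incl.map (𝟙 c), combMonos_incl (StableMonos.iso _ inferInstance),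
      fun x => iff_of_true trivial ⟨x, Category.comp_id x⟩⟩
  | vert => exact ⟨_, S.vertAdd 0, combMonos_vertAdd _, fun x =>
      iff_of_true trivial ⟨x, congrArg ULift.up (add_zero x.down)⟩⟩

theorem isCombOpen_empty (a : S.Comb) : IsCombOpen M a ∅ := by
  refine ⟨_, S.comb.isInitial.to a, ?_, fun x => iff_of_false id
    fun ⟨y, _⟩ => S.isEmpty_pts_zero.elim y⟩
  cases a with
  | of c => exact combMonos_incl (IsAdmissible.zero_mem (S := S) c)
  | vert => exact ⟨S.isInitial⟩

theorem IsCombOpen.preimage {a b : S.Comb} {U : Set a.Pt} (hU : IsCombOpen M a U) (f : b ⟶ a) :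
    IsCombOpen M b (f.1 ⁻¹' U) := by
  have const : (∃ y, ∀ x, f.1 x = y) → IsCombOpen M b (f.1 ⁻¹' U) := by
    rintro ⟨y, hy⟩
    by_cases h : y ∈ U
    · convert isCombOpen_univ (M := M) b
      exact Set.eq_univ_of_forall fun x => by rw [Set.mem_preimage, hy]; exact h
    · convert isCombOpen_empty (M := M) b
      exact Set.eq_empty_of_forall_notMem fun x => by rw [Set.mem_preimage, hy]; exact h
  rcases a with a | _ <;> rcases b with b | _
  · obtain ⟨f, rfl⟩ := incl_full f
    exact isCombOpen_of.2 ((isCombOpen_of.1 hU).preimage f)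
  · exact const f.2
  · exact const f.2
  · obtain ⟨h1, h2⟩ := isCombOpen_vert.1 hU
    have hf : ωScottContinuous fun n : ℕ∞ => (f.1 (ULift.up n)).down := f.2
    refine isCombOpen_vert.2 ⟨fun x y hxy hx => h1 _ _ (hf.monotone hxy) hx, fun h => ?_⟩
    obtain ⟨k, hk⟩ := h2 (h1 _ ⊤ le_top h)
    -- If the value at `⊤` is `⊤`, the function passes the natural number `k` of `U` at a finite
    -- stage; otherwise its value at `⊤` is finite, hence compact, and already reached at a finite
    -- stage.
    by_cases htop : (f.1 (ULift.up ⊤)).down = ⊤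
    · obtain ⟨n, hn⟩ := enat_continuous_le hf k (le_top.trans htop.ge)
      exact ⟨n, h1 _ _ hn hk⟩
    · obtain ⟨l, hl⟩ := ENat.ne_top_iff_exists.1 htop
      obtain ⟨n, hn⟩ := enat_continuous_le hf l hl.le
      exact ⟨n, h1 _ _ (hl.ge.trans hn) h⟩

-- The mono `n` is chosen with the preimage of the image of `m` as its image; since both legs in the
-- class are injective and factorizations are decided on points, the square is a pullback.
variable (M) in
theorem combMonos_exists_pullback {a b c : S.Comb} (m : b ⟶ a) (hm : S.combMonos M m) (f : c ⟶ a) :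
    ∃ (p : S.Comb) (k : p ⟶ b) (n : p ⟶ c), S.combMonos M n ∧ IsPullback k n m f := by
  obtain ⟨p, n, hn, h⟩ := IsCombOpen.preimage (M := M) ⟨b, m, hm, fun _ => Iff.rfl⟩ f
  obtain ⟨k, hk⟩ := combMonos_factors hm (n ≫ f) fun x => (h (n.1 x)).2 ⟨x, rfl⟩
  have key : ∀ s : PullbackCone m f, ∃ l, l ≫ n = s.snd := fun s =>
    combMonos_factors hn s.snd fun x => (h _).1
      ⟨s.fst.1 x, congrFun (congrArg Subtype.val s.condition) x⟩
  choose l hl using key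
  refine ⟨p, k, n, hn, ⟨⟨hk⟩, ⟨PullbackCone.IsLimit.mk _ l (fun s => ?_) hl
    (fun s l' _ hl' => ?_)⟩⟩⟩
  · refine Comb.hom_ext fun x => combMonos_injective m hm ?_
    have e1 := congrFun (congrArg Subtype.val hk) ((l s).1 x)
    have e2 := congrFun (congrArg Subtype.val (hl s)) x
    have e3 := congrFun (congrArg Subtype.val s.condition) x
    exact e1.trans ((congrArg f.1 e2).trans e3.symm)
  · refine Comb.hom_ext fun x => combMonos_injective n hn ?_
    exact (congrFun (congrArg Subtype.val hl') x).trans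
      (congrFun (congrArg Subtype.val (hl s)) x).symm

theorem combMonos_iso {a b : S.Comb} (m : a ⟶ b) (hm : IsIso m) : S.combMonos M m := by
  have h1 : ∀ x, (inv m).1 (m.1 x) = x := fun x =>
    congrFun (congrArg Subtype.val (IsIso.hom_inv_id m)) x
  have h2 : ∀ x, m.1 ((inv m).1 x) = x := fun x =>
    congrFun (congrArg Subtype.val (IsIso.inv_hom_id m)) x
  have ne : ∀ y : ℕ∞, ∃ x, x ≠ y := fun y => exists_ne y
  rcases a with a | _ <;> rcases b with b | _
  · obtain ⟨f, rfl⟩ := incl_full m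
    obtain ⟨g, hg⟩ := incl_full (inv (S.incl.map f))
    rw [hg] at h1 h2
    refine ⟨f, StableMonos.iso _ ⟨g, S.faithful _ _ fun x => ?_, S.faithful _ _ fun x => ?_⟩, rfl⟩
    · exact (Category.assoc _ _ _).symm.trans ((h1 x).trans (Category.comp_id x).symm)
    · exact (Category.assoc _ _ _).symm.trans ((h2 x).trans (Category.comp_id x).symm)
  -- Maps between `V` and an object of `C` are constant, and `V` has more than one point, so neither
  -- mixed case admits an isomorphism.
  · obtain ⟨y, hy⟩ := m.2
    obtain ⟨x, hx⟩ := ne y.down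
    exact (hx (congrArg ULift.down ((h2 (ULift.up x)).symm.trans (hy _)))).elim
  · obtain ⟨y, hy⟩ := (inv m).2
    obtain ⟨x, hx⟩ := ne y.down
    exact (hx (congrArg ULift.down ((h1 (ULift.up x)).symm.trans (hy _)))).elim
  · refine ⟨0, fun x => ?_⟩
    -- The well-order `ω + 1` has no automorphism other than the identity, so an automorphism of `V`
    -- is the shift by `0`.
    let f : ℕ∞ ≃o ℕ∞ :=
      { toFun := fun x => (m.1 (ULift.up x)).down
        invFun := fun x => ((inv m).1 (ULift.up x)).down
        left_inv := fun x => congrArg ULift.down (h1 (ULift.up x))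
        right_inv := fun x => congrArg ULift.down (h2 (ULift.up x))
        map_rel_iff' := fun {x y} => by
          have hm : ωScottContinuous fun n : ℕ∞ => (m.1 (ULift.up n)).down := m.2
          have hi : ωScottContinuous fun n : ℕ∞ => ((inv m).1 (ULift.up n)).down := (inv m).2
          refine ⟨fun h => ?_, fun h => hm.monotone h⟩
          have := hi.monotone h
          change ((inv m).1 (m.1 (ULift.up x))).down ≤ ((inv m).1 (m.1 (ULift.up y))).down at this
          exact (congrArg ULift.down (h1 (ULift.up x))).ge.trans
            (this.trans (congrArg ULift.down (h1 (ULift.up y))).le) }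
    have : f = OrderIso.refl ℕ∞ := Subsingleton.elim _ _
    have h3 := DFunLike.congr_fun this x
    rw [Nat.cast_zero, add_zero]
    exact congrArg ULift.up h3

theorem combMonos_comp {a b c : S.Comb} (m : a ⟶ b) (n : b ⟶ c) (hm : S.combMonos M m)
    (hn : S.combMonos M n) : S.combMonos M (m ≫ n) := by
  rcases a with a | _ <;> rcases b with b | _ <;> rcases c with c | _
  · obtain ⟨m, hm, rfl⟩ := hm
    obtain ⟨n, hn, rfl⟩ := hn
    exact ⟨m ≫ n, StableMonos.comp _ _ hm hn, (S.incl.map_comp _ _).symm⟩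
  · refine (isInitial_iff_isEmpty (S := S) M a).2 ⟨fun x => ?_⟩
    exact ((isInitial_iff_isEmpty (S := S) M b).1 hn).false (m.1 x)
  · exact hn.elim
  · exact hm
  · exact hm.elim
  · exact hm.elim
  · exact hn.elim
  · obtain ⟨m', hm⟩ := hm
    obtain ⟨n', hn⟩ := hn
    refine ⟨m' + n', fun x => ?_⟩
    change n.1 (m.1 _) = _
    rw [hm, hn, Nat.cast_add, add_assoc]

instance combMonos_stable : StableMonos (S.combMonos M) where
  mono m hm := ⟨fun g h e => Comb.hom_ext fun x =>
    combMonos_injective m hm (congrFun (congrArg Subtype.val e) x)⟩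
  iso := combMonos_iso
  comp := combMonos_comp
  hasPullback m f hm := by
    obtain ⟨_, _, _, _, h⟩ := combMonos_exists_pullback M m hm f
    exact h.hasPullback
  pullback {_ _ _ _ _ n m f} h hm := by
    obtain ⟨_, k', n', hn', h'⟩ := combMonos_exists_pullback M m hm f
    -- Any pullback differs from the constructed one by an isomorphism, and isomorphisms belong to
    -- the class.
    rw [← IsPullback.isoIsPullback_hom_snd _ _ h h']
    exact combMonos_comp _ _ (combMonos_iso _ inferInstance) hn'

/-- With this, subobjects in the class can be replaced by their sets of points, and pullback by
preimage. -/
theorem MSub_pts_factors {a b : S.Comb} (P : MSub (S.combMonos M) a) (f : b ⟶ a) :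
    P.Factors f ↔ ∀ x, f.1 x ∈ MSub_pts P := by
  constructor
  · intro h x
    rw [← Subobject.factorThru_arrow P.sub f h]
    exact (MSub_pts_iff P _).2 ⟨_, rfl⟩
  · intro h
    obtain ⟨k, rfl⟩ := combMonos_factors P.mem f fun x => (MSub_pts_iff P _).1 (h x)
    exact Subobject.factors_comp_arrow _

theorem MSub_pts_injective {a : S.Comb} {P Q : MSub (S.combMonos M) a}
    (h : MSub_pts P = MSub_pts Q) : P = Q :=
  MSub.ext' fun g => by rw [MSub_pts_factors, MSub_pts_factors, h]

theorem MSub_pts_pull {a b : S.Comb} (P : MSub (S.combMonos M) a) (f : b ⟶ a) :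
    MSub_pts (MSub.pull f P) = f.1 ⁻¹' MSub_pts P := by
  ext x
  exact MSub.pull_factors f P _

theorem MSub_pts_mk' {a b : S.Comb} (m : b ⟶ a) (hm : S.combMonos M m) (x : a.Pt) :
    x ∈ MSub_pts (MSub.mk' m hm) ↔ ∃ y, m.1 y = x := by
  refine (MSub.mk'_factors m hm _).trans ⟨fun ⟨k, hk⟩ => ?_, fun ⟨y, hy⟩ => ?_⟩
  · exact ⟨k.1 (𝟙 S.star), congrFun (congrArg Subtype.val hk) (𝟙 S.star)⟩
  · exact ⟨constMap _ y, Comb.hom_ext fun _ => hy⟩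

theorem IsCombOpen.exists_MSub {a : S.Comb} {U : Set a.Pt} (hU : IsCombOpen M a U) :
    ∃ P : MSub (S.combMonos M) a, MSub_pts P = U := by
  obtain ⟨b, m, hm, h⟩ := hU
  exact ⟨MSub.mk' m hm, Set.ext fun x => (MSub_pts_mk' m hm x).trans (h x).symm⟩

theorem isCombOpen_of_cover {a : S.Comb} {U : Set a.Pt} (T : Presieve a)
    (hT : T ∈ S.combCoverings a)
    (h : ∀ ⦃b : S.Comb⦄ ⦃f : b ⟶ a⦄, T f → IsCombOpen M b (f.1 ⁻¹' U)) : IsCombOpen M a U := by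
  cases a with
  | of c =>
    obtain ⟨R, hR, rfl⟩ := hT
    exact isCombOpen_of.2 (isOpenPts_of_cover R hR fun d f hf =>
      isCombOpen_of.1 (h (Presieve.map_map hf)))
  | vert =>
    obtain rfl := hT
    exact h ⟨⟩

/-- Compatible open sets on a cover are glued as the union of their images; openness is local by
`isCombOpen_of_cover`, and uniqueness holds because covers reach every point. -/
instance combMonos_preAdmissible : PreAdmissible S.comb.topology (S.combMonos M) where
  isSheaf := by
    refine (Presieve.isSheaf_coverage S.combCoverage _).2 fun {a} T hT s hs => ?_
    change ∀ ⦃b : S.Comb⦄ (f : b ⟶ a), T f → MSub (S.combMonos M) b at s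
    have hs' : ∀ {b b' : S.Comb} (f : b ⟶ a) (f' : b' ⟶ a) (hf : T f) (hf' : T f') (y : b.Pt)
        (y' : b'.Pt), f.1 y = f'.1 y' → y ∈ MSub_pts (s f hf) → y' ∈ MSub_pts (s f' hf') := by
      intro b b' f f' hf hf' y y' e hy
      -- Compatibility is only needed for pairs of points with the same image in `a`.
      have h1 : MSub.pull (constMap (.of S.star) y) (s f hf) =
          MSub.pull (constMap (.of S.star) y') (s f' hf') :=
        hs _ _ hf hf' (Comb.hom_ext fun _ => e)
      have h2 := congrArg MSub_pts h1
      rw [MSub_pts_pull, MSub_pts_pull] at h2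
      exact (Set.ext_iff.1 h2 (𝟙 S.star)).1 hy
    let U : Set a.Pt := {x | ∃ (b : S.Comb) (f : b ⟶ a) (hf : T f) (y : b.Pt), f.1 y = x ∧
      y ∈ MSub_pts (s f hf)}
    have hU : ∀ {b : S.Comb} (f : b ⟶ a) (hf : T f), f.1 ⁻¹' U = MSub_pts (s f hf) := by
      intro b f hf
      ext y
      refine ⟨?_, fun hy => ⟨b, f, hf, y, rfl, hy⟩⟩
      rintro ⟨b', f', hf', y', e, hy'⟩
      exact hs' f' f hf' hf y' y e hy'
    obtain ⟨P, hP⟩ := (isCombOpen_of_cover T hT fun b f hf =>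
      (hU f hf).symm ▸ MSub_pts_isCombOpen _ : IsCombOpen M a U).exists_MSub
    refine ⟨P, fun b f hf => MSub_pts_injective ?_, fun Q hQ => MSub_pts_injective ?_⟩
    · exact (MSub_pts_pull P f).trans (hP ▸ hU f hf)
    · rw [hP]
      ext x
      obtain ⟨b, f, y, hf, rfl⟩ := S.combCoverings_points hT x
      have h1 : MSub.pull f Q = s f hf := hQ f hf
      have h2 := (MSub_pts_pull Q f).symm.trans ((congrArg MSub_pts h1).trans (hU f hf).symm)
      exact Set.ext_iff.1 h2 y

/-- The covering axiom for suprema of chains, restated with sets of points and an arbitrary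
representative `m` of the supremum. -/
theorem comb_sup_cover {a b : S.Comb} (m : b ⟶ a) (hm : S.combMonos M m) (U : ℕ → Set a.Pt)
    (hU : ∀ n, IsCombOpen M a (U n)) (hmono : ∀ n, U n ⊆ U (n + 1))
    (h : ∀ x, (∃ y, m.1 y = x) ↔ ∃ n, x ∈ U n) :
    ∃ T ∈ S.combCoverings b, ∀ ⦃d : S.Comb⦄ ⦃f : d ⟶ b⦄, T f → ∃ n, ∀ x, m.1 (f.1 x) ∈ U n := by
  rcases a with a | _ <;> rcases b with b | _
  · obtain ⟨m, hm, rfl⟩ := hm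
    choose P hP using fun n => (isCombOpen_of.1 (hU n)).exists_MSub
    have hQ : ∀ x : S.Pts a, (MSub.mk' m hm).Factors x ↔ ∃ n, (P n).Factors x := fun x => by
      rw [MSub.mk'_factors]
      simp only [hP]
      exact h x
    obtain ⟨T, hT, hT'⟩ := IsAdmissible.sup_cover (S := S) P
      (fun n => IsAdmissible.le_of_points (S := S) _ _ fun x hx =>
        (hP _ x).2 (hmono n ((hP _ x).1 hx))) (MSub.mk' m hm) hQ
    -- The cover lives on the chosen representative of the subobject and is transported to `b` along
    -- the isomorphism.
    obtain ⟨R, hR, hR'⟩ := S.J.pullback (MSub.mk'Iso m hm).inv T hT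
    refine ⟨R.map S.incl, ⟨R, hR, rfl⟩, ?_⟩
    rintro _ _ ⟨hf⟩
    obtain ⟨d, i, l, hl, e⟩ := hR' hf
    obtain ⟨n, hn⟩ := hT' hl
    rename_i f
    refine ⟨n, fun (x : S.Pts _) => (hP n _).1 ?_⟩
    have e' : f ≫ m = i ≫ l ≫ (MSub.mk' m hm).arrow := by
      rw [← MSub.mk'Iso_comp, ← Category.assoc i, e]
      simp
    have : (P n).Factors (f ≫ m) := e' ▸ Subobject.factors_of_factors_right _ hn
    have h3 : (P n).Factors (x ≫ f ≫ m) := Subobject.factors_of_factors_right (x : S.Pts _) this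
    have e3 : x ≫ f ≫ m = (x ≫ f) ≫ m := (Category.assoc (x : S.Pts _) f m).symm
    change (P n).Factors ((x ≫ f) ≫ m)
    exact e3 ▸ h3
  · exact hm.elim
  · have hb := (isInitial_iff_isEmpty (S := S) M b).1 hm
    refine ⟨_, S.combCoverings_id _, ?_⟩
    rintro _ _ ⟨⟩
    exact ⟨0, fun x => hb.elim x⟩
  · refine ⟨_, S.combCoverings_id _, ?_⟩
    rintro _ _ ⟨⟩
    -- The `U n` containing the image of the least point of `V` contains the whole image, being
    -- upward closed; so the identity cover of `V` suffices.
    obtain ⟨n, hn⟩ := (h _).1 ⟨ULift.up 0, rfl⟩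
    refine ⟨n, fun x => (isCombOpen_vert.1 (hU n)).1 _ _ ?_ hn⟩
    have hm' : ωScottContinuous fun n : ℕ∞ => (m.1 (ULift.up n)).down := m.2
    exact hm'.monotone (zero_le (a := x.down))

instance combMonos_admissible : S.comb.IsAdmissible (S.combMonos M) where
  zero_mem a := by
    cases a with
    | of c =>
      rw [S.comb.isInitial.hom_ext (S.comb.isInitial.to (Comb.of c))
        (S.incl.map (S.isInitial.to c))]
      exact combMonos_incl (IsAdmissible.zero_mem (S := S) c)
    | vert => exact ⟨S.isInitial⟩
  le_of_points P Q h := by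
    refine Subobject.le_of_factors ((MSub_pts_factors Q P.arrow).2 fun x => ?_)
    exact h _ ((MSub_pts_iff P _).2 ⟨x, rfl⟩)
  exists_sup {a} P hP := by
    have hmono : ∀ n, MSub_pts (P n) ⊆ MSub_pts (P (n + 1)) := fun n x hx =>
      Subobject.factors_of_le _ (hP n) hx
    -- It is enough that open sets are closed under unions of chains; on `V` any union of Scott-open
    -- sets is Scott-open.
    have hU : IsCombOpen M a {x | ∃ n, x ∈ MSub_pts (P n)} := by
      cases a with
      | of c =>
        choose Q hQ using fun n => (isCombOpen_of.1 (MSub_pts_isCombOpen (P n))).exists_MSub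
        obtain ⟨R, hR⟩ := IsAdmissible.exists_sup (S := S) Q fun n =>
          IsAdmissible.le_of_points (S := S) _ _ fun x hx =>
            (hQ _ x).2 (hmono n ((hQ _ x).1 hx))
        refine isCombOpen_of.2 ?_
        have e : {x | ∃ n, x ∈ MSub_pts (P n)} = {x : S.Pts c | R.Factors x} := Set.ext fun x =>
          (exists_congr fun n => (hQ n x).symm).trans (hR x).symm
        exact e ▸ MSub_isOpenPts R
      | vert =>
        have h := fun n => isCombOpen_vert.1 (MSub_pts_isCombOpen (P n))
        exact isCombOpen_vert.2 ⟨fun x y hxy ⟨n, hn⟩ => ⟨n, (h n).1 x y hxy hn⟩, fun ⟨n, hn⟩ => by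
          obtain ⟨k, hk⟩ := (h n).2 hn
          exact ⟨k, n, hk⟩⟩
    obtain ⟨Q, hQ⟩ := hU.exists_MSub
    refine ⟨Q, fun x => ?_⟩
    rw [← Comb.constMap_pt x]
    exact Set.ext_iff.1 hQ _
  sup_cover {a} P hP Q hQ := by
    obtain ⟨T, hT, h⟩ := comb_sup_cover Q.arrow Q.mem (fun n => MSub_pts (P n))
      (fun n => MSub_pts_isCombOpen _) (fun n x hx => Subobject.factors_of_le _ (hP n) hx)
      (fun x => (MSub_pts_iff Q x).symm.trans (hQ _))
    refine ⟨T, hT, fun d f hf => ?_⟩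
    obtain ⟨n, hn⟩ := h hf
    exact ⟨n, (MSub_pts_factors _ _).2 hn⟩

end ConcreteSite

end OmegaSheaf

namespace OmegaSheaf

open OmegaCompletePartialOrder ConcreteSite

/-! ### The sheaf of an `ω`-concrete sheaf. -/

namespace OmegaConc

variable {C : Type u} [SmallCategory C] {S : ConcreteSite C}

/-- The functions from the points of an object of `C + V₀` to `|X|`: on objects of `C`, those in
the relation of `X`, and on `V` the continuous functions. -/
def rel (X : OmegaConc S) : ∀ a : S.Comb, Set (a.Pt → X.carrier)
  | .of c => X.R c
  | .vert => {g | ωScottContinuous fun n : ℕ∞ => g (ULift.up n)}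

variable {X Y : OmegaConc S}

theorem rel_const (a : S.Comb) (x : X.carrier) : (fun _ => x) ∈ X.rel a := by
  cases a with
  | of c => exact X.const_mem c x
  | vert => exact ωScottContinuous.const

theorem rel_comp {a b : S.Comb} (f : b ⟶ a) {g : a.Pt → X.carrier} (hg : g ∈ X.rel a) :
    (fun x => g (f.1 x)) ∈ X.rel b := by
  have const : (∃ y, ∀ x, f.1 x = y) → (fun x => g (f.1 x)) ∈ X.rel b := by
    rintro ⟨y, hy⟩
    simp only [hy]
    exact rel_const b _
  rcases a with a | _ <;> rcases b with b | _
  · obtain ⟨f, rfl⟩ := incl_full f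
    exact X.comp_mem f hg
  · exact const f.2
  · exact const f.2
  · have hf : ωScottContinuous fun n : ℕ∞ => (f.1 (ULift.up n)).down := f.2
    exact ωScottContinuous.comp (g := fun n : ℕ∞ => g (ULift.up n)) hg hf

theorem rel_glue {a : S.Comb} (T : Presieve a) (hT : T ∈ S.combCoverings a) (g : a.Pt → X.carrier)
    (h : ∀ ⦃b : S.Comb⦄ ⦃f : b ⟶ a⦄, T f → (fun x => g (f.1 x)) ∈ X.rel b) : g ∈ X.rel a := by
  cases a with
  | of c =>
    obtain ⟨R, hR, rfl⟩ := hT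
    exact X.glue_mem R hR g fun d f hf => h (Presieve.map_map hf)
  | vert =>
    obtain rfl := hT
    exact h ⟨⟩

/-- Over `V` this is the interchange of two suprema. It is used to form the extension to `ω̄ × A` as
a supremum of maps. -/
theorem rel_sup {a : S.Comb} (s : Chain (a.Pt → X.carrier)) (hs : ∀ n, s n ∈ X.rel a) :
    ωSup s ∈ X.rel a := by
  cases a with
  | of c => exact X.sup_mem s hs
  | vert =>
    change ∀ n, ωScottContinuous fun k : ℕ∞ => s n (ULift.up k) at hs
    have hm : Monotone fun k : ℕ∞ => (ωSup s : Comb.vert.Pt → X.carrier) (ULift.up k) :=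
      fun _ _ h => ωSup_le_ωSup_of_le fun n => ⟨n, (hs n).monotone h⟩
    refine enat_continuous hm (ωSup_le _ _ fun n => ?_)
    refine (enat_continuous_top (hs n)).le.trans (ωSup_le_ωSup_of_le fun k => ⟨k, ?_⟩)
    exact le_ωSup s n (ULift.up (k : ℕ∞))

theorem rel_map (f : Hom X Y) {a : S.Comb} {g : a.Pt → X.carrier} (hg : g ∈ X.rel a) :
    (fun x => f.toFun (g x)) ∈ Y.rel a := by
  cases a with
  | of c => exact f.map_mem hg
  | vert => exact f.continuous.comp hg

variable (X) in
/-- The presheaf of an `ω`-concrete sheaf. -/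
def presheaf : S.Combᵒᵖ ⥤ Type u where
  obj a := X.rel a.unop
  map f := TypeCat.ofHom fun g => ⟨fun x => g.1 (f.unop.1 x), rel_comp f.unop g.2⟩

-- Each point of `a` is reached by the cover, so the glued function takes its value from any member
-- reaching that point; compatibility at points makes the choice irrelevant.
variable (X) in
theorem presheaf_isSheaf : Presieve.IsSheaf S.comb.topology X.presheaf := by
  refine (Presieve.isSheaf_coverage S.combCoverage _).2 fun {a} T hT s hs => ?_
  change ∀ ⦃b : S.Comb⦄ (f : b ⟶ a), T f → X.rel b at s
  have hs' : ∀ {b b' : S.Comb} (f : b ⟶ a) (f' : b' ⟶ a) (hf : T f) (hf' : T f') (y : b.Pt)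
      (y' : b'.Pt), f.1 y = f'.1 y' → (s f hf).1 y = (s f' hf').1 y' := by
    intro b b' f f' hf hf' y y' e
    have h1 := hs (constMap (.of S.star) y) (constMap (.of S.star) y') hf hf'
      (Comb.hom_ext fun _ => e)
    exact congrFun (congrArg Subtype.val h1) (𝟙 S.star)
  choose b f y hf hy using fun x => S.combCoverings_points hT x
  have key : ∀ {b' : S.Comb} (f' : b' ⟶ a) (hf' : T f'),
      (fun x => (s (f (f'.1 x)) (hf (f'.1 x))).1 (y (f'.1 x))) = (s f' hf').1 :=
    fun f' hf' => funext fun x => hs' _ _ _ _ _ _ (hy _)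
  refine ⟨(⟨fun x => (s (f x) (hf x)).1 (y x), rel_glue T hT _ fun b' f' hf' => ?_⟩ : X.rel a),
    fun b' f' hf' => Subtype.ext (key f' hf'), fun t ht => Subtype.ext (funext fun x => ?_)⟩
  · rw [key f' hf']
    exact (s f' hf').2
  · have h1 := congrFun (congrArg Subtype.val (ht (f x) (hf x))) (y x)
    refine Eq.trans ?_ h1
    exact congrArg t.1 (hy x).symm

variable (S) in
/-- The functor from `ω`-concrete sheaves on `(C, J)` to sheaves on `(C + V₀, J ∪ J_V)`. -/
def realize : OmegaConc S ⥤ S.comb.Sh where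
  obj X := ⟨X.presheaf, (isSheaf_iff_isSheaf_of_type _ _).2 X.presheaf_isSheaf⟩
  map f := ⟨{ app a := TypeCat.ofHom fun g => ⟨fun x => f.toFun (g.1 x), rel_map f g.2⟩ }⟩

end OmegaConc

open OmegaConc

/-! ### Maps into `FX` as functions on global elements; full faithfulness. -/

section Values

variable {C : Type u} [SmallCategory C] {S : ConcreteSite C}

/-- The elements of a sheaf over the terminal object. -/
abbrev Global (Z : S.comb.Sh) : Type u := Z.obj.obj (op (.of S.star))

/-- The restriction of an element of a sheaf along a point. -/
def atPt {Z : S.comb.Sh} {a : S.Comb} (z : Z.obj.obj (op a)) (x : a.Pt) : Global Z :=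
  Z.obj.map (constMap (.of S.star) x).op z

theorem atPt_map {Z : S.comb.Sh} {a b : S.Comb} (f : b ⟶ a) (z : Z.obj.obj (op a)) (x : b.Pt) :
    atPt (Z.obj.map f.op z) x = atPt z (f.1 x) :=
  (Functor.map_comp_apply Z.obj f.op (constMap (.of S.star) x).op z).symm

theorem atPt_app {Z W : S.comb.Sh} (α : Z ⟶ W) {a : S.Comb} (z : Z.obj.obj (op a)) (x : a.Pt) :
    atPt (α.hom.app (op a) z) x = α.hom.app _ (atPt z x) :=
  (NatTrans.naturality_apply α.hom (constMap (.of S.star) x).op z).symm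

theorem atPt_global {Z : S.comb.Sh} (z : Global Z) (x : (Comb.of S.star : S.Comb).Pt) :
    atPt z x = z := by
  have : constMap (.of S.star) x = 𝟙 _ :=
    Comb.hom_ext fun y => S.isTerminal.hom_ext _ _
  rw [atPt, this, op_id, Functor.map_id_apply]

/-- The constant element given by a global element of a sheaf. -/
def constAt {Z : S.comb.Sh} (a : S.Comb) (z : Global Z) : Z.obj.obj (op a) :=
  Z.obj.map (constMap (b := .of S.star) a (𝟙 S.star)).op z

theorem atPt_constAt {Z : S.comb.Sh} (a : S.Comb) (z : Global Z) (x : a.Pt) :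
    atPt (constAt a z) x = z :=
  (atPt_map _ _ _).trans (atPt_global _ _)

variable {X : OmegaConc S} {Z W : S.comb.Sh}

/-- The function given by an element of the sheaf of an `ω`-concrete sheaf. -/
def valAt {a : S.Comb} (z : ((realize S).obj X).obj.obj (op a)) : a.Pt → X.carrier :=
  Subtype.val (p := (· ∈ X.rel a)) z

/-- The function on global elements given by a map to the sheaf of an `ω`-concrete sheaf. -/
def value (α : Z ⟶ (realize S).obj X) (z : Global Z) : X.carrier :=
  valAt (α.hom.app _ z) (𝟙 S.star)

/-- Naturality at the points of `a`: all components of a map into `FX` are determined by the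
component at the terminal object. -/
theorem app_val (α : Z ⟶ (realize S).obj X) {a : S.Comb} (z : Z.obj.obj (op a)) (x : a.Pt) :
    valAt (α.hom.app _ z) x = value α (atPt z x) := by
  rw [value, ← atPt_app α z x]
  rfl

theorem value_mem (α : Z ⟶ (realize S).obj X) {a : S.Comb} (z : Z.obj.obj (op a)) :
    (fun x => value α (atPt z x)) ∈ X.rel a := by
  simp only [← app_val α z]
  exact Subtype.prop (p := (· ∈ X.rel a)) (α.hom.app _ z)

theorem realize_hom_ext {α β : Z ⟶ (realize S).obj X} (h : ∀ z, value α z = value β z) :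
    α = β := by
  ext a z
  refine Subtype.ext (funext fun x => ?_)
  exact (app_val α z x).trans ((h _).trans (app_val β z x).symm)

/-- The map to the sheaf of an `ω`-concrete sheaf given by a function on global elements. -/
def toRealize (v : Global Z → X.carrier)
    (hv : ∀ (a : S.Comb) (z : Z.obj.obj (op a)), (fun x => v (atPt z x)) ∈ X.rel a) :
    Z ⟶ (realize S).obj X :=
  ⟨{ app a := TypeCat.ofHom fun z => ⟨fun x => v (atPt z x), hv a.unop z⟩
     naturality a b f := by
      ext z
      exact Subtype.ext (funext fun x => congrArg v (atPt_map f.unop z x)) }⟩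

theorem value_toRealize (v : Global Z → X.carrier)
    (hv : ∀ (a : S.Comb) (z : Z.obj.obj (op a)), (fun x => v (atPt z x)) ∈ X.rel a)
    (z : Global Z) : value (toRealize v hv) z = v z := congrArg v (atPt_global z _)

theorem value_comp (β : W ⟶ Z) (α : Z ⟶ (realize S).obj X) (z : Global W) :
    value (β ≫ α) z = value α (β.hom.app _ z) := rfl

theorem value_comp_map {Y : OmegaConc S} (α : Z ⟶ (realize S).obj X) (f : X ⟶ Y) (z : Global Z) :
    value (α ≫ (realize S).map f) z = f.toFun (value α z) := rfl

/-- The global element of the sheaf of `X` given by an element of `|X|`. -/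
def globalOf (x : X.carrier) : Global ((realize S).obj X) := ⟨fun _ => x, rel_const _ x⟩

theorem globalOf_val (z : Global ((realize S).obj X)) :
    globalOf (valAt z (𝟙 S.star)) = z :=
  Subtype.ext (funext fun _ =>
    congrArg (valAt z) (S.isTerminal.hom_ext _ _))

theorem value_map {Y : OmegaConc S} (f : X ⟶ Y) (x : X.carrier) :
    value ((realize S).map f) (globalOf x) = f.toFun x := rfl

instance : (realize S).Faithful where
  map_injective {X Y f g} h := OmegaConc.hom_ext fun x => by
    rw [← value_map, ← value_map, h]

/-- The function on global elements preserves sections over every object: those over `V` give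
continuity by `continuous_of_enat`, those over `c` the preservation of `R^c`. -/
instance : (realize S).Full where
  map_surjective {X Y} α := by
    have hR : ∀ {a : S.Comb} {g : a.Pt → X.carrier}, g ∈ X.rel a →
        (fun x => value α (globalOf (g x))) ∈ Y.rel a := fun hg => value_mem α ⟨_, hg⟩
    refine ⟨⟨fun x => value α (globalOf x), continuous_of_enat fun f hf => ?_,
      fun {c g} hg => hR (a := .of c) hg⟩, realize_hom_ext fun z => ?_⟩
    · exact hR (a := .vert) (g := fun n => f n.down) hf
    · rw [← globalOf_val z]
      rfl

theorem realize_isConcrete (X : OmegaConc S) : S.comb.IsConcrete ((realize S).obj X) := by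
  intro a s t h
  refine Subtype.ext (funext fun x => ?_)
  have := congrFun h (constMap (.of S.star) x)
  exact congrFun (congrArg Subtype.val this) (𝟙 S.star)

end Values

end OmegaSheaf

namespace OmegaSheaf

open OmegaCompletePartialOrder ConcreteSite

/-! ### Products. -/

namespace OmegaConc

variable {C : Type u} [SmallCategory C] {S : ConcreteSite C} {ι : Type u}

/-- The product of a family of `ω`-concrete sheaves. -/
def piObj (X : ι → OmegaConc S) : OmegaConc S where
  carrier := ∀ i, (X i).carrier
  R c := {g | ∀ i, (fun x => g x i) ∈ (X i).R c}
  const_mem c x i := (X i).const_mem c (x i)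
  comp_mem h _ hg i := (X i).comp_mem h (hg i)
  glue_mem T hT _ h i := (X i).glue_mem T hT _ fun _ _ hf => h hf i
  sup_mem s hs i := (X i).sup_mem (s.map ⟨fun g x => g x i, fun _ _ h x => h x i⟩)
    fun n => hs n i

theorem mem_rel_piObj {X : ι → OmegaConc S} {a : S.Comb} {g : a.Pt → (piObj X).carrier} :
    g ∈ (piObj X).rel a ↔ ∀ i, (fun x => g x i) ∈ (X i).rel a := by
  cases a with
  | of c => exact Iff.rfl
  | vert => exact ωScottContinuous_iff_apply₂

/-- The projections of a product. -/
def piProj (X : ι → OmegaConc S) (i : ι) : piObj X ⟶ X i where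
  toFun x := x i
  continuous := ωScottContinuous_iff_apply₂.1 ωScottContinuous.id i
  map_mem hg := hg i

/-- The product of a family of `ω`-concrete sheaves is a product in the category. -/
def piIsLimit (X : ι → OmegaConc S) : IsLimit (Fan.mk (piObj X) (piProj X)) :=
  Fan.IsLimit.mk _
    (fun s => ⟨fun x i => (s.proj i).toFun x,
      ωScottContinuous.of_apply₂ fun i => (s.proj i).continuous,
      fun hg i => (s.proj i).map_mem hg⟩)
    (fun _ _ => rfl)
    (fun s _ h => hom_ext fun x => funext fun i =>
      congrArg (fun f : s.pt ⟶ X i => f.toFun x) (h i))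

instance : HasProducts.{u} (OmegaConc S) :=
  hasProducts_of_limit_fans (fun X => Fan.mk (piObj X) (piProj X)) piIsLimit

/-- The map to the sheaf of a product given by maps to the sheaves of the factors. -/
def realizePiLift {X : ι → OmegaConc S} {Z : S.comb.Sh} (α : ∀ i, Z ⟶ (realize S).obj (X i)) :
    Z ⟶ (realize S).obj (piObj X) :=
  toRealize (X := piObj X) (fun z i => value (α i) z) fun _ z =>
    mem_rel_piObj.2 fun i => value_mem (α i) z

theorem value_realizePiLift {X : ι → OmegaConc S} {Z : S.comb.Sh}
    (α : ∀ i, Z ⟶ (realize S).obj (X i)) (z : Global Z) :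
    value (realizePiLift α) z = fun i => value (α i) z :=
  value_toRealize (X := piObj X) _ _ z

/-- The functor to sheaves maps products to products. -/
def realizePiIsLimit (X : ι → OmegaConc S) :
    IsLimit (Fan.mk ((realize S).obj (piObj X)) fun i => (realize S).map (piProj X i)) :=
  Fan.IsLimit.mk _
    (fun s => realizePiLift (Z := s.pt) s.proj)
    (fun s i => realize_hom_ext (Z := s.pt) fun z => (value_comp_map _ (piProj X i) _).trans
      (congrFun (value_realizePiLift (Z := s.pt) s.proj z) i))
    (fun s m h => realize_hom_ext (Z := s.pt) fun z => Eq.trans (funext fun i =>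
      (value_comp_map (Z := s.pt) m (piProj X i) z).symm.trans
        (congrArg (fun f : s.pt ⟶ (realize S).obj (X i) => value f z) (h i)))
      (value_realizePiLift (Z := s.pt) s.proj z).symm)

instance realize_preservesProducts : PreservesLimitsOfShape (Discrete ι) (realize S) where
  preservesLimit {K} :=
    have : PreservesLimit (Discrete.functor (K.obj ∘ Discrete.mk)) (realize S) :=
      preservesLimit_of_preserves_limit_cone (piIsLimit _)
        ((isLimitMapConeFanMkEquiv _ _ _).symm (realizePiIsLimit _))
    preservesLimit_of_iso_diagram (realize S) Discrete.natIsoFunctor.symm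

/-- The comparison map for exponentials requires binary products; the two-element index set is
lifted to the universe of the general families. -/
instance realize_preservesBinaryProducts :
    PreservesLimitsOfShape (Discrete WalkingPair) (realize S) :=
  preservesLimitsOfShape_of_equiv
    (Discrete.equivalence (Equiv.ulift.{u} : ULift WalkingPair ≃ WalkingPair)) (realize S)

end OmegaConc

end OmegaSheaf

namespace OmegaSheaf

open OmegaCompletePartialOrder ConcreteSite

/-! ### Disjoint unions of `ω`cpos. -/

section Sigma

variable {ι : Type*} {α : ι → Type*} [∀ i, OmegaCompletePartialOrder (α i)]

theorem exists_of_sigma_le {i : ι} {x : α i} {y : Σ i, α i} (h : ⟨i, x⟩ ≤ y) :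
    ∃ z : α i, y = ⟨i, z⟩ := by
  obtain ⟨j, y⟩ := y
  obtain ⟨rfl : i = j, -⟩ := Sigma.le_def.1 h
  exact ⟨y, rfl⟩

/-- Elements of different summands are incomparable, so a chain never leaves the summand of its
first term. -/
theorem exists_sigma_chain (c : Chain (Σ i, α i)) {i : ι} {x : α i} (h : c 0 = ⟨i, x⟩) :
    ∃ d : Chain (α i), ∀ n, c n = ⟨i, d n⟩ := by
  choose d hd using fun n => exists_of_sigma_le (h ▸ c.monotone (Nat.zero_le n))
  refine ⟨⟨d, fun m n hmn => ?_⟩, hd⟩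
  rw [← Sigma.mk_le_mk_iff, ← hd, ← hd]
  exact c.monotone hmn

/-- The disjoint union of `ω`cpos. -/
instance sigmaOmegaCPO : OmegaCompletePartialOrder (Σ i, α i) where
  ωSup c := ⟨(c 0).1, ωSup (exists_sigma_chain c (x := (c 0).2) rfl).choose⟩
  le_ωSup c n := by
    have h := (exists_sigma_chain c (x := (c 0).2) rfl).choose_spec
    refine (h n).le.trans ?_
    exact Sigma.mk_le_mk_iff.2 (le_ωSup _ n)
  ωSup_le c x hx := by
    have h := (exists_sigma_chain c (x := (c 0).2) rfl).choose_spec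
    have h0 : (⟨(c 0).1, (c 0).2⟩ : Σ i, α i) ≤ x := hx 0
    obtain ⟨y, rfl⟩ := exists_of_sigma_le h0
    exact Sigma.mk_le_mk_iff.2 (ωSup_le _ _ fun n =>
      Sigma.mk_le_mk_iff.1 ((h n).symm.le.trans (hx n)))

theorem sigma_ωSup (c : Chain (Σ i, α i)) {i : ι} (d : Chain (α i)) (h : ∀ n, c n = ⟨i, d n⟩) :
    ωSup c = ⟨i, ωSup d⟩ := by
  refine le_antisymm (ωSup_le _ _ fun n => (h n).le.trans ?_) ?_
  · exact Sigma.mk_le_mk_iff.2 (le_ωSup d n)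
  · have h0 := le_ωSup c 0
    rw [h 0] at h0
    obtain ⟨y, hy⟩ := exists_of_sigma_le h0
    rw [hy]
    refine Sigma.mk_le_mk_iff.2 (ωSup_le _ _ fun n => Sigma.mk_le_mk_iff.1 ?_)
    rw [← hy, ← h n]
    exact le_ωSup c n

theorem sigma_mk_continuous (i : ι) : ωScottContinuous fun x : α i => (⟨i, x⟩ : Σ i, α i) :=
  ωScottContinuous.of_monotone_map_ωSup ⟨fun _ _ h => Sigma.mk_le_mk_iff.2 h, fun d =>
    (sigma_ωSup (d.map ⟨_, fun _ _ h => Sigma.mk_le_mk_iff.2 h⟩) d fun _ => rfl).symm⟩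

theorem sigma_desc_continuous {β : Type*} [OmegaCompletePartialOrder β] {f : (Σ i, α i) → β}
    (hf : ∀ i, ωScottContinuous fun x : α i => f ⟨i, x⟩) : ωScottContinuous f := by
  have hm : Monotone f := by
    rintro ⟨i, x⟩ y h
    obtain ⟨z, rfl⟩ := exists_of_sigma_le h
    exact (hf i).monotone (Sigma.mk_le_mk_iff.1 h)
  refine ωScottContinuous.of_monotone_map_ωSup ⟨hm, fun c => ?_⟩
  obtain ⟨d, hd⟩ := exists_sigma_chain c (x := (c 0).2) rfl
  rw [sigma_ωSup c d hd]
  refine ((hf _).map_ωSup d).trans (congrArg ωSup ?_)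
  ext n
  exact congrArg f (hd n).symm

/-- All values lie above the value at `0`; in this sense `V` is connected, and its identity cover is
enough for coproducts. -/
theorem exists_of_enat_sigma {f : ℕ∞ → Σ i, α i} (hf : ωScottContinuous f) :
    ∃ (i : ι) (g : ℕ∞ → α i), ωScottContinuous g ∧ ∀ n, f n = ⟨i, g n⟩ := by
  choose g hg using fun n => exists_of_sigma_le (x := (f 0).2) (hf.monotone (zero_le (a := n)))
  have hm : Monotone g := fun m n h => by
    rw [← Sigma.mk_le_mk_iff, ← hg, ← hg]
    exact hf.monotone h
  refine ⟨_, g, enat_continuous hm ?_, hg⟩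
  rw [← Sigma.mk_le_mk_iff, ← hg, enat_continuous_top hf]
  exact (sigma_ωSup _ (finiteValues g hm) fun n => hg n).le

end Sigma

/-! ### Coproducts. -/

namespace OmegaConc

variable {C : Type u} [SmallCategory C] {S : ConcreteSite C} {ι : Type u}

/-- The relations of a coproduct: the functions that are locally in the relation of
one of the summands. -/
def sigmaR (X : ι → OmegaConc S) (c : C) : Set (S.Pts c → Σ i, (X i).carrier) :=
  {g | ∃ T ∈ S.J c, ∀ ⦃d : C⦄ ⦃f : d ⟶ c⦄, T f →
    ∃ i, ∃ h ∈ (X i).R d, ∀ x, g (x ≫ f) = ⟨i, h x⟩}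

theorem mem_R_of_isEmpty (M : MorphismProperty C) [S.IsAdmissible M] (X : OmegaConc S) {c : C}
    (hc : IsEmpty (S.Pts c)) (g : S.Pts c → X.carrier) : g ∈ X.R c :=
  X.glue_mem ⊥ (bot_mem_of_isEmpty hc M) g fun _ _ h => h.elim

variable {X : ι → OmegaConc S}

theorem sigmaR_mk {c : C} {i : ι} {g : S.Pts c → (X i).carrier} (hg : g ∈ (X i).R c) :
    (fun x => (⟨i, g x⟩ : Σ i, (X i).carrier)) ∈ sigmaR X c := by
  refine ⟨_, S.id_mem c, ?_⟩
  rintro _ _ ⟨⟩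
  exact ⟨i, g, hg, fun x => by rw [Category.comp_id]⟩

theorem sigmaR_comp {c d : C} (h : d ⟶ c) {g : S.Pts c → Σ i, (X i).carrier}
    (hg : g ∈ sigmaR X c) : (fun x => g (x ≫ h)) ∈ sigmaR X d := by
  obtain ⟨T, hT, hg⟩ := hg
  obtain ⟨Q, hQ, hQT⟩ := S.J.pullback h T hT
  refine ⟨Q, hQ, fun e k hk => ?_⟩
  obtain ⟨b, i, l, hl, hil⟩ := hQT hk
  obtain ⟨j, r, hr, h'⟩ := hg hl
  refine ⟨j, _, (X j).comp_mem i hr, fun x => ?_⟩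
  change g ((x ≫ k) ≫ h) = _
  rw [Category.assoc, ← hil, ← Category.assoc, h']

/-- The covers that witness membership on the pieces are composed with `T`, by axiom (L). -/
theorem sigmaR_glue {c : C} (T : Presieve c) (hT : T ∈ S.J c) (g : S.Pts c → Σ i, (X i).carrier)
    (h : ∀ ⦃d : C⦄ ⦃f : d ⟶ c⦄, T f → (fun x => g (x ≫ f)) ∈ sigmaR X d) : g ∈ sigmaR X c := by
  choose R hR hR' using h
  refine ⟨_, S.bind_mem T R hT hR, ?_⟩
  rintro d _ ⟨e, k, f, hf, hk, rfl⟩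
  obtain ⟨i, r, hr, h'⟩ := hR' hf hk
  exact ⟨i, r, hr, fun x => by rw [← Category.assoc]; exact h' x⟩

/-- On a piece with a point the local summand must be `i`; on a piece without points the summand is
undetermined, but every function is in the relation. -/
theorem of_mem_sigmaR (M : MorphismProperty C) [S.IsAdmissible M] {c : C} {i : ι}
    {g : S.Pts c → (X i).carrier}
    (hg : (fun x => (⟨i, g x⟩ : Σ i, (X i).carrier)) ∈ sigmaR X c) : g ∈ (X i).R c := by
  obtain ⟨T, hT, h⟩ := hg
  refine (X i).glue_mem T hT g fun d f hf => ?_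
  obtain ⟨j, r, hr, h'⟩ := h hf
  by_cases hd : IsEmpty (S.Pts d)
  · exact mem_R_of_isEmpty M _ hd _
  · rw [not_isEmpty_iff] at hd
    obtain rfl : i = j := congrArg Sigma.fst (h' hd.some)
    convert hr using 2 with x
    exact eq_of_heq (Sigma.mk.inj (h' x)).2

theorem sigmaR_sup (M : MorphismProperty C) [S.IsAdmissible M] {c : C}
    (s : Chain (S.Pts c → Σ i, (X i).carrier)) (hs : ∀ n, s n ∈ sigmaR X c) :
    ωSup s ∈ sigmaR X c := by
  -- The cover for the first term serves the whole chain, since at each point the later terms stay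
  -- in the summand of the first.
  obtain ⟨T, hT, h⟩ := hs 0
  refine ⟨T, hT, fun d f hf => ?_⟩
  obtain ⟨i, r, hr, h0⟩ := h hf
  choose t ht using fun x => exists_sigma_chain (s.map (Pi.evalOrderHom (x ≫ f))) (h0 x)
  let t' : Chain (S.Pts d → (X i).carrier) := ⟨fun n x => t x n, fun m n h x => (t x).monotone h⟩
  refine ⟨i, ωSup t', (X i).sup_mem t' fun n => of_mem_sigmaR M ?_, fun x => ?_⟩
  · convert sigmaR_comp f (hs n) using 2 with x
    exact (ht x n).symm
  · exact sigma_ωSup (s.map (Pi.evalOrderHom (x ≫ f))) (t x) (ht x)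

variable (X) in
/-- The coproduct of a family of `ω`-concrete sheaves. -/
def sigmaObj (M : MorphismProperty C) [S.IsAdmissible M] : OmegaConc S where
  carrier := Σ i, (X i).carrier
  R := sigmaR X
  const_mem c x := sigmaR_mk ((X x.1).const_mem c x.2)
  comp_mem := sigmaR_comp
  glue_mem := sigmaR_glue
  sup_mem := sigmaR_sup M

variable (M : MorphismProperty C) [S.IsAdmissible M]

variable (X) in
/-- The inclusions of the summands of a coproduct. -/
def sigmaIncl (i : ι) : X i ⟶ sigmaObj X M where
  toFun x := (⟨i, x⟩ : Σ i, (X i).carrier)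
  continuous := sigma_mk_continuous (α := fun i => (X i).carrier) i
  map_mem hg := sigmaR_mk hg

variable (X) in
/-- The coproduct of a family of `ω`-concrete sheaves is a coproduct in the category. -/
def sigmaIsColimit : IsColimit (Cofan.mk (sigmaObj X M) (sigmaIncl X M)) :=
  Cofan.IsColimit.mk _
    (fun s => ⟨fun x => (s.inj (Sigma.fst x)).toFun (Sigma.snd x),
      sigma_desc_continuous (α := fun i => (X i).carrier)
        (f := fun x => (s.inj (Sigma.fst x)).toFun (Sigma.snd x)) fun i => (s.inj i).continuous,
      fun {c g} hg => by
        obtain ⟨T, hT, h⟩ := hg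
        refine s.pt.glue_mem T hT _ fun d f hf => ?_
        obtain ⟨i, r, hr, h'⟩ := h hf
        convert (s.inj i).map_mem hr using 2 with x
        rw [h' x]⟩)
    (fun _ _ => rfl)
    (fun s m h => hom_ext fun (x : Σ i, (X i).carrier) =>
      congrArg (fun f : X x.1 ⟶ s.pt => f.toFun x.2) (h x.1))

/-- The element of the sheaf of `X` given by a function in the relation of `X`. -/
def secOf {X : OmegaConc S} {a : S.Comb} (g : a.Pt → X.carrier) (hg : g ∈ X.rel a) :
    ((realize S).obj X).obj.obj (op a) := ⟨g, hg⟩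

/-- The elements of the sheaf of a coproduct come locally from the summands. -/
def sigmaSieve {a : S.Comb} (g : a.Pt → Σ i, (X i).carrier) : Sieve a where
  arrows b f := ∃ i, ∃ h ∈ (X i).rel b, ∀ x, g (f.1 x) = ⟨i, h x⟩
  downward_closed {_ _ _} := by
    rintro ⟨i, h, hh, e⟩ k
    exact ⟨i, _, rel_comp k hh, fun x => e _⟩

/-- Over `C` the sieve contains the cover in the definition of `sigmaR`; over `V` it is maximal by
connectedness. -/
theorem sigmaSieve_mem {a : S.Comb} {g : a.Pt → Σ i, (X i).carrier}
    (hg : g ∈ (sigmaObj X M).rel a) : sigmaSieve g ∈ S.comb.topology a := by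
  cases a with
  | of c =>
    obtain ⟨T, hT, h⟩ := hg
    refine S.comb.topology.superset_covering ?_
      (Coverage.Saturate.of (K := S.comb.J) (.of c) (T.map S.incl) ⟨T, hT, rfl⟩)
    refine (Sieve.generate_le_iff (X := Comb.of c) _ _).2 ?_
    rintro _ _ ⟨hf⟩
    exact h hf
  | vert =>
    obtain ⟨i, h, hh, e⟩ := exists_of_enat_sigma (α := fun i => (X i).carrier) hg
    refine ((Sieve.id_mem_iff_eq_top (S := sigmaSieve g)).1 ?_).symm ▸ S.comb.topology.top_mem _
    exact ⟨i, fun n => h n.down, hh, fun x => e _⟩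

theorem section_eq_of_isEmpty (M : MorphismProperty C) [S.IsAdmissible M] (Y : S.comb.Sh)
    {a : S.Comb} (ha : IsEmpty a.Pt)
    (y z : Y.obj.obj (op a)) : y = z := by
  have h : (⊥ : Sieve a) ∈ S.comb.topology a := by
    have := Coverage.Saturate.of (K := S.comb.J) _ _
      (bot_mem_of_isEmpty (S := S.comb) (c := a) ⟨fun x => ha.false (Comb.pt x)⟩ (S.combMonos M))
    rwa [show Sieve.generate (⊥ : Presieve a) = ⊥ from Sieve.generate_bot] at this
  obtain ⟨_, -, hu⟩ := existsUnique_of_empty_cover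
    ((isSheaf_iff_isSheaf_of_type _ _).1 Y.property) h
  exact (hu y trivial).trans (hu z trivial).symm

section

variable {Y : S.comb.Sh} (β : ∀ i, (realize S).obj (X i) ⟶ Y)

/-- The local definition of the descended map does not depend on the chosen summand: a point
determines it, and without points any two sections of `Y` agree. -/
theorem sigma_desc_eq (M : MorphismProperty C) [S.IsAdmissible M] {a : S.Comb}
    {i j : ι} {g : a.Pt → (X i).carrier} {h : a.Pt → (X j).carrier}
    (hg : g ∈ (X i).rel a) (hh : h ∈ (X j).rel a)
    (e : ∀ x, (⟨i, g x⟩ : Σ i, (X i).carrier) = ⟨j, h x⟩) :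
    (β i).hom.app (op a) (secOf g hg) = (β j).hom.app (op a) (secOf h hh) := by
  by_cases ha : IsEmpty a.Pt
  · exact section_eq_of_isEmpty M Y ha _ _
  · rw [not_isEmpty_iff] at ha
    obtain rfl : i = j := congrArg Sigma.fst (e ha.some)
    obtain rfl : g = h := funext fun x => eq_of_heq (Sigma.mk.inj (e x)).2
    rfl

/-- The sections `β i` of the local pieces of `g` are compatible by `sigma_desc_eq`, and the sheaf
`Y` glues them along `sigmaSieve g`. -/
theorem exists_sigma_desc {a : S.Comb} {g : a.Pt → Σ i, (X i).carrier}
    (hg : g ∈ (sigmaObj X M).rel a) : ∃! y : Y.obj.obj (op a),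
      ∀ {b : S.Comb} (f : b ⟶ a) (i : ι) (h : b.Pt → (X i).carrier) (hh : h ∈ (X i).rel b),
        (∀ x, g (f.1 x) = ⟨i, h x⟩) → Y.obj.map f.op y = (β i).hom.app (op b) (secOf h hh) := by
  have hY := (isSheaf_iff_isSheaf_of_type _ _).1 Y.property (sigmaSieve g) (sigmaSieve_mem M hg)
  have h1 : ∀ (b : S.Comb) (f : b ⟶ a), sigmaSieve g f →
      ∃ i, ∃ h : b.Pt → (X i).carrier, ∃ _ : h ∈ (X i).rel b, ∀ x, g (f.1 x) = ⟨i, h x⟩ := by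
    rintro b f ⟨i, h, hh, e⟩
    exact ⟨i, h, hh, e⟩
  choose i h hh e using h1
  obtain ⟨y, hy, hyu⟩ := hY (fun b f hf =>
      (β (i b f hf)).hom.app (op b) (secOf (h b f hf) (hh b f hf))) (by
    refine (Presieve.compatible_iff_sieveCompatible _).2 ?_
    intro b d f k hf
    refine Eq.trans ?_ (NatTrans.naturality_apply (β (i b f hf)).hom k.op _)
    refine sigma_desc_eq β M _ (rel_comp k (hh b f hf)) fun x => ?_
    rw [← e, ← e]
    rfl)
  refine ⟨y, fun {b} f j r hr e' => ?_, fun z hz => hyu z fun b f hf => ?_⟩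
  · refine (hy f ⟨j, r, hr, e'⟩).trans (sigma_desc_eq β M _ hr fun x => ?_)
    exact (e b f _ x).symm.trans (e' x)
  · exact hz f _ _ _ (e b f hf)

/-- The map from the sheaf of a coproduct given by maps from the sheaves of the summands. -/
def realizeSigmaDesc : (realize S).obj (sigmaObj X M) ⟶ Y :=
  ⟨{ app a := TypeCat.ofHom fun g : (sigmaObj X M).rel a.unop =>
      (exists_sigma_desc M β g.2).choose
     naturality a b k := by
      ext (g : (sigmaObj X M).rel a.unop)
      refine ((exists_sigma_desc M β (rel_comp k.unop g.2)).choose_spec.2 _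
        fun {d} f i h hh e => ?_).symm
      rw [← (exists_sigma_desc M β g.2).choose_spec.1 (f ≫ k.unop) i h hh e]
      exact (Functor.map_comp_apply Y.obj k f.op _).symm }⟩

end

variable (X) in
/-- The functor to sheaves maps coproducts to coproducts. -/
def realizeSigmaIsColimit : IsColimit
    (Cofan.mk ((realize S).obj (sigmaObj X M)) fun i => (realize S).map (sigmaIncl X M i)) :=
  Cofan.IsColimit.mk _ (fun s => realizeSigmaDesc (Y := s.pt) M s.inj)
    (fun s i => by
      ext a (g : (X i).rel a.unop)
      have h : (fun x => (⟨i, g.1 x⟩ : Σ i, (X i).carrier)) ∈ (sigmaObj X M).rel a.unop :=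
        rel_map (sigmaIncl X M i) g.2
      have := (exists_sigma_desc M s.inj h).choose_spec.1 (𝟙 _) i g.1 g.2 fun x => rfl
      rw [op_id, Functor.map_id_apply] at this
      exact this)
    (fun s m h => by
      ext a (g : (sigmaObj X M).rel a.unop)
      refine (exists_sigma_desc M s.inj g.2).choose_spec.2 _ fun {b} f i r hr e => ?_
      rw [← h i]
      refine (NatTrans.naturality_apply m.hom f.op g).symm.trans ?_
      refine congrArg (m.hom.app (op b)) (Subtype.ext (funext fun x => ?_))
      exact e x)

theorem hasCoproducts (M : MorphismProperty C) [S.IsAdmissible M] :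
    HasCoproducts.{u} (OmegaConc S) :=
  hasCoproducts_of_colimit_cofans (fun X => Cofan.mk (sigmaObj X M) (sigmaIncl X M))
    fun X => sigmaIsColimit X M

theorem realize_preservesCoproducts (M : MorphismProperty C) [S.IsAdmissible M] :
    PreservesColimitsOfShape (Discrete ι) (realize S) where
  preservesColimit {K} :=
    have : PreservesColimit (Discrete.functor (K.obj ∘ Discrete.mk)) (realize S) :=
      preservesColimit_of_preserves_colimit_cocone (sigmaIsColimit _ M)
        ((isColimitMapCoconeCofanMkEquiv _ _ _).symm (realizeSigmaIsColimit _ M))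
    preservesColimit_of_iso_diagram (realize S) Discrete.natIsoFunctor.symm

end OmegaConc

end OmegaSheaf

namespace OmegaSheaf

open OmegaCompletePartialOrder ConcreteSite OmegaConc MonoidalCategory CartesianMonoidalCategory

/-! ### Exponentials. -/

section Exponentials

variable {C : Type u} [SmallCategory C] {S : ConcreteSite C} {X Y : OmegaConc S} {Z W : S.comb.Sh}

/-- Pairs of elements of sheaves. -/
def pairAt {a : S.Comb} (w : W.obj.obj (op a)) (z : Z.obj.obj (op a)) :
    (W ⊗ Z).obj.obj (op a) := (w, z)

theorem atPt_pairAt {a : S.Comb} (w : W.obj.obj (op a)) (z : Z.obj.obj (op a)) (x : a.Pt) :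
    atPt (pairAt w z) x = pairAt (a := .of S.star) (atPt w x) (atPt z x) := rfl

theorem whiskerLeft_pairAt {V : S.comb.Sh} (f : Z ⟶ V) {a : S.Comb} (w : W.obj.obj (op a))
    (z : Z.obj.obj (op a)) :
    (W ◁ f).hom.app (op a) (pairAt w z) = pairAt w (f.hom.app (op a) z) := rfl

theorem prodComparison_globalOf (x : X.carrier) (y : Y.carrier) :
    (CartesianMonoidalCategory.prodComparison (realize S) X Y).hom.app _
      (globalOf (X := X ⊗ Y) (x, y)) =
      pairAt (a := .of S.star) (globalOf x) (globalOf y) := rfl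

/-- A global element of `FX × F(Y^X)` is the image of a pair under the product comparison, which
cancels its inverse; what is left is application. -/
theorem value_evaluation (x : X.carrier) (f : Hom X Y) :
    value (inv (CartesianMonoidalCategory.prodComparison (realize S) X ((ihom X).obj Y)) ≫
        (realize S).map ((ihom.ev X).app Y))
      (pairAt (a := .of S.star) (globalOf x) (globalOf (X := (ihom X).obj Y) f)) = f.toFun x := by
  have h := prodComparison_globalOf (S := S) (Y := (ihom X).obj Y) x f
  refine (congrArg _ h.symm).trans ?_
  refine (value_comp
    (CartesianMonoidalCategory.prodComparison (realize S) X ((ihom X).obj Y)) _ _).symm.trans ?_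
  rw [IsIso.hom_inv_id_assoc]
  rfl

/-- Over `C` the hypothesis contains the definition of the relation. Over `V` it suffices to test
constant `k`, because order and suprema of morphisms are pointwise. -/
theorem rel_ihom {a : S.Comb} {g : a.Pt → Hom X Y}
    (h : ∀ {b : S.Comb} (f : b ⟶ a) {k : b.Pt → X.carrier}, k ∈ X.rel b →
      (fun x => (g (f.1 x)).toFun (k x)) ∈ Y.rel b) :
    g ∈ ((ihom X).obj Y).rel a := by
  cases a with
  | of c => exact fun {d} f k hk => h (b := .of d) (S.incl.map f) hk
  | vert =>
    have h1 : ∀ x, ωScottContinuous fun n : ℕ∞ => (g (ULift.up n)).toFun x := fun x =>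
      h (𝟙 Comb.vert) (rel_const _ x)
    have hm : Monotone fun n : ℕ∞ => g (ULift.up n) := fun m n hmn x => (h1 x).monotone hmn
    exact enat_continuous (α := Hom X Y) hm fun x => (enat_continuous_top (h1 x)).le

variable (φ : (realize S).obj X ⊗ Z ⟶ (realize S).obj Y)

theorem value_pair_mem {a : S.Comb} {k : a.Pt → X.carrier} (hk : k ∈ X.rel a)
    (z : Z.obj.obj (op a)) :
    (fun x => value φ (pairAt (a := .of S.star) (globalOf (k x)) (atPt z x))) ∈ Y.rel a :=
  value_mem φ (pairAt (W := (realize S).obj X) (secOf k hk) z)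

/-- The map `X ⟶ Y` obtained by fixing the second argument of a map on sheaves. -/
def fixSecond (z : Global Z) : Hom X Y where
  toFun x := value φ (pairAt (a := .of S.star) (globalOf x) z)
  continuous := continuous_of_enat fun f hf => by
    -- Spreading `z` to a constant section over `V` lets the first argument vary alone.
    have := value_pair_mem φ (a := .vert) (k := fun n => f n.down) hf (constAt .vert z)
    simp only [atPt_constAt] at this
    exact this
  map_mem {c g} hg := by
    have := value_pair_mem φ (a := .of c) (k := g) hg (constAt (.of c) z)
    simp only [atPt_constAt] at this
    exact this

/-- Currying for maps between sheaves of `ω`-concrete sheaves. -/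
def realizeCurry : Z ⟶ (realize S).obj ((ihom X).obj Y) :=
  toRealize (X := (ihom X).obj Y) (fixSecond φ) fun _ z => rel_ihom fun f k hk => by
    have := value_pair_mem φ hk (Z.obj.map f.op z)
    simp only [atPt_map] at this
    exact this

theorem value_whiskerLeft_evaluation (h : Z ⟶ (realize S).obj ((ihom X).obj Y)) (x : X.carrier)
    (z : Global Z) :
    value ((realize S).obj X ◁ h ≫
        inv (CartesianMonoidalCategory.prodComparison (realize S) X ((ihom X).obj Y)) ≫
      (realize S).map ((ihom.ev X).app Y)) (pairAt (a := .of S.star) (globalOf x) z) =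
      Hom.toFun (X := X) (Y := Y) (value h z) x := by
  refine Eq.trans ?_ (value_evaluation x (value h z))
  rw [value_comp, whiskerLeft_pairAt]
  congr 2
  exact (globalOf_val (X := (ihom X).obj Y) (h.hom.app _ z)).symm

/-- This is the universal property of the exponential for `F(Y^X)`: injectivity is read off from
values at pairs of global elements, and `realizeCurry` gives surjectivity. -/
theorem realize_evaluation_bijective (X Y : OmegaConc S) (Z : S.comb.Sh) :
    Function.Bijective fun h : Z ⟶ (realize S).obj ((ihom X).obj Y) =>
      (realize S).obj X ◁ h ≫
        inv (CartesianMonoidalCategory.prodComparison (realize S) X ((ihom X).obj Y)) ≫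
        (realize S).map ((ihom.ev X).app Y) := by
  constructor
  · intro h h' e
    refine realize_hom_ext fun z => OmegaConc.hom_ext (X := X) (Y := Y) fun x => ?_
    have := congrArg (fun f => value f (pairAt (a := .of S.star) (globalOf x) z)) e
    exact (value_whiskerLeft_evaluation h x z).symm.trans
      (this.trans (value_whiskerLeft_evaluation h' x z))
  · intro φ
    refine ⟨realizeCurry φ, realize_hom_ext fun w => ?_⟩
    obtain ⟨p, z⟩ := w
    change Global ((realize S).obj X) at p
    rw [← globalOf_val p]
    refine (value_whiskerLeft_evaluation (realizeCurry φ) _ z).trans ?_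
    exact congrArg (fun f : Hom X Y => f.toFun _)
      (value_toRealize (X := (ihom X).obj Y) (fixSecond φ) _ z)

instance realize_monoidalClosedFunctor : MonoidalClosedFunctor (realize S) where
  comparison_iso X := by
    refine @NatIso.isIso_of_isIso_app _ _ _ _ _ _ _ fun Y => ?_
    -- By Yoneda, and after uncurrying, the exponential comparison becomes the evaluation map just
    -- shown to be bijective.
    rw [isIso_iff_yoneda_map_bijective]
    intro Z
    refine (Function.Bijective.of_comp_iff'
      ((ihom.adjunction ((realize S).obj X)).homEquiv Z ((realize S).obj Y)).symm.bijective _).1 ?_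
    convert realize_evaluation_bijective X Y Z using 2 with h
    refine (MonoidalClosed.uncurry_natural_left h _).trans ?_
    exact congrArg (fun f => (realize S).obj X ◁ h ≫ f) (uncurry_expComparison (realize S) X Y)

end Exponentials

end OmegaSheaf

namespace OmegaSheaf

open OmegaCompletePartialOrder ConcreteSite OmegaConc

/-! ### Comparison of the lifting monads. -/

section Lifting

variable {C : Type u} [SmallCategory C] {S : ConcreteSite C} {M : MorphismProperty C}
  {X Y : OmegaConc S}

open Classical in
/-- The value in `|X| ⊎ {⊥}` of a global partial element of the sheaf of `X`. -/
def liftValue (s : LiftElt (S.combMonos M) ((realize S).obj X).obj (.of S.star)) :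
    WithBot X.carrier :=
  if h : s.dom.Factors (𝟙 _) then
    ((valAt (s.ev (𝟙 _) h) (𝟙 S.star) : X.carrier) :
      WithBot X.carrier)
  else ⊥

theorem liftValue_of_factors {s : LiftElt (S.combMonos M) ((realize S).obj X).obj (.of S.star)}
    (h : s.dom.Factors (𝟙 _)) : liftValue s =
      (valAt (s.ev (𝟙 _) h) (𝟙 S.star) : X.carrier) :=
  dif_pos h

theorem liftValue_of_not_factors {s : LiftElt (S.combMonos M) ((realize S).obj X).obj (.of S.star)}
    (h : ¬ s.dom.Factors (𝟙 _)) : liftValue s = ⊥ := dif_neg h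

theorem liftValue_ne_bot (s : LiftElt (S.combMonos M) ((realize S).obj X).obj (.of S.star)) :
    liftValue s ≠ ⊥ ↔ s.dom.Factors (𝟙 _) := by
  by_cases h : s.dom.Factors (𝟙 _)
  · rw [liftValue_of_factors h]
    exact iff_of_true WithBot.coe_ne_bot h
  · exact iff_of_false (fun h' => h' (liftValue_of_not_factors h)) h

theorem liftValue_map (f : X ⟶ Y)
    (s : LiftElt (S.combMonos M) ((realize S).obj X).obj (.of S.star)) :
    liftValue (LiftElt.map ((realize S).map f).hom s) = WithBot.map f.toFun (liftValue s) := by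
  by_cases h : s.dom.Factors (𝟙 _)
  · rw [liftValue_of_factors h]
    refine (liftValue_of_factors (s := LiftElt.map ((realize S).map f).hom s) h).trans ?_
    exact congrArg (fun v => ((valAt (X := Y) (a := .of S.star) v (𝟙 S.star) : Y.carrier) :
      WithBot Y.carrier)) (LiftElt.map_ev ((realize S).map f).hom s (𝟙 _) h h)
  · rw [liftValue_of_not_factors h]
    exact liftValue_of_not_factors (s := LiftElt.map ((realize S).map f).hom s) h

variable [S.IsAdmissible M]

theorem enat_unbot_continuous {α : Type u} [OmegaCompletePartialOrder α] {f : ℕ∞ → WithBot α}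
    (hf : ωScottContinuous f) {g : ℕ∞ → α} (h : ∀ n, f n = g n) : ωScottContinuous g := by
  have hm : Monotone g := fun m n hmn => by
    rw [← WithBot.coe_le_coe, ← h, ← h]
    exact hf.monotone hmn
  refine enat_continuous hm ?_
  rw [← WithBot.coe_le_coe, ← h, enat_continuous_top hf]
  refine (withBot_ωSup_coe _ 0 (finiteValues g hm) fun n => ?_).le
  rw [Nat.zero_add]
  exact h n

/-- A uniform description over all objects of the combined site, matching partial sections of `FX`.
For `V` it says that continuity into `|X| ⊎ {⊥}` amounts to a Scott-open domain and continuity on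
it. -/
theorem mem_rel_lift_iff {a : S.Comb} {g : a.Pt → WithBot X.carrier} :
    g ∈ (liftObj M X).rel a ↔ ∃ (b : S.Comb) (m : b ⟶ a), S.combMonos M m ∧
      (∀ x, g x ≠ ⊥ ↔ ∃ y, m.1 y = x) ∧ ∃ g' ∈ X.rel b, ∀ y, g (m.1 y) = g' y := by
  cases a with
  | of c =>
    constructor
    · rintro ⟨d, m, hm, h, g', hg', h'⟩
      exact ⟨.of d, S.incl.map m, combMonos_incl hm, h, g', hg', h'⟩
    · rintro ⟨d | _, m, hm, h, g', hg', h'⟩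
      · obtain ⟨m, hm, rfl⟩ := hm
        exact ⟨d, m, hm, h, g', hg', h'⟩
      · exact hm.elim
  | vert =>
    constructor
    · intro hg
      have hc : ωScottContinuous fun n : ℕ∞ => g (ULift.up n) := hg
      -- The domain is Scott-open because a supremum is different from `⊥` only if some term is.
      obtain ⟨b, m, hm, h⟩ := (isCombOpen_vert (M := M) (U := {x | g x ≠ ⊥})).2 ⟨fun x y hxy hx e =>
        hx (le_bot_iff.1 ((hc.monotone hxy).trans e.le)), fun htop => by
          change g (ULift.up ⊤) ≠ ⊥ at htop
          have e := enat_continuous_top hc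
          change g (ULift.up ⊤) = _ at e
          rw [e, withBot_ωSup_ne_bot] at htop
          exact htop⟩
      have hne : ∀ y, g (m.1 y) ≠ ⊥ := fun y => (h _).2 ⟨y, rfl⟩
      refine ⟨b, m, hm, h, fun y => (g (m.1 y)).unbot (hne y), ?_,
        fun y => (WithBot.coe_unbot _ _).symm⟩
      cases b with
      | of b => exact mem_R_of_isEmpty M X ((isInitial_iff_isEmpty (S := S) M b).1 hm) _
      | vert =>
        exact enat_unbot_continuous (g := fun n : ℕ∞ => (g (m.1 (ULift.up n))).unbot (hne _))
          (rel_comp (X := liftObj M X) m hg) fun n => (WithBot.coe_unbot _ _).symm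
    · rintro ⟨b | _, m, hm, h, g', hg', h'⟩
      · have hb := (isInitial_iff_isEmpty (S := S) M b).1 hm
        have e : g = fun _ => ⊥ := funext fun x => by
          by_contra hx
          obtain ⟨y, -⟩ := (h x).1 hx
          exact hb.false y
        exact e ▸ rel_const (X := liftObj M X) _ _
      · obtain ⟨n, hn⟩ := hm
        have hc : ωScottContinuous fun n : ℕ∞ => g' (ULift.up n) := hg'
        have hgn : ∀ x : ℕ∞, g (ULift.up (x + n)) = g' (ULift.up x) := fun x =>
          (congrArg g (hn x)).symm.trans (h' _)
        have hm : Monotone fun n : ℕ∞ => g (ULift.up n) := by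
          intro x y hxy
          by_cases hx : g (ULift.up x) = ⊥
          · exact hx.le.trans bot_le
          · obtain ⟨⟨x'⟩, hx'⟩ := (h _).1 hx
            rw [hn] at hx'
            obtain rfl : x' + n = x := congrArg ULift.down hx'
            obtain ⟨y', rfl⟩ : ∃ y', y = y' + n :=
              ⟨y - n, (tsub_add_cancel_of_le (le_add_self.trans hxy)).symm⟩
            change g _ ≤ g _
            rw [hgn, hgn]
            exact WithBot.coe_le_coe.2
              (hc.monotone ((ENat.addLECancellable_natCast n).add_le_add_iff_right.1 hxy))
        -- As `⊤ + n = ⊤`, the values of `g` and `g'` at `⊤` agree, and the supremum of the finite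
        -- values of `g` is computed on the tail from index `n`, where they are those of `g'`.
        refine enat_continuous hm ?_
        have e := hgn ⊤
        rw [top_add] at e
        have e' := enat_continuous_top hc
        change g' (ULift.up ⊤) = _ at e'
        change g (ULift.up ⊤) ≤ _
        rw [e, e']
        refine (withBot_ωSup_coe (finiteValues _ hm) n (finiteValues _ hc.monotone) fun k => ?_).ge
        change g (ULift.up ((n + k : ℕ) : ℕ∞)) = g' (ULift.up (k : ℕ∞))
        rw [← hgn, Nat.cast_add, add_comm]

theorem liftValue_res_ne_bot {a : S.Comb}
    (s : LiftElt (S.combMonos M) ((realize S).obj X).obj a) (x : a.Pt) :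
    liftValue (LiftElt.res (constMap (.of S.star) x) s) ≠ ⊥ ↔ x ∈ MSub_pts s.dom := by
  rw [liftValue_ne_bot, LiftElt.res_dom, MSub.pull_factors, Category.id_comp]
  rfl

theorem liftValue_res_arrow {a : S.Comb} (s : LiftElt (S.combMonos M) ((realize S).obj X).obj a)
    (y : s.dom.obj.Pt) :
    liftValue (LiftElt.res (constMap (.of S.star) (s.dom.arrow.1 y)) s) =
      (valAt s.val y : X.carrier) := by
  have h : (LiftElt.res (constMap (.of S.star) (s.dom.arrow.1 y)) s).dom.Factors (𝟙 _) :=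
    (liftValue_ne_bot _).1 ((liftValue_res_ne_bot s _).2 ((MSub_pts_iff _ _).2 ⟨y, rfl⟩))
  have e : 𝟙 _ ≫ constMap (.of S.star) (s.dom.arrow.1 y) =
    constMap (.of S.star) y ≫ s.dom.arrow := rfl
  have h2 : s.dom.Factors (constMap (.of S.star) y ≫ s.dom.arrow) :=
    Subobject.factors_comp_arrow _
  rw [liftValue_of_factors h, LiftElt.res_ev, LiftElt.ev_congr s e]
  have e2 : s.dom.factorThru _ h2 = constMap (.of S.star) y := by
    have := StableMonos.mono _ s.dom.mem
    rw [← cancel_mono s.dom.arrow, Subobject.factorThru_arrow]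
  rw [LiftElt.ev, e2]
  rfl

variable (M X) in
/-- The comparison map between the two lifting monads. -/
def liftComparison :
    (S.comb.lift (S.combMonos M)).obj ((realize S).obj X) ⟶ (realize S).obj (liftObj M X) :=
  toRealize (Z := (S.comb.lift (S.combMonos M)).obj ((realize S).obj X)) (X := liftObj M X)
    liftValue fun a (s : LiftElt (S.combMonos M) ((realize S).obj X).obj a) =>
      mem_rel_lift_iff.2 ⟨s.dom.obj, s.dom.arrow, s.dom.mem,
        fun x => (liftValue_res_ne_bot s x).trans (MSub_pts_iff _ x), _, s.val.2,
        liftValue_res_arrow s⟩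

theorem value_liftComparison (s : LiftElt (S.combMonos M) ((realize S).obj X).obj (.of S.star)) :
    value (X := liftObj M X) (liftComparison M X) s = liftValue s :=
  value_toRealize (X := liftObj M X) _ _ _

/-- The points where the value is not `⊥` recover the domain, and the values there recover the
section. -/
theorem liftValue_injective {a : S.Comb} {s t : LiftElt (S.combMonos M) ((realize S).obj X).obj a}
    (h : ∀ x, liftValue (LiftElt.res (constMap (.of S.star) x) s) =
      liftValue (LiftElt.res (constMap (.of S.star) x) t)) : s = t := by
  have hd : s.dom = t.dom := MSub_pts_injective (Set.ext fun x => by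
    rw [← liftValue_res_ne_bot, ← liftValue_res_ne_bot, h])
  obtain ⟨P, u⟩ := s
  obtain ⟨Q, v⟩ := t
  obtain rfl : P = Q := hd
  congr 1
  refine Subtype.ext (funext fun y => ?_)
  have h1 := liftValue_res_arrow (⟨P, u⟩ : LiftElt (S.combMonos M) ((realize S).obj X).obj a) y
  have h2 := liftValue_res_arrow (⟨P, v⟩ : LiftElt (S.combMonos M) ((realize S).obj X).obj a) y
  exact WithBot.coe_injective (h1.symm.trans ((h _).trans h2))

theorem liftValue_surjective {a : S.Comb} {g : a.Pt → WithBot X.carrier}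
    (hg : g ∈ (liftObj M X).rel a) : ∃ s : LiftElt (S.combMonos M) ((realize S).obj X).obj a,
      ∀ x, liftValue (LiftElt.res (constMap (.of S.star) x) s) = g x := by
  obtain ⟨b, m, hm, h, g', hg', h'⟩ := mem_rel_lift_iff.1 hg
  refine ⟨LiftElt.mk' m hm (secOf g' hg'), fun x => ?_⟩
  have hx : x ∈ MSub_pts (LiftElt.mk' (X := ((realize S).obj X).obj) m hm (secOf g' hg')).dom ↔
      g x ≠ ⊥ :=
    (MSub_pts_mk' m hm x).trans (h x).symm
  by_cases hgx : g x = ⊥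
  · rw [hgx]
    by_contra hne
    exact hx.1 ((liftValue_res_ne_bot _ _).1 hne) hgx
  · obtain ⟨y, rfl⟩ := (h x).1 hgx
    have hf := (liftValue_ne_bot _).1 ((liftValue_res_ne_bot _ _).2 (hx.2 hgx))
    rw [liftValue_of_factors hf, LiftElt.res_ev, h']
    have e : 𝟙 _ ≫ constMap (.of S.star) (m.1 y) = constMap (.of S.star) y ≫ m := rfl
    rw [LiftElt.ev_congr _ e, LiftElt.mk'_ev]
    rfl

instance : IsIso (liftComparison M X) := by
  -- Bijectivity can be checked objectwise, since the forgetful functor to presheaves reflects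
  -- isomorphisms.
  have h : IsIso ((sheafToPresheaf _ _).map (liftComparison M X)) := by
    refine @NatIso.isIso_of_isIso_app _ _ _ _ _ _ _ fun a => ?_
    rw [isIso_iff_bijective]
    constructor
    · intro s t h
      exact liftValue_injective fun x => congrFun (congrArg Subtype.val h) x
    · rintro ⟨g, hg⟩
      obtain ⟨s, hs⟩ := liftValue_surjective hg
      exact ⟨s, Subtype.ext (funext hs)⟩
  exact isIso_of_reflects_iso _ (sheafToPresheaf _ _)

theorem liftComparison_natural (f : X ⟶ Y) :
    (S.comb.lift (S.combMonos M)).map ((realize S).map f) ≫ liftComparison M Y =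
      liftComparison M X ≫ (realize S).map ((OmegaConc.lift S M).map f) := by
  refine realize_hom_ext (X := liftObj M Y) fun s => ?_
  refine (value_liftComparison (LiftElt.map ((realize S).map f).hom s)).trans ?_
  refine (liftValue_map f s).trans ?_
  refine Eq.trans ?_ (value_comp_map (X := liftObj M X) (Y := liftObj M Y) (liftComparison M X)
    ((OmegaConc.lift S M).map f) s).symm
  exact congrArg (WithBot.map f.toFun) (value_liftComparison (X := X) s).symm

theorem liftValue_unit (s : Global ((realize S).obj X)) :
    liftValue (LiftElt.unit (M := S.combMonos M) (X := ((realize S).obj X).obj) s) =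
      (valAt s (𝟙 S.star) : X.carrier) := by
  rw [liftValue_of_factors (LiftElt.unit_factors _ _), LiftElt.unit_ev]
  rfl

theorem liftComparison_unit (X : OmegaConc S) :
    (S.comb.lift (S.combMonos M)).η.app ((realize S).obj X) ≫ liftComparison M X =
      (realize S).map ((OmegaConc.lift S M).η.app X) :=
  realize_hom_ext (X := liftObj M X) fun s =>
    (value_liftComparison (LiftElt.unit (X := ((realize S).obj X).obj) s)).trans (liftValue_unit s)

theorem liftComparison_mul (X : OmegaConc S) :
    (S.comb.lift (S.combMonos M)).μ.app ((realize S).obj X) ≫ liftComparison M X =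
      (S.comb.lift (S.combMonos M)).map (liftComparison M X) ≫ liftComparison M (liftObj M X) ≫
        (realize S).map ((OmegaConc.lift S M).μ.app X) := by
  refine realize_hom_ext (X := liftObj M X) fun (s : LiftElt (S.combMonos M)
    (liftPresheaf (S.combMonos M) ((realize S).obj X).obj) (.of S.star)) => ?_
  refine (value_liftComparison (LiftElt.join s)).trans ?_
  refine Eq.trans ?_ (congrArg (joinFun X.carrier) (value_liftComparison (X := liftObj M X)
    (LiftElt.map (liftComparison M X).hom s)).symm)
  have key : ∀ h : s.dom.Factors (𝟙 _),
      liftValue (X := liftObj M X) (LiftElt.map (liftComparison M X).hom s) =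
        ((liftValue (X := X) (s.evLift (𝟙 _) h) : WithBot X.carrier) :
          WithBot (WithBot X.carrier)) := fun h => by
    refine (liftValue_of_factors (X := liftObj M X)
      (s := LiftElt.map (liftComparison M X).hom s) h).trans (congrArg WithBot.some ?_)
    refine Eq.trans ?_ (value_liftComparison (X := X) (s.evLift (𝟙 _) h))
    exact congrArg (fun v => valAt (X := liftObj M X) (a := .of S.star) v (𝟙 S.star))
      (LiftElt.map_ev (liftComparison M X).hom s (𝟙 _) h h)
  -- The three cases, outer element undefined, only the inner one undefined, and both defined, are
  -- those of `joinFun`.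
  by_cases h : s.dom.Factors (𝟙 _)
  · rw [key h]
    change _ = liftValue (s.evLift (𝟙 _) h)
    by_cases h' : (s.evLift (𝟙 _) h).dom.Factors (𝟙 _)
    · rw [liftValue_of_factors h', liftValue_of_factors ((LiftElt.join_factors _ _).2 ⟨h, h'⟩),
        LiftElt.join_ev _ _ h h']
    · rw [liftValue_of_not_factors h', liftValue_of_not_factors fun hj => ?_]
      obtain ⟨_, h2⟩ := (LiftElt.join_factors _ _).1 hj
      exact h' h2
  · rw [liftValue_of_not_factors (s := LiftElt.map (liftComparison M X).hom s) h,
      liftValue_of_not_factors fun hj => h ((LiftElt.join_factors _ _).1 hj).1]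
    rfl

/-- The comparison was built as `L F ⟶ F L`; this inverts its compatibility with the
multiplications. -/
theorem comp_inv_eq_of_square {D : Type*} [Category* D] {P Q R U W : D} (k : P ≅ Q) (l : R ≅ W)
    (t : U ≅ R) {m : U ⟶ P} {n : W ⟶ Q} (h : m ≫ k.hom = t.hom ≫ l.hom ≫ n) :
    n ≫ k.inv = l.inv ≫ t.inv ≫ m := by
  rw [Iso.comp_inv_eq, Category.assoc, Category.assoc, h]
  simp

variable (S M) in
theorem realize_commutesWithMonads :
    CommutesWithMonads (realize S) (OmegaConc.lift S M) (S.comb.lift (S.combMonos M)) := by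
  let k : ∀ X : OmegaConc S, (S.comb.lift (S.combMonos M)).obj ((realize S).obj X) ≅
      (realize S).obj (liftObj M X) := fun X => asIso (liftComparison M X)
  let e : realize S ⋙ (S.comb.lift (S.combMonos M)).toFunctor ≅
      (OmegaConc.lift S M).toFunctor ⋙ realize S :=
    NatIso.ofComponents k fun f => liftComparison_natural f
  refine ⟨e.symm, fun X => ?_, fun X => ?_⟩
  · exact ((Iso.eq_comp_inv (k X)).2 (liftComparison_unit X)).symm
  · exact comp_inv_eq_of_square (k X) (k (liftObj M X))
      ((S.comb.lift (S.combMonos M)).mapIso (k X)) (liftComparison_mul X)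

end Lifting

end OmegaSheaf

namespace OmegaSheaf

/-! ### Rules for computing with partial elements. -/

section PartialElements

variable {C : Type u} [SmallCategory C] {M : MorphismProperty C} [StableMonos M]
  {X Y : Cᵒᵖ ⥤ Type u}

theorem LiftElt.map_mk' (α : X ⟶ Y) {c d : C} (m : d ⟶ c) (hm : M m) (x : X.obj (op d)) :
    map α (mk' m hm x) = mk' m hm (α.app _ x) :=
  congrArg (LiftElt.mk _) (NatTrans.naturality_apply α (MSub.mk'Iso m hm).hom.op x)

/-- The hypotheses `w` and `h` express that the square is a pullback, in the form used here: only
the existence of a factorization through the mono `n` needs checking. -/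
theorem LiftElt.res_mk' {a b c d : C} {k : a ⟶ b} {n : a ⟶ c} {m : b ⟶ d} {f : c ⟶ d}
    (hm : M m) (hn : M n) (w : k ≫ m = n ≫ f)
    (h : ∀ {e : C} (g : e ⟶ c) (l : e ⟶ b), l ≫ m = g ≫ f → ∃ l', l' ≫ n = g)
    (x : X.obj (op b)) : res f (mk' m hm x) = mk' n hn (X.map k.op x) := by
  refine ext' (fun g => ?_) fun g hs ht => ?_
  · rw [res_dom, MSub.pull_factors, mk'_factors, mk'_factors]
    refine ⟨fun ⟨l, hl⟩ => h g l hl, ?_⟩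
    rintro ⟨l, rfl⟩
    exact ⟨l ≫ k, by rw [Category.assoc, Category.assoc, w]⟩
  · obtain ⟨l, rfl⟩ := (mk'_factors _ _ _ _).1 ht
    rw [res_ev, mk'_ev, ev_congr _ (show (l ≫ n) ≫ f = (l ≫ k) ≫ m by
      rw [Category.assoc, Category.assoc, w]), mk'_ev, op_comp, Functor.map_comp_apply]

theorem LiftElt.eq_unit {c : C} (s : LiftElt M X c) (h : s.dom.Factors (𝟙 c)) :
    s = unit (s.ev (𝟙 c) h) := by
  have h' : ∀ {d : C} (g : d ⟶ c), s.dom.Factors (g ≫ 𝟙 c) := fun g =>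
    Subobject.factors_of_factors_right g h
  refine ext' (fun g => iff_of_true (Category.comp_id g ▸ h' g) (unit_factors _ g))
    fun g hs ht => ?_
  rw [unit_ev, ← ev_comp s (𝟙 c) g h (h' g)]
  exact ev_congr _ (Category.comp_id g).symm _

theorem LiftElt.unit_injective {c : C} {x y : X.obj (op c)}
    (h : unit (M := M) x = unit y) : x = y := by
  have key : ∀ (s : LiftElt M X c) (hs : s.dom.Factors (𝟙 c)), s = unit y → s.ev (𝟙 c) hs = y := by
    rintro s hs rfl
    rw [unit_ev, op_id, Functor.map_id_apply]
  have := key _ (unit_factors x (𝟙 c)) h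
  rwa [unit_ev, op_id, Functor.map_id_apply] at this

end PartialElements

open OmegaCompletePartialOrder ConcreteSite OmegaConc MonoidalCategory CartesianMonoidalCategory

/-! ### The sheaves `Lⁿ1` and their generic elements over `V`. -/

section Stages

variable {C : Type u} [SmallCategory C] (S : ConcreteSite C) (M : MorphismProperty C)
  [S.IsAdmissible M]

/-- The sheaves `1, L1, LL1, …`. -/
abbrev finStage (n : ℕ) : S.comb.Sh := stage (S.comb.lift (S.combMonos M)).toFunctor n

variable {S M}

/-- The point `0` is not of the form `x + 1`, so only objects without points map into the restricted
domain. -/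
theorem res_succ_eq_bot {W : S.comb.Sh} {a : S.Comb} (w : W.obj.obj (op .vert))
    {f : a ⟶ .vert} (hf : ∀ x, f.1 x = ULift.up 0) :
    LiftElt.res f (LiftElt.mk' (X := W.obj) (S.vertAdd 1) (combMonos_vertAdd (M := M) 1) w) =
      botElt S.comb.isInitial S.comb.empty_mem_topology
        (IsAdmissible.zero_mem (S := S.comb) (M := S.combMonos M)) W a := by
  refine botElt_unique _ _ _ _ _ fun {d} g => ?_
  rw [LiftElt.res_dom, MSub.pull_factors, LiftElt.mk'_factors]
  constructor
  · rintro ⟨l, hl⟩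
    refine exists_to_zero (S := S.comb) (S.combMonos M) d ⟨fun x => ?_⟩
    have h1 := congrArg (fun k : d ⟶ .vert => (k.1 (x.1 (𝟙 S.star))).down) hl
    have h2 : (l.1 (x.1 (𝟙 S.star))).down + ((1 : ℕ) : ℕ∞) = 0 :=
      h1.trans (congrArg ULift.down (hf _))
    simp at h2
  · rintro ⟨k⟩
    exact ⟨constMap _ (ULift.up 0), Comb.hom_ext fun x => (S.isEmpty_pts_zero.false (k.1 x)).elim⟩

/-- The points of `V`. -/
def vpt (k : ℕ∞) : (Comb.vert : S.Comb).Pt := ULift.up k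

variable (S M) in
/-- The generic element of `Lⁿ1` over `V`. -/
def generic : ∀ n, (finStage S M n).obj.obj (op .vert)
  | 0 => PUnit.unit
  | n + 1 => LiftElt.mk' (X := (finStage S M n).obj) (S.vertAdd 1) (combMonos_vertAdd 1) (generic n)

theorem stageDown_generic : ∀ n,
    (stageDown (S.comb.lift (S.combMonos M)).toFunctor n).hom.app _ (generic S M (n + 1)) =
      generic S M n
  | 0 => rfl
  | n + 1 => (LiftElt.map_mk' _ _ _ _).trans
      (congrArg (LiftElt.mk' (X := (finStage S M n).obj) (S.vertAdd 1) (combMonos_vertAdd 1))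
        (stageDown_generic n))

/-- The point `j` of the generic element of `Lⁿ1` stands for the number `min j n`, the count of
successive definedness steps; passing through `Lᵏ1` caps this number at `k`. -/
theorem stageMap_generic : ∀ k n,
    (stageMap (S.comb.bot (S.combMonos M)) k n).hom.app _ (generic S M k) =
      (finStage S M n).obj.map (S.vertMap _ (continuous_enat_min k)).op (generic S M n)
  | 0, 0 => rfl
  | _ + 1, 0 => rfl
  | 0, n + 1 => (res_succ_eq_bot (generic S M n) fun x =>
      congrArg ULift.up (min_eq_right zero_le)).symm
  | k + 1, n + 1 => by
    refine (LiftElt.map_mk' _ _ _ _).trans ?_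
    refine (congrArg (LiftElt.mk' (X := (finStage S M n).obj) (S.vertAdd 1) (combMonos_vertAdd 1))
        (stageMap_generic k n)).trans ?_
    -- Truncation at `k + 1` restricts along the shift to truncation at `k`, and the square is a
    -- pullback because a truncated number is at least `1` only if the number is.
    refine (LiftElt.res_mk' (combMonos_vertAdd 1) (combMonos_vertAdd 1) ?_ ?_ _).symm
    · refine Comb.hom_ext fun x => congrArg ULift.up ?_
      change min x.down (k : ℕ∞) + ((1 : ℕ) : ℕ∞) = min (x.down + ((1 : ℕ) : ℕ∞)) ((k + 1 : ℕ) : ℕ∞)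
      push_cast
      exact min_add_add_right _ _ _ |>.symm
    · intro e g l hl
      refine combMonos_factors (combMonos_vertAdd (M := M) 1) g fun x => ?_
      have h1 : (l.1 x).down + ((1 : ℕ) : ℕ∞) = min (g.1 x).down ((k + 1 : ℕ) : ℕ∞) :=
        congrArg (fun k : e ⟶ .vert => (k.1 x).down) hl
      have h2 : (1 : ℕ∞) ≤ (g.1 x).down := by
        refine le_trans ?_ (min_le_left _ ((k + 1 : ℕ) : ℕ∞))
        rw [← h1]
        exact le_add_self
      exact ⟨ULift.up ((g.1 x).down - 1), congrArg ULift.up (tsub_add_cancel_of_le h2)⟩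

theorem atPt_generic_zero (n : ℕ) :
    atPt (generic S M (n + 1)) (vpt 0) =
      botElt S.comb.isInitial S.comb.empty_mem_topology
        (IsAdmissible.zero_mem (S := S.comb) (M := S.combMonos M)) (finStage S M n) (.of S.star) :=
  res_succ_eq_bot _ fun _ => rfl

theorem atPt_generic_succ (n : ℕ) (k : ℕ∞) :
    atPt (generic S M (n + 1)) (vpt (k + 1)) =
      LiftElt.unit (M := S.combMonos M) (X := (finStage S M n).obj) (c := .of S.star)
        (atPt (generic S M n) (vpt k)) :=
  LiftElt.res_mk' (M := S.combMonos M) (X := (finStage S M n).obj) (c := .of S.star)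
    (k := constMap (b := .vert) _ (vpt k)) (n := 𝟙 _)
    (m := S.vertAdd 1) (f := constMap (b := .vert) _ (vpt (k + 1))) (combMonos_vertAdd 1)
    (StableMonos.iso _ inferInstance) rfl
    (fun g _ _ => ⟨g, Category.comp_id g⟩) _

/-- An undefined global element is the point `0`; a defined one is a total element of the previous
stage, hence a successor. -/
theorem exists_eq_atPt_generic : ∀ (n : ℕ) (s : Global (finStage S M n)),
    ∃ k : ℕ∞, s = atPt (generic S M n) (vpt k)
  | 0, _ => ⟨0, rfl⟩
  | n + 1, s => by
    change LiftElt (S.combMonos M) (finStage S M n).obj (.of S.star) at s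
    by_cases h : s.dom.Factors (𝟙 _)
    · obtain ⟨k, hk⟩ := exists_eq_atPt_generic n (s.ev (𝟙 _) h)
      refine ⟨k + 1, ?_⟩
      rw [atPt_generic_succ, ← hk]
      exact s.eq_unit h
    · refine ⟨0, ?_⟩
      rw [atPt_generic_zero]
      refine botElt_unique _ _ _ _ _ fun {d} g => ⟨fun hg => ?_, fun ⟨k⟩ => ?_⟩
      · refine exists_to_zero (S := S.comb) (S.combMonos M) d ⟨fun x => h ?_⟩
        have e : x ≫ g = 𝟙 _ := S.comb.isTerminal.hom_ext _ _
        exact e ▸ Subobject.factors_of_factors_right x hg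
      · have hd : IsEmpty d.Pt := ⟨fun x => S.isEmpty_pts_zero.false (k.1 x)⟩
        refine (MSub_pts_factors _ _).2 fun x => (hd.false x).elim

/-- Zero and successors are separated by definedness, and successors are compared one stage lower
because the unit is injective. -/
theorem min_eq_of_atPt_generic_eq : ∀ (n : ℕ) (j k : ℕ∞),
    atPt (generic S M n) (vpt j) = atPt (generic S M n) (vpt k) →
      min j n = min k n
  | 0, _, _, _ => by simp
  | n + 1, j, k, h => by
    have hb : ∀ i : ℕ∞, atPt (generic S M (n + 1)) (vpt 0) ≠
        atPt (generic S M (n + 1)) (vpt (i + 1)) := fun i e => by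
      rw [atPt_generic_zero, atPt_generic_succ] at e
      obtain ⟨l⟩ := (botElt_factors S.comb.isInitial S.comb.empty_mem_topology
        (IsAdmissible.zero_mem (S := S.comb) (M := S.combMonos M)) (finStage S M n) (𝟙 _)).1
        (e ▸ LiftElt.unit_factors _ (𝟙 _))
      exact S.isEmpty_pts_zero.false (l.1 (𝟙 S.star))
    have hc : ∀ i : ℕ∞, i = 0 ∨ ∃ i', i = i' + 1 := fun i => by
      rcases eq_or_ne i 0 with h | h
      · exact Or.inl h
      · exact Or.inr ⟨i - 1, (tsub_add_cancel_of_le (Order.one_le_iff_ne_zero.2 h)).symm⟩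
    obtain rfl | ⟨j, rfl⟩ := hc j <;> obtain rfl | ⟨k, rfl⟩ := hc k
    · rfl
    · exact (hb _ h).elim
    · exact (hb _ h.symm).elim
    · rw [atPt_generic_succ, atPt_generic_succ] at h
      have := min_eq_of_atPt_generic_eq n j k (LiftElt.unit_injective h)
      push_cast
      rw [min_add_add_right, min_add_add_right, this]

theorem stageMap_self : ∀ n, stageMap (S.comb.bot (S.combMonos M)) n n = 𝟙 _
  | 0 => rfl
  | n + 1 => (congrArg _ (stageMap_self n)).trans (CategoryTheory.Functor.map_id _ _)

theorem stageMap_succ : ∀ {n m : ℕ}, n ≤ m → stageMap (S.comb.bot (S.combMonos M)) n (m + 1) =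
    stageMap (S.comb.bot (S.combMonos M)) n m ≫ stageUp (S.comb.bot (S.combMonos M)) m
  | 0, 0, _ => (Category.id_comp _).symm
  | 0, m + 1, _ => by
    have := (S.comb.bot (S.combMonos M)).naturality (stageUp (S.comb.bot (S.combMonos M)) m)
    simp only [Functor.const_obj_obj, Functor.const_obj_map, Category.id_comp] at this
    exact this
  | n + 1, m + 1, h => (congrArg _ (stageMap_succ (Nat.le_of_succ_le_succ h))).trans
      (Functor.map_comp _ _ _)

end Stages

end OmegaSheaf

namespace OmegaSheaf

open OmegaCompletePartialOrder ConcreteSite OmegaConc MonoidalCategory CartesianMonoidalCategory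

/-! ### Limits of sheaves, and colimits in a cartesian closed category. -/

section SheafLimits

variable {C : Type u} [SmallCategory C] {J : GrothendieckTopology C} {K : Type} [SmallCategory K]
  (F : K ⥤ Sheaf J (Type u)) (a : Cᵒᵖ)

/-- Limits of sheaves are computed objectwise, so a section of the limit is a compatible family of
sections. -/
theorem sheaf_limit_ext {x y : (limit F).obj.obj a}
    (h : ∀ k, (limit.π F k).hom.app a x = (limit.π F k).hom.app a y) : x = y := by
  let hl := isLimitOfPreserves (sheafToPresheaf J (Type u) ⋙ (evaluation _ _).obj a)
    (limit.isLimit F)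
  exact (Types.isLimitEquivSections hl).injective (Subtype.ext (funext h))

theorem sheaf_limit_exists (x : ∀ k, (F.obj k).obj.obj a)
    (h : ∀ {k l} (f : k ⟶ l), (F.map f).hom.app a (x k) = x l) :
    ∃ y : (limit F).obj.obj a, ∀ k, (limit.π F k).hom.app a y = x k := by
  let hl := isLimitOfPreserves (sheafToPresheaf J (Type u) ⋙ (evaluation _ _).obj a)
    (limit.isLimit F)
  obtain ⟨y, hy⟩ := (Types.isLimitEquivSections hl).surjective ⟨x, h⟩
  exact ⟨y, fun k => congrFun (congrArg Subtype.val hy) k⟩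

end SheafLimits

/-- By currying, maps out of a product with `colimit F` are maps out of `colimit F`. The factors are
swapped by `β` because `curry` takes the fixed factor on the left. -/
theorem colimit_whiskerRight_hom_ext {D : Type*} [Category* D] [CartesianMonoidalCategory D]
    [MonoidalClosed D] {K : Type*} [Category* K] (F : K ⥤ D) [HasColimit F] (A : D) {X : D}
    {f g : colimit F ⊗ A ⟶ X} (h : ∀ k, colimit.ι F k ▷ A ≫ f = colimit.ι F k ▷ A ≫ g) :
    f = g := by
  let β : ∀ P Q : D, P ⊗ Q ⟶ Q ⊗ P := fun P Q => lift (snd P Q) (fst P Q)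
  have hβ : ∀ P Q, β P Q ≫ β Q P = 𝟙 _ := fun P Q => by ext <;> simp [β]
  have hn : ∀ {P Q : D} (k : P ⟶ Q), A ◁ k ≫ β A Q = β A P ≫ k ▷ A := fun k => by
    ext <;> simp [β]
  have key : MonoidalClosed.curry (β A _ ≫ f) = MonoidalClosed.curry (β A _ ≫ g) := by
    refine colimit.hom_ext fun k => ?_
    rw [← MonoidalClosed.curry_natural_left, ← MonoidalClosed.curry_natural_left,
      ← Category.assoc, ← Category.assoc, hn, Category.assoc, Category.assoc, h]
  have := congrArg (fun k => β _ A ≫ k) (MonoidalClosed.curry_injective key)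
  simpa only [← Category.assoc, hβ, Category.id_comp] using this

/-! ### Completeness. -/

section Complete

variable {C : Type u} [SmallCategory C] (S : ConcreteSite C) (M : MorphismProperty C)
  [S.IsAdmissible M]

/-- The sheaf `ω`. -/
abbrev omegaSheaf : S.comb.Sh := omegaObj (S.comb.bot (S.combMonos M))

/-- The sheaf `ω̄`. -/
abbrev omegaBarSheaf : S.comb.Sh := omegaBarObj (S.comb.lift (S.combMonos M)).toFunctor

/-- The projections of `ω̄`. -/
def omegaBarπ (n : ℕ) : omegaBarSheaf S M ⟶ finStage S M n :=
  limit.π (Functor.ofOpSequence (stageDown (S.comb.lift (S.combMonos M)).toFunctor)) (op n)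

/-- The inclusions into `ω`. -/
def omegaι (n : ℕ) : finStage S M n ⟶ omegaSheaf S M :=
  colimit.ι (Functor.ofSequence (stageUp (S.comb.bot (S.combMonos M)))) n

variable {S M}

theorem omegaBarπ_succ (n : ℕ) :
    omegaBarπ S M (n + 1) ≫ stageDown (S.comb.lift (S.combMonos M)).toFunctor n =
      omegaBarπ S M n := by
  have := limit.w (Functor.ofOpSequence (stageDown (S.comb.lift (S.combMonos M)).toFunctor))
    (homOfLE (Nat.le_succ n)).op
  rwa [Functor.ofOpSequence_map_homOfLE_succ] at this

theorem stageUp_omegaι (n : ℕ) :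
    stageUp (S.comb.bot (S.combMonos M)) n ≫ omegaι S M (n + 1) = omegaι S M n := by
  have := colimit.w (Functor.ofSequence (stageUp (S.comb.bot (S.combMonos M))))
    (homOfLE (Nat.le_succ n))
  rwa [Functor.ofSequence_map_homOfLE_succ] at this

theorem stageMap_omegaι {n m : ℕ} (h : n ≤ m) :
    stageMap (S.comb.bot (S.combMonos M)) n m ≫ omegaι S M m = omegaι S M n := by
  induction m, h using Nat.le_induction with
  | base => rw [stageMap_self, Category.id_comp]
  | succ m h ih => rw [stageMap_succ h, Category.assoc, stageUp_omegaι, ih]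

theorem omegaι_comparison_π (n m : ℕ) :
    omegaι S M n ≫ omegaComparison (S.comb.bot (S.combMonos M)) ≫ omegaBarπ S M m =
      stageMap (S.comb.bot (S.combMonos M)) n m := by
  have h1 : omegaι S M n ≫ omegaComparison (S.comb.bot (S.combMonos M)) =
    stageToOmegaBar (S.comb.bot (S.combMonos M)) n := colimit.ι_desc _ _
  rw [← Category.assoc, h1]
  exact limit.lift_π _ _

theorem exists_genericBar : ∃ w : (omegaBarSheaf S M).obj.obj (op .vert),
    ∀ n, (omegaBarπ S M n).hom.app _ w = generic S M n := by
  have h : ∀ {k l : ℕᵒᵖ} (f : k ⟶ l),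
      ((Functor.ofOpSequence (stageDown (S.comb.lift (S.combMonos M)).toFunctor)).map f).hom.app _
        (generic S M k.unop) = generic S M l.unop := fun f => by
    -- Compatibility is known for consecutive stages; packaging it as a natural transformation from
    -- a point extends it to all maps of the diagram.
    let N : (Functor.const ℕᵒᵖ).obj PUnit.{u + 1} ⟶
        Functor.ofOpSequence (stageDown (S.comb.lift (S.combMonos M)).toFunctor) ⋙
          sheafToPresheaf _ _ ⋙ (evaluation _ _).obj (op Comb.vert) :=
      NatTrans.ofOpSequence (fun n => TypeCat.ofHom fun _ => generic S M n) fun n => by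
        ext x
        refine (stageDown_generic n).symm.trans ?_
        exact (congrArg (fun k : finStage S M (n + 1) ⟶ finStage S M n =>
          k.hom.app (op Comb.vert) (generic S M (n + 1)))
          (Functor.ofOpSequence_map_homOfLE_succ _ n)).symm
    exact (NatTrans.naturality_apply N f PUnit.unit).symm
  obtain ⟨w, hw⟩ := sheaf_limit_exists
    (Functor.ofOpSequence (stageDown (S.comb.lift (S.combMonos M)).toFunctor)) (op .vert)
    (fun k => generic S M k.unop) h
  exact ⟨w, fun n => hw (op n)⟩

variable (S M) in
/-- The generic element of `ω̄` over `V`. -/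
def genericBar : (omegaBarSheaf S M).obj.obj (op .vert) :=
  (exists_genericBar (S := S) (M := M)).choose

theorem omegaBarπ_genericBar (n : ℕ) :
    (omegaBarπ S M n).hom.app _ (genericBar S M) = generic S M n :=
  (exists_genericBar (S := S) (M := M)).choose_spec n

theorem omegaBarπ_atPt (n : ℕ) (k : Comb.vert.Pt) :
    (omegaBarπ S M n).hom.app _ (atPt (genericBar S M) k) = atPt (generic S M n) k := by
  rw [← atPt_app, omegaBarπ_genericBar]

theorem stageMap_atPt (n m : ℕ) (k : ℕ∞) :
    (stageMap (S.comb.bot (S.combMonos M)) n m).hom.app _ (atPt (generic S M n) (vpt k)) =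
      atPt (generic S M m) (vpt (min k n)) := by
  rw [← atPt_app, stageMap_generic, atPt_map]
  rfl

theorem atPt_generic_min (n : ℕ) (k : ℕ∞) :
    atPt (generic S M n) (vpt k) = atPt (generic S M n) (vpt (min k n)) := by
  rw [← stageMap_atPt, stageMap_self]
  rfl

theorem omegaBar_ext {x y : Global (omegaBarSheaf S M)}
    (h : ∀ n, (omegaBarπ S M n).hom.app _ x = (omegaBarπ S M n).hom.app _ y) : x = y :=
  sheaf_limit_ext _ _ fun n => h n.unop

/-- The projections give numbers `k n ≤ n` with `min (k (n + 1)) n = k n`; such a sequence consists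
of the truncations of its supremum, which is the required point. -/
theorem exists_eq_atPt_genericBar (f : Global (omegaBarSheaf S M)) :
    ∃ k : ℕ∞, f = atPt (genericBar S M) (vpt k) := by
  have h : ∀ n : ℕ, ∃ k : ℕ∞, k ≤ n ∧
      (omegaBarπ S M n).hom.app _ f = atPt (generic S M n) (vpt k) := fun n => by
    obtain ⟨k, hk⟩ := exists_eq_atPt_generic n ((omegaBarπ S M n).hom.app _ f)
    exact ⟨min k n, min_le_right _ _, hk.trans (atPt_generic_min n k)⟩
  choose k hkn hk using h
  have hs : ∀ n : ℕ, min (k (n + 1)) n = k n := fun n => by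
    refine (min_eq_of_atPt_generic_eq (S := S) (M := M) n (k (n + 1)) (k n) ?_).trans
      (min_eq_left (hkn n))
    rw [← hk, ← omegaBarπ_succ, ← stageDown_generic, atPt_app, ← hk]
    rfl
  have hm : Monotone k := monotone_nat_of_le_succ fun n => (hs n).ge.trans (min_le_left _ _)
  have hmin : ∀ n m : ℕ, n ≤ m → min (k m) n = k n := fun n m h => by
    induction m, h using Nat.le_induction with
    | base => exact min_eq_left (hkn n)
    | succ m h ih =>
      rw [← ih, ← hs m, min_assoc, min_eq_right (Nat.cast_le.2 h : (n : ℕ∞) ≤ m)]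
  refine ⟨⨆ n, k n, omegaBar_ext fun n => ?_⟩
  rw [hk, omegaBarπ_atPt, atPt_generic_min n (⨆ n, k n)]
  have e : min (⨆ n, k n) (n : ℕ∞) = k n := by
    refine le_antisymm ?_ (le_min (le_iSup k n) (hkn n))
    refine (iSup_inf_eq k (n : ℕ∞)).le.trans (iSup_le fun m => ?_)
    rcases le_total n m with h | h
    · exact (hmin n m h).le
    · exact inf_le_left.trans (hm h)
  rw [e]

/-- Finite points of `ω̄` lie in the image of `ω`; this density gives the uniqueness of extensions.
-/
theorem atPt_genericBar_natCast (n : ℕ) :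
    atPt (genericBar S M) (vpt (n : ℕ∞)) =
      (omegaComparison (S.comb.bot (S.combMonos M))).hom.app _
        ((omegaι S M n).hom.app _ (atPt (generic S M n) (vpt (n : ℕ∞)))) := by
  refine omegaBar_ext fun m => ?_
  rw [omegaBarπ_atPt]
  refine Eq.trans ?_ (congrArg (fun k => k.hom.app _ (atPt (generic S M n) (vpt (n : ℕ∞))))
    (omegaι_comparison_π n m)).symm
  refine Eq.trans ?_ (stageMap_atPt n m n).symm
  rw [min_self]

variable {X : OmegaConc S} {A Y : S.comb.Sh}

/-- The section `y`, paired with a constant section of `A`, is sent to a section of `FX` over `V`,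
and those are continuous functions. -/
theorem value_atPt_continuous (φ : Y ⊗ A ⟶ (realize S).obj X) (y : Y.obj.obj (op .vert))
    (s : Global A) : ωScottContinuous fun k : ℕ∞ =>
      value φ (pairAt (a := .of S.star) (atPt y (vpt k)) s) := by
  have := value_mem φ (pairAt y (constAt .vert s))
  simp only [atPt_pairAt, atPt_constAt] at this
  exact this

/-- The approximations to an extension of `φ` to `ω̄ × A`. -/
def approx (φ : omegaSheaf S M ⊗ A ⟶ (realize S).obj X) (n : ℕ) :
    omegaBarSheaf S M ⊗ A ⟶ (realize S).obj X :=
  (omegaBarπ S M n ≫ omegaι S M n) ▷ A ≫ φ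

theorem value_approx (φ : omegaSheaf S M ⊗ A ⟶ (realize S).obj X) (n : ℕ)
    (f : Global (omegaBarSheaf S M)) (s : Global A) :
    value (approx φ n) (pairAt (a := .of S.star) f s) =
      value φ (pairAt (a := .of S.star)
        ((omegaι S M n).hom.app _ ((omegaBarπ S M n).hom.app _ f)) s) := rfl

theorem omegaι_atPt {n m : ℕ} (h : n ≤ m) (k : ℕ∞) :
    (omegaι S M n).hom.app _ (atPt (generic S M n) (vpt k)) =
      (omegaι S M m).hom.app _ (atPt (generic S M m) (vpt (min k n))) := by
  rw [← stageMap_atPt, ← stageMap_omegaι h]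
  rfl

theorem approx_monotone (φ : omegaSheaf S M ⊗ A ⟶ (realize S).obj X)
    (z : Global (omegaBarSheaf S M ⊗ A)) : Monotone fun n => value (approx φ n) z := by
  obtain ⟨f, s⟩ := z
  change Global (omegaBarSheaf S M) at f
  change Global A at s
  refine fun n m h => ?_
  change value (approx φ n) (pairAt (a := .of S.star) f s) ≤
    value (approx φ m) (pairAt (a := .of S.star) f s)
  -- Seen in stage `m`, the two approximations evaluate `φ` at the points `min k n ≤ k` of one
  -- section over `V`.
  obtain ⟨k, rfl⟩ := exists_eq_atPt_genericBar f
  rw [value_approx, value_approx, omegaBarπ_atPt, omegaBarπ_atPt, omegaι_atPt h]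
  have := (value_atPt_continuous φ ((omegaι S M m).hom.app _ (generic S M m)) s).monotone
    (min_le_left k n)
  simp only [atPt_app] at this
  exact this

/-- The extension of a map from `ω × A` to a map from `ω̄ × A`. -/
def extendBar (φ : omegaSheaf S M ⊗ A ⟶ (realize S).obj X) :
    omegaBarSheaf S M ⊗ A ⟶ (realize S).obj X :=
  toRealize (fun z => ωSup ⟨fun n => value (approx φ n) z, approx_monotone φ z⟩) fun _ z =>
    rel_sup ⟨fun n x => value (approx φ n) (atPt z x), fun _ _ h _ => approx_monotone φ _ h⟩
      fun n => value_mem (approx φ n) z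

theorem value_extendBar (φ : omegaSheaf S M ⊗ A ⟶ (realize S).obj X)
    (z : Global (omegaBarSheaf S M ⊗ A)) :
    value (extendBar φ) z = ωSup ⟨fun n => value (approx φ n) z, approx_monotone φ z⟩ :=
  value_toRealize _ _ z

/-- On elements coming from stage `n`, truncation at a later stage changes nothing, so the chain of
approximations is constant from `n` on and its supremum is the value of `φ`. -/
theorem value_approx_of_le (φ : omegaSheaf S M ⊗ A ⟶ (realize S).obj X) {n m : ℕ} (h : n ≤ m)
    (g : Global (finStage S M n)) (s : Global A) :
    value (approx φ m) (pairAt (a := .of S.star)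
      ((omegaComparison (S.comb.bot (S.combMonos M))).hom.app _ ((omegaι S M n).hom.app _ g)) s) =
      value φ (pairAt (a := .of S.star) ((omegaι S M n).hom.app _ g) s) := by
  have e : omegaι S M n ≫ omegaComparison (S.comb.bot (S.combMonos M)) ≫ omegaBarπ S M m ≫
      omegaι S M m = omegaι S M n := by
    have := congrArg (· ≫ omegaι S M m) (omegaι_comparison_π (S := S) (M := M) n m)
    simp only [Category.assoc] at this
    rw [this, stageMap_omegaι h]
  exact congrArg (fun k => value φ (pairAt (a := .of S.star) (k.hom.app _ g) s)) e

theorem comparison_extendBar (φ : omegaSheaf S M ⊗ A ⟶ (realize S).obj X) :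
    omegaComparison (S.comb.bot (S.combMonos M)) ▷ A ≫ extendBar φ = φ := by
  refine colimit_whiskerRight_hom_ext _ A fun n => realize_hom_ext fun z => ?_
  obtain ⟨g, s⟩ := z
  change Global (finStage S M n) at g
  change Global A at s
  refine (value_extendBar φ (pairAt (a := .of S.star)
      ((omegaComparison (S.comb.bot (S.combMonos M))).hom.app _
        ((omegaι S M n).hom.app _ g)) s)).trans (le_antisymm (ωSup_le _ _ fun m => ?_) ?_)
  · refine (approx_monotone φ _ (le_max_right n m)).trans ?_
    exact (value_approx_of_le φ (le_max_left n m) g s).le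
  · exact (value_approx_of_le φ le_rfl g s).ge.trans
      (le_ωSup ⟨fun n => value (approx φ n) _, approx_monotone φ _⟩ n)

theorem comparison_hom_ext {g h : omegaBarSheaf S M ⊗ A ⟶ (realize S).obj X}
    (e : omegaComparison (S.comb.bot (S.combMonos M)) ▷ A ≫ g =
      omegaComparison (S.comb.bot (S.combMonos M)) ▷ A ≫ h) : g = h := by
  refine realize_hom_ext fun z => ?_
  obtain ⟨f, s⟩ := z
  change Global (omegaBarSheaf S M) at f
  change Global A at s
  obtain ⟨k, rfl⟩ := exists_eq_atPt_genericBar f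
  have hg := value_atPt_continuous g (genericBar S M) s
  have hh := value_atPt_continuous h (genericBar S M) s
  have key : ∀ n : ℕ, value g (pairAt (a := .of S.star) (atPt (genericBar S M) (vpt n)) s) =
      value h (pairAt (a := .of S.star) (atPt (genericBar S M) (vpt n)) s) := fun n => by
    rw [atPt_genericBar_natCast]
    exact congrArg (fun k => value k (pairAt (a := .of S.star)
      ((omegaι S M n).hom.app _ (atPt (generic S M n) (vpt (n : ℕ∞)))) s)) e
  change value g (pairAt (a := .of S.star) _ s) = value h (pairAt (a := .of S.star) _ s)
  -- Both sides are continuous in the point and agree at finite points, so they agree at `⊤` as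
  -- well.
  induction k using ENat.recTopCoe with
  | coe n => exact key n
  | top =>
    refine (enat_continuous_top hg).trans (Eq.trans ?_ (enat_continuous_top hh).symm)
    congr 1
    exact Chain.ext (funext key)

variable (M) in
theorem realize_isLComplete (X : OmegaConc S) :
    S.comb.IsLComplete (S.combMonos M) ((realize S).obj X) := fun _ φ =>
  ⟨extendBar φ, comparison_extendBar φ, fun _ h =>
    comparison_hom_ext (h.trans (comparison_extendBar φ).symm)⟩

end Complete

end OmegaSheaf

end

theorem mainTheorem5 {C : Type u} [SmallCategory C] (S : OmegaSheaf.ConcreteSite C)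
    (M : MorphismProperty C) [S.IsAdmissible M] :
    HasProducts.{u} (OmegaSheaf.OmegaConc S) ∧ HasCoproducts.{u} (OmegaSheaf.OmegaConc S) ∧
    ∃ _ : S.comb.IsAdmissible (S.combMonos M),
    ∃ F : OmegaSheaf.OmegaConc S ⥤ S.comb.Sh,
      F.Full ∧ F.Faithful ∧
      (∀ ι : Type u, PreservesLimitsOfShape (Discrete ι) F) ∧
      (∀ ι : Type u, PreservesColimitsOfShape (Discrete ι) F) ∧
      (∃ _ : PreservesLimitsOfShape (Discrete WalkingPair) F, MonoidalClosedFunctor F) ∧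
      OmegaSheaf.CommutesWithMonads F (OmegaSheaf.OmegaConc.lift S M)
        (S.comb.lift (S.combMonos M)) ∧
      ∀ X : OmegaSheaf.OmegaConc S,
        S.comb.IsConcrete (F.obj X) ∧ S.comb.IsLComplete (S.combMonos M) (F.obj X) :=
  ⟨inferInstance, OmegaSheaf.OmegaConc.hasCoproducts M, inferInstance,
    OmegaSheaf.OmegaConc.realize S, inferInstance, inferInstance, fun _ => inferInstance,
    fun _ => OmegaSheaf.OmegaConc.realize_preservesCoproducts M, ⟨inferInstance, inferInstance⟩,
    OmegaSheaf.realize_commutesWithMonads S M,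
    fun X => ⟨OmegaSheaf.realize_isConcrete X, OmegaSheaf.realize_isLComplete M X⟩⟩
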